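/- **Homological criteria for ascending $\Delta$- and $\bar\Delta$-flags.** *Setting.* Let $\Bbbk$ be an algebraically closed field and $A=\bigoplus_{i,j\in\mathbf I}1_iA1_j$ a $\mathbb Z$-graded locally unital $\Bbbk$-algebra with mutually orthogonal homogeneous idempotents $1_i$, such that every $1_iA_d1_j$ is finite-dimensional and, for fixed $i,j$, zero for $d\ll 0$. Suppose that $A$ has a *graded triangular basis*: a subset $\mathbf S\subseteq\mathbf I$; a poset $\Lambda$ in which every set $\{\mu\le\lambda\}$ is finite; a function $\mathbf S\to\Lambda$, $s\mapsto\dot s$, with finite fibres $\mathbf S_\lambda$; and sets of homogeneous elements $X(i,s)\subset 1_iA1_s$, $H(s,t)\subset 1_sA1_t$, $Y(t,j)\subset 1_tA1_j$ for $i,j\in\mathbf I$, $s,t\in\mathbf S$, such that: the products $xhy$ with $x\in X(i,s)$, $h\in H(s,t)$, $y\in Y(t,j)$ form a basis of $A$; $X(s,s)=Y(s,s)=\{1_s\}$; for $s\ne t$ in $\mathbf S$, $X(s,t)\neq\varnothing\Rightarrow\dot s>\dot t$, $H(s,t)\ne\varnothing\Rightarrow\dot s=\dot t$, $Y(s,t)\ne\varnothing\Rightarrow\dot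 s<\dot t$; and for each $i\in\mathbf I\setminus\mathbf S$ there are only finitely many $s\in\mathbf S$ with $X(i,s)\cup Y(s,i)\neq\varnothing$. *Modules.* $A\text{-gmod}$ is the abelian category of graded left $A$-modules $V=\bigoplus_i 1_iV$ and degree-preserving homomorphisms; $(q^dV)_n=V_{n+d}$. A module $V$ is *locally finite-dimensional* if all $1_iV_n$ are finite-dimensional, and *bounded below* if for each $i$ one has $1_iV_n=0$ for $n\ll0$. $\operatorname{Hom}_A(V,W)_d$ is the space of $A$-module homomorphisms with $f(V_n)\subseteq W_{n+d}$ for all $n$, and $\operatorname{Ext}^n_A(V,W)=\bigoplus_{d\in\mathbb Z}\operatorname{Ext}^n_{A\text{-gmod}}(V,q^dW)$. *Standard objects.* Put $e_\lambda=\sum_{s\in\mathbf S_\lambda}1_s$, let $A_{\ge\lambda}$ be the quotient of $A$ by the two-sided ideal generated by all $e_\mu$ with $\mu\not\ge\lambda$, and $A_\lambda=\bar e_\lambda A_{\ge\lambda}\bar e_\lambda$. For a graded left $A_\lambda$-module $M$ let $j^\lambda_!M=A_{\ge\lambda}\bar e_\lambda\otimes_{A_\lambda}M$ and $j^\lambda_*M=\bigoplus_{i\in\mathbf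 I}\operatorname{Hom}_{A_\lambda}(\bar e_\lambda A_{\ge\lambda}\bar 1_i,M)$ (graded Hom), viewed as graded left $A$-modules. For each $\lambda$ fix a full set $L_\lambda(b)$, $b\in\mathbf B_\lambda$, of irreducible graded left $A_\lambda$-modules up to isomorphism and degree shift, and an injective hull $I_\lambda(b)$ of $L_\lambda(b)$ in $A_\lambda\text{-gmod}$. Let $\mathbf B=\coprod_\lambda\mathbf B_\lambda$ and, for $b\in\mathbf B_\lambda$, $\bar\nabla(b)=j^\lambda_*L_\lambda(b)$ and $\nabla(b)=j^\lambda_*I_\lambda(b)$. *Flags.* A *$\Delta$-layer* (resp. *$\bar\Delta$-layer*) of type $\lambda$ is a module isomorphic to $j^\lambda_!M$ with $M$ a projective (resp. arbitrary) graded left $A_\lambda$-module that is locally finite-dimensional and bounded below. $V$ has a *$\Delta$-flag* (resp. *$\bar\Delta$-flag*) if there are a finite graded filtration $0=V_0\subseteq V_1\subseteq\cdots\subseteq V_n=V$ and distinct weights $\lambda_1,\dots,\lambda_n\in\Lambda$ such that $V_r/V_{r-1}$ is a $\Delta$-layer (resp. $\bar\Delta$-layer) of type $\lambda_r$ for each $r$.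 For a finite lower set $\Gamma\subseteq\Lambda$ put $e_\Gamma=\sum_{\lambda\in\Gamma}e_\lambda$, $V_\Gamma=Ae_\Gamma V$, $A_\Gamma=e_\Gamma Ae_\Gamma$ and $j^\Gamma V=e_\Gamma V$, a graded left $A_\Gamma$-module; flags of $A_\Gamma$-modules are defined in the same way from the idempotents $1_s$ ($\dot s\in\Gamma$) and the weight poset $\Gamma$. $V$ has an *ascending $\Delta$-flag* (resp. *ascending $\bar\Delta$-flag*) if $V_\Gamma$ has a $\Delta$-flag (resp. $\bar\Delta$-flag) for every finite lower set $\Gamma\subseteq\Lambda$. For such $V$ and $b\in\mathbf B$, put $(V:\Delta(b))_q=\sum_{d}\dim\operatorname{Hom}_A(V,\bar\nabla(b))_d\,q^d$ (resp. $(V:\bar\Delta(b))_q=\sum_d\dim\operatorname{Hom}_A(V,\nabla(b))_d\,q^d$). *Theorem.* Let $V$ be a graded left $A$-module that is locally finite-dimensional and bounded below. (1) The following are equivalent: (a) $V$ has an ascending $\Delta$-flag; (b) $j^\Gamma V$ has a $\Delta$-flag for every finite lower set $\Gamma\subseteq\Lambda$; (c) $\operatorname{Ext}^1_A(V,\bar\nabla(b))=0$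 for all $b\in\mathbf B$; (d) $\operatorname{Ext}^n_A(V,\bar\nabla(b))=0$ for all $b\in\mathbf B$ and $n\ge1$. When this holds, for every finite lower set $\Gamma\subseteq\Lambda$ both $V_\Gamma$ and $V/V_\Gamma$ have ascending $\Delta$-flags; for $U\in\{V,V_\Gamma,V/V_\Gamma\}$ and $b\in\mathbf B$ the series $(U:\Delta(b))_q$ has finite coefficients and belongs to $\mathbb N(\!(q^{-1})\!)$; and, for $b\in\mathbf B_\lambda$, $(V_\Gamma:\Delta(b))_q=(V:\Delta(b))_q$ and $(V/V_\Gamma:\Delta(b))_q=0$ if $\lambda\in\Gamma$, while $(V_\Gamma:\Delta(b))_q=0$ and $(V/V_\Gamma:\Delta(b))_q=(V:\Delta(b))_q$ if $\lambda\notin\Gamma$. (2) The same statement holds with $\Delta$ replaced by $\bar\Delta$ and $\bar\nabla(b)$ replaced by $\nabla(b)$ throughout. -/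

import Mathlib

open CategoryTheory CategoryTheory.Limits
open scoped TensorProduct DirectSum

universe u v w

noncomputable section

/-- A locally unital `ℤ`-graded associative `k`-algebra `A = ⨁ i j, 1ᵢ A 1ⱼ` with distinguished
mutually orthogonal homogeneous idempotents `1ᵢ` (`i : I`), presented through its homogeneous
pieces: `piece i j d` is `1ᵢ A_d 1ⱼ`, the algebra itself being the direct sum of all the pieces.
Only the products of `1ᵢ A_d 1ⱼ` with `1ⱼ A_e 1ₗ` have to be recorded, all the others being zero by
orthogonality of the idempotents. -/
structure LUGAlg (k : Type u) [Field k] (I : Type u) where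
  piece : I → I → ℤ → Type u
  [addCommGroup : ∀ i j d, AddCommGroup (piece i j d)]
  [module : ∀ i j d, Module k (piece i j d)]
  one : ∀ i, piece i i 0
  mul : ∀ {i j l : I} {d e f : ℤ}, d + e = f → piece i j d →ₗ[k] piece j l e →ₗ[k] piece i l f
  one_mul : ∀ {i j : I} {d : ℤ} (h : 0 + d = d) (a : piece i j d), mul h (one i) a = a
  mul_one : ∀ {i j : I} {d : ℤ} (h : d + 0 = d) (a : piece i j d), mul h a (one j) = a
  mul_assoc : ∀ {i j l m : I} {d e f de ef g : ℤ} (h₁ : d + e = de) (h₂ : de + f = g)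
    (h₃ : e + f = ef) (h₄ : d + ef = g) (a : piece i j d) (b : piece j l e) (c : piece l m f),
    mul h₂ (mul h₁ a b) c = mul h₄ a (mul h₃ b c)

attribute [instance] LUGAlg.addCommGroup LUGAlg.module

/-- A (locally unital) graded left module `V = ⨁ i, 1ᵢ V` over a locally unital graded algebra,
presented through its homogeneous pieces: `piece i n` is `1ᵢ V_n`. -/
structure GMod {k : Type u} [Field k] {I : Type u} (A : LUGAlg k I) where
  piece : I → ℤ → Type u
  [addCommGroup : ∀ i n, AddCommGroup (piece i n)]
  [module : ∀ i n, Module k (piece i n)]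
  act : ∀ {i j : I} {d n m : ℤ}, d + n = m → A.piece i j d →ₗ[k] piece j n →ₗ[k] piece i m
  one_act : ∀ {i : I} {n : ℤ} (h : 0 + n = n) (v : piece i n), act h (A.one i) v = v
  mul_act : ∀ {i j l : I} {d e f n m p : ℤ} (h₁ : d + e = f) (h₂ : f + n = p)
    (h₃ : e + n = m) (h₄ : d + m = p) (a : A.piece i j d) (b : A.piece j l e) (v : piece l n),
    act h₂ (A.mul h₁ a b) v = act h₄ a (act h₃ b v)

attribute [instance] GMod.addCommGroup GMod.module

variable {k : Type u} [Field k] {I : Type u}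

namespace GMod

variable {A : LUGAlg k I}

/-- A degree-preserving homomorphism of graded modules. -/
structure Hom (V W : GMod A) where
  app : ∀ i n, V.piece i n →ₗ[k] W.piece i n
  app_act : ∀ {i j : I} {d n m : ℤ} (h : d + n = m) (a : A.piece i j d) (v : V.piece j n),
    app i m (V.act h a v) = W.act h a (app j n v)

/-- The category `A-gmod`. -/
instance : Category (GMod A) where
  Hom := Hom
  id V := ⟨fun _ _ => LinearMap.id, fun _ _ _ => rfl⟩
  comp f g := ⟨fun i n => g.app i n ∘ₗ f.app i n, fun h a v => by
    simp [f.app_act, g.app_act]⟩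

section category

variable {V W X : GMod A}

theorem hom_ext {f g : V ⟶ W} (h : ∀ i n v, f.app i n v = g.app i n v) : f = g := by
  have key : ∀ f g : Hom V W, f.app = g.app → f = g := by
    rintro ⟨_, _⟩ ⟨_, _⟩ rfl
    rfl
  exact key f g (funext fun i => funext fun n => LinearMap.ext (h i n))

theorem id_app (i : I) (n : ℤ) (v : V.piece i n) : Hom.app (𝟙 V) i n v = v := rfl

theorem comp_app (f : V ⟶ W) (g : W ⟶ X) (i : I) (n : ℤ) (v : V.piece i n) :
    (f ≫ g).app i n v = g.app i n (f.app i n v) := rfl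

instance : Zero (V ⟶ W) := ⟨⟨fun _ _ => 0, by simp⟩⟩
instance : Add (V ⟶ W) :=
  ⟨fun f g => ⟨fun i n => f.app i n + g.app i n, fun h a v => by simp [f.app_act, g.app_act]⟩⟩
instance : Neg (V ⟶ W) :=
  ⟨fun f => ⟨fun i n => -f.app i n, fun h a v => by simp [f.app_act]⟩⟩

theorem zero_app (i : I) (n : ℤ) (v : V.piece i n) : Hom.app (0 : V ⟶ W) i n v = 0 := rfl
theorem add_app (f g : V ⟶ W) (i : I) (n : ℤ) (v : V.piece i n) :
    (f + g).app i n v = f.app i n v + g.app i n v := rfl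
theorem neg_app (f : V ⟶ W) (i : I) (n : ℤ) (v : V.piece i n) :
    (-f).app i n v = -f.app i n v := rfl

instance : AddCommGroup (V ⟶ W) where
  add_assoc f g h := hom_ext fun i n v => by simp [add_app, add_assoc]
  zero_add f := hom_ext fun i n v => by simp [add_app, zero_app]
  add_zero f := hom_ext fun i n v => by simp [add_app, zero_app]
  add_comm f g := hom_ext fun i n v => by simp [add_app, add_comm]
  neg_add_cancel f := hom_ext fun i n v => by simp [add_app, zero_app, neg_app]
  nsmul := nsmulRec
  zsmul := zsmulRec

instance : Preadditive (GMod A) where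
  add_comp _ _ _ f f' g := hom_ext fun i n v => by simp [comp_app, add_app]
  comp_add _ _ _ f g g' := hom_ext fun i n v => by simp [comp_app, add_app]

end category

/-! ### Graded submodules and quotients -/

/-- A graded submodule of a graded module, given by its homogeneous pieces. -/
structure Sub (V : GMod A) where
  piece : ∀ i n, Submodule k (V.piece i n)
  act_mem : ∀ {i j : I} {d n m : ℤ} (h : d + n = m) (a : A.piece i j d) (v : V.piece j n),
    v ∈ piece j n → V.act h a v ∈ piece i m

variable {V W : GMod A}

/-- A graded submodule, viewed as a graded module. -/
def Sub.toGMod (N : V.Sub) : GMod A where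
  piece i n := N.piece i n
  act {i j d n m} h := LinearMap.mk₂ k
    (fun a v => (⟨V.act h a v, N.act_mem h a v v.2⟩ : N.piece i m))
    (fun _ _ _ => by ext; simp) (fun _ _ _ => by ext; simp)
    (fun _ _ _ => by ext; simp) (fun _ _ _ => by ext; simp)
  one_act h v := by ext; simp [V.one_act]
  mul_act h₁ h₂ h₃ h₄ a b v := by ext; simp [V.mul_act h₁ h₂ h₃ h₄]

/-- The quotient of a graded module by a graded submodule. -/
def Sub.quot (N : V.Sub) : GMod A where
  piece i n := V.piece i n ⧸ N.piece i n
  act {i j d n m} h := LinearMap.flip <| Submodule.liftQ (N.piece j n)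
    ((V.act h).compr₂ (N.piece i m).mkQ).flip (by
      intro v hv
      ext a
      simpa using N.act_mem h a v hv)
  one_act h v := by
    obtain ⟨v, rfl⟩ := Submodule.mkQ_surjective _ v
    exact congrArg (Submodule.mkQ _) (V.one_act h v)
  mul_act h₁ h₂ h₃ h₄ a b v := by
    obtain ⟨v, rfl⟩ := Submodule.mkQ_surjective _ v
    exact congrArg (Submodule.mkQ _) (V.mul_act h₁ h₂ h₃ h₄ a b v)

/-- For graded submodules `N, M` of `V`, the graded submodule `N ∩ M` of `M`. -/
def Sub.within (N M : V.Sub) : M.toGMod.Sub where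
  piece i n := (N.piece i n).comap (M.piece i n).subtype
  act_mem {_ j _ n _} h a v hv := N.act_mem h a (Subtype.val (p := (· ∈ M.piece j n)) v) hv

/-- For graded submodules `N ⊆ M` of `V`, the graded module `M / N`. -/
def Sub.subquot (N M : V.Sub) : GMod A := (N.within M).quot

/-! ### The category of graded modules is abelian -/

section abelian

/-- The inclusion of a graded submodule. -/
def Sub.incl (N : V.Sub) : N.toGMod ⟶ V :=
  Hom.mk (fun i n => (N.piece i n).subtype) fun _ _ _ => rfl

/-- The projection onto a quotient. -/
def Sub.proj (N : V.Sub) : V ⟶ N.quot :=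
  Hom.mk (fun i n => (N.piece i n).mkQ) fun _ _ _ => rfl

/-- Factoring a homomorphism through a graded submodule of the target. -/
def Sub.lift (N : V.Sub) (f : W ⟶ V) (h : ∀ i n v, f.app i n v ∈ N.piece i n) : W ⟶ N.toGMod :=
  Hom.mk (fun i n => (f.app i n).codRestrict _ (h i n)) fun h' a v =>
    Subtype.ext (f.app_act h' a v)

/-- Factoring a homomorphism through a quotient of the source. -/
def Sub.desc (N : V.Sub) (f : V ⟶ W) (h : ∀ i n, ∀ v ∈ N.piece i n, f.app i n v = 0) :
    N.quot ⟶ W :=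
  Hom.mk (fun i n => (N.piece i n).liftQ (f.app i n) (h i n)) fun h' a v => by
    obtain ⟨v, rfl⟩ := Submodule.mkQ_surjective _ v
    exact f.app_act h' a v

/-- The kernel of a homomorphism. -/
def ker (f : V ⟶ W) : V.Sub where
  piece i n := LinearMap.ker (f.app i n)
  act_mem h a v hv := by
    have hv' : f.app _ _ v = 0 := hv
    simp [f.app_act, hv']

/-- The image of a homomorphism. -/
def range (f : V ⟶ W) : W.Sub where
  piece i n := LinearMap.range (f.app i n)
  act_mem := by
    rintro i j d n m h a _ ⟨v, rfl⟩
    exact ⟨V.act h a v, f.app_act h a v⟩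

theorem incl_app (N : V.Sub) (i : I) (n : ℤ) (v : N.piece i n) :
    N.incl.app i n v = (v : V.piece i n) := rfl

theorem proj_app (N : V.Sub) (i : I) (n : ℤ) (v : V.piece i n) :
    N.proj.app i n v = (N.piece i n).mkQ v := rfl

theorem lift_incl (N : V.Sub) (f : W ⟶ V) (h) : N.lift f h ≫ N.incl = f := rfl

theorem proj_desc (N : V.Sub) (f : V ⟶ W) (h) : N.proj ≫ N.desc f h = f := rfl

theorem app_eq_zero {X : GMod A} {f : V ⟶ W} {g : W ⟶ X} (h : f ≫ g = 0) (i : I) (n : ℤ)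
    (v : V.piece i n) : g.app i n (f.app i n v) = 0 := by
  rw [← comp_app, h, zero_app]

theorem mono_of_injective (f : V ⟶ W) (h : ∀ i n, Function.Injective (f.app i n)) : Mono f :=
  ⟨fun a b hab => hom_ext fun i n v => h i n (by
    rw [← comp_app, ← comp_app, hab])⟩

theorem epi_of_surjective (f : V ⟶ W) (h : ∀ i n, Function.Surjective (f.app i n)) : Epi f :=
  ⟨fun a b hab => hom_ext fun i n v => by
    obtain ⟨v, rfl⟩ := h i n v
    rw [← comp_app, ← comp_app, hab]⟩

instance (N : V.Sub) : Mono N.incl := mono_of_injective _ fun _ _ => Subtype.val_injective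

instance (N : V.Sub) : Epi N.proj := epi_of_surjective _ fun _ _ => Submodule.mkQ_surjective _

theorem ker_incl_comp (f : V ⟶ W) : (ker f).incl ≫ f = 0 := hom_ext fun _ _ v => v.2

theorem comp_range_proj (f : V ⟶ W) : f ≫ (range f).proj = 0 :=
  hom_ext fun _ _ v => (Submodule.Quotient.mk_eq_zero _).2 ⟨v, rfl⟩

theorem injective_of_mono (f : V ⟶ W) [Mono f] (i : I) (n : ℤ) :
    Function.Injective (f.app i n) := by
  rw [injective_iff_map_eq_zero]
  intro v hv
  have h0 : (ker f).incl = 0 := by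
    rw [← cancel_mono f, ker_incl_comp, zero_comp]
  have := incl_app (ker f) i n ⟨v, hv⟩
  rw [h0] at this
  exact this.symm

theorem surjective_of_epi (f : V ⟶ W) [Epi f] (i : I) (n : ℤ) :
    Function.Surjective (f.app i n) := by
  intro w
  have h0 : (range f).proj = 0 := by
    rw [← cancel_epi f, comp_range_proj, comp_zero]
  have := proj_app (range f) i n w
  rw [h0] at this
  exact (Submodule.Quotient.mk_eq_zero _).1 this.symm

/-- An isomorphism from a homomorphism that is bijective on all pieces. -/
def isoOfBijective (f : V ⟶ W) (h : ∀ i n, Function.Bijective (f.app i n)) : V ≅ W where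
  hom := f
  inv := Hom.mk (fun i n => (LinearEquiv.ofBijective (f.app i n) (h i n)).symm.toLinearMap)
    fun {i j d n m} h' a w => by
      obtain ⟨v, rfl⟩ := (h j n).2 w
      rw [← f.app_act]
      have e : ∀ i n x, (LinearEquiv.ofBijective (f.app i n) (h i n)).symm (f.app i n x) = x :=
        fun i n x => (LinearEquiv.ofBijective (f.app i n) (h i n)).symm_apply_apply x
      simp only [LinearEquiv.coe_coe, e]
  hom_inv_id := hom_ext fun i n x =>
    (LinearEquiv.ofBijective (f.app i n) (h i n)).symm_apply_apply x
  inv_hom_id := hom_ext fun i n x =>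
    (LinearEquiv.ofBijective (f.app i n) (h i n)).apply_symm_apply x

theorem isIso_of_bijective (f : V ⟶ W) (h : ∀ i n, Function.Bijective (f.app i n)) :
    IsIso f :=
  (isoOfBijective f h).isIso_hom

/-- `ker f` is a kernel of `f`. -/
def kerIsLimit (f : V ⟶ W) : IsLimit (KernelFork.ofι (ker f).incl (ker_incl_comp f)) :=
  KernelFork.IsLimit.ofι _ _ (fun g hg => (ker f).lift g (app_eq_zero hg))
    (fun _ _ => rfl) (fun g hg m hm => by rw [← cancel_mono (ker f).incl, hm]; rfl)

/-- The quotient by the image of `f` is a cokernel of `f`. -/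
def rangeIsColimit (f : V ⟶ W) :
    IsColimit (CokernelCofork.ofπ (range f).proj (comp_range_proj f)) :=
  CokernelCofork.IsColimit.ofπ _ _
    (fun g hg => (range f).desc g (by rintro _ _ _ ⟨v, rfl⟩; exact app_eq_zero hg _ _ v))
    (fun _ _ => rfl) (fun g hg m hm => by rw [← cancel_epi (range f).proj, hm]; rfl)

instance : HasKernels (GMod A) := ⟨fun f => ⟨⟨⟨_, kerIsLimit f⟩⟩⟩⟩

instance : HasCokernels (GMod A) := ⟨fun f => ⟨⟨⟨_, rangeIsColimit f⟩⟩⟩⟩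

/-- The direct product of a finite family of graded modules. -/
def pi {N : ℕ} (F : Fin N → GMod A) : GMod A where
  piece i m := ∀ r, (F r).piece i m
  act h := LinearMap.mk₂ k (fun a v r => (F r).act h a (v r))
    (fun _ _ _ => by ext; simp) (fun _ _ _ => by ext; simp)
    (fun _ _ _ => by ext; simp) (fun _ _ _ => by ext; simp)
  one_act h v := funext fun r => (F r).one_act h (v r)
  mul_act h₁ h₂ h₃ h₄ a b v := funext fun r => (F r).mul_act h₁ h₂ h₃ h₄ a b (v r)

instance : HasFiniteProducts (GMod A) := by
  refine ⟨fun n => ⟨fun F => ?_⟩⟩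
  suffices key : ∀ G : Fin n → GMod A, HasProduct G by
    have := key (F.obj ∘ Discrete.mk)
    exact hasLimit_of_iso Discrete.natIsoFunctor.symm
  intro G
  refine ⟨⟨⟨Fan.mk (pi G) fun r =>
    Hom.mk (fun i m => LinearMap.proj r) fun _ _ _ => rfl, Fan.IsLimit.mk _
      (fun s => Hom.mk (fun i m => LinearMap.pi fun r => (s.proj r).app i m) fun h a v =>
        funext fun r => (s.proj r).app_act h a v) ?_ ?_⟩⟩⟩
  · intro s r
    rfl
  · intro s m hm
    refine hom_ext fun i n v => funext fun r => ?_
    have := congrArg (fun f => Hom.app f i n v) (hm r)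
    exact this

/-- A monomorphism is a kernel of its cokernel. -/
@[reducible] def normalMono (f : V ⟶ W) [Mono f] : NormalMono f where
  Z := (range f).quot
  g := (range f).proj
  w := comp_range_proj f
  isLimit :=
    let e : V ≅ (ker (range f).proj).toGMod := isoOfBijective
      ((ker (range f).proj).lift f (app_eq_zero (comp_range_proj f))) fun i n => by
        refine ⟨fun x y h => injective_of_mono f i n (congrArg Subtype.val h), ?_⟩
        rintro ⟨w, hw⟩
        obtain ⟨v, rfl⟩ := (Submodule.Quotient.mk_eq_zero _).1 hw
        exact ⟨v, rfl⟩
    IsKernel.isoKernel _ _ (kerIsLimit _) e rfl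

/-- An epimorphism is a cokernel of its kernel. -/
@[reducible] def normalEpi (f : V ⟶ W) [Epi f] : NormalEpi f where
  W := (ker f).toGMod
  g := (ker f).incl
  w := ker_incl_comp f
  isColimit :=
    let e : (range (ker f).incl).quot ≅ W := isoOfBijective
      ((range (ker f).incl).desc f (by
        rintro i n _ ⟨v, rfl⟩
        exact v.2)) fun i n => by
        constructor
        · rw [injective_iff_map_eq_zero]
          intro x hx
          obtain ⟨x, rfl⟩ := Submodule.mkQ_surjective _ x
          exact (Submodule.Quotient.mk_eq_zero _).2 ⟨⟨x, hx⟩, rfl⟩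
        · intro w
          obtain ⟨v, rfl⟩ := surjective_of_epi f i n w
          exact ⟨Submodule.mkQ _ v, rfl⟩
    IsCokernel.cokernelIso _ _ (rangeIsColimit _) e rfl

instance : Abelian (GMod A) where
  normalMonoOfMono f _ := ⟨normalMono f⟩
  normalEpiOfEpi f _ := ⟨normalEpi f⟩

instance : HasExt.{u + 1} (GMod A) := HasExt.standard _

end abelian

end GMod

/-! ### Degree shifts, homomorphisms of arbitrary degree, finiteness conditions -/

namespace GMod

variable {A : LUGAlg k I}

/-- The degree shift `q^t V`, with `(q^t V)_n = V_{n+t}`. -/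
def shift (t : ℤ) (V : GMod A) : GMod A where
  piece i n := V.piece i (n + t)
  act {i j d n m} h := V.act (show d + (n + t) = m + t by omega)
  one_act _ v := V.one_act _ v
  mul_act _ _ _ _ a b v := V.mul_act _ _ _ _ a b v

/-- `Hom_A(V, W)_d`: the `A`-module homomorphisms `f : V → W` such that `f(V_n) ⊆ W_{n+d}`. -/
def homDeg (V W : GMod A) (d : ℤ) :
    Submodule k (∀ (i : I) (n : ℤ), V.piece i n →ₗ[k] W.piece i (n + d)) where
  carrier := {f | ∀ (i j : I) (e n m : ℤ) (h : e + n = m) (a : A.piece i j e) (v : V.piece j n),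
    f i m (V.act h a v) = W.act (show e + (n + d) = m + d by omega) a (f j n v)}
  add_mem' hf hg := by
    intro i j e n m h a v
    simp [hf i j e n m h a v, hg i j e n m h a v]
  zero_mem' := by
    intro i j e n m h a v
    simp
  smul_mem' c f hf := by
    intro i j e n m h a v
    simp [hf i j e n m h a v]

/-- `V` is locally finite-dimensional: every `1ᵢ V_n` is finite-dimensional. -/
def LocallyFinite (V : GMod A) : Prop := ∀ i n, FiniteDimensional k (V.piece i n)

/-- `V` is bounded below: for each `i`, `1ᵢ V_n = 0` for all sufficiently negative `n`. -/
def BoundedBelow (V : GMod A) : Prop := ∀ i, ∃ N : ℤ, ∀ n < N, Subsingleton (V.piece i n)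

/-- `Ext^n_A(V, W) = 0`, where `Ext^n_A(V, W) = ⨁ d, Ext^n(V, q^d W)` with the summands computed
in the abelian category `A-gmod`. -/
def ExtVanishes (V W : GMod A) (n : ℕ) : Prop :=
  ∀ d : ℤ, Subsingleton (Abelian.Ext V (W.shift d) n)

/-- `f : L ⟶ E` exhibits `E` as an injective hull of `L` in `A-gmod`: `E` is injective, `f` is
a monomorphism, and the image of `f` is essential (it meets every nonzero graded submodule of
`E` nontrivially). -/
def IsInjectiveHull {L E : GMod A} (f : L ⟶ E) : Prop :=
  Injective E ∧ Mono f ∧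
    ∀ N : E.Sub, (∀ i n, N.piece i n ⊓ (range f).piece i n = ⊥) → ∀ i n, N.piece i n = ⊥

end GMod

/-! ### Quotients and idempotent truncations of algebras -/

namespace LUGAlg

/-- `A` is locally finite-dimensional and bounded below. -/
def FiniteBelow (A : LUGAlg k I) : Prop :=
  (∀ i j d, FiniteDimensional k (A.piece i j d)) ∧
    ∀ i j, ∃ N : ℤ, ∀ d < N, Subsingleton (A.piece i j d)

/-- A homogeneous two-sided ideal, given by its homogeneous pieces `1ᵢ J_d 1ⱼ`. -/
structure TwoIdeal (A : LUGAlg k I) where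
  piece : ∀ i j d, Submodule k (A.piece i j d)
  mul_mem_left : ∀ {i j l : I} {d e f : ℤ} (h : d + e = f) (a : A.piece i j d)
    (b : A.piece j l e), b ∈ piece j l e → A.mul h a b ∈ piece i l f
  mul_mem_right : ∀ {i j l : I} {d e f : ℤ} (h : d + e = f) (a : A.piece i j d)
    (b : A.piece j l e), a ∈ piece i j d → A.mul h a b ∈ piece i l f

/-- The quotient of a locally unital graded algebra by a homogeneous two-sided ideal. -/
def quot (A : LUGAlg k I) (J : A.TwoIdeal) : LUGAlg k I where
  piece i j d := A.piece i j d ⧸ J.piece i j d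
  one i := (J.piece i i 0).mkQ (A.one i)
  mul {i j l d e f} h := Submodule.liftQ (J.piece i j d)
    (LinearMap.flip <| Submodule.liftQ (J.piece j l e)
      ((A.mul h).compr₂ (J.piece i l f).mkQ).flip (by
        intro b hb
        ext a
        simpa using J.mul_mem_left h a b hb)) (by
      intro a ha
      refine LinearMap.ext fun b => ?_
      obtain ⟨b, rfl⟩ := Submodule.mkQ_surjective _ b
      exact (Submodule.Quotient.mk_eq_zero _).2 (J.mul_mem_right h a b ha))
  one_mul h a := by
    obtain ⟨a, rfl⟩ := Submodule.mkQ_surjective _ a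
    exact congrArg (Submodule.mkQ _) (A.one_mul h a)
  mul_one h a := by
    obtain ⟨a, rfl⟩ := Submodule.mkQ_surjective _ a
    exact congrArg (Submodule.mkQ _) (A.mul_one h a)
  mul_assoc h₁ h₂ h₃ h₄ a b c := by
    obtain ⟨a, rfl⟩ := Submodule.mkQ_surjective _ a
    obtain ⟨b, rfl⟩ := Submodule.mkQ_surjective _ b
    obtain ⟨c, rfl⟩ := Submodule.mkQ_surjective _ c
    exact congrArg (Submodule.mkQ _) (A.mul_assoc h₁ h₂ h₃ h₄ a b c)

/-- The two-sided ideal generated by the idempotents `1ₛ` with `s ∈ T`: the piece `1ᵢ J_d 1ⱼ` is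
spanned by the products `a 1ₛ b = a b` with `a ∈ 1ᵢ A 1ₛ`, `b ∈ 1ₛ A 1ⱼ` homogeneous, `s ∈ T`. -/
def idealOf (A : LUGAlg k I) (T : Set I) : A.TwoIdeal where
  piece i j d := Submodule.span k {x | ∃ s ∈ T, ∃ (m n : ℤ) (h : m + n = d)
    (a : A.piece i s m) (b : A.piece s j n), x = A.mul h a b}
  mul_mem_left {i j l d e f} h c x hx := by
    induction hx using Submodule.span_induction with
    | mem x hx =>
      obtain ⟨s, hs, m, n, h', a, b, rfl⟩ := hx
      refine Submodule.subset_span ⟨s, hs, d + m, n, by omega, A.mul rfl c a, b, ?_⟩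
      exact (A.mul_assoc rfl (by omega) h' h c a b).symm
    | zero => simp
    | add x y _ _ hx hy => simpa using add_mem hx hy
    | smul t x _ hx => simpa using Submodule.smul_mem _ t hx
  mul_mem_right {i j l d e f} h x c hx := by
    induction hx using Submodule.span_induction with
    | mem x hx =>
      obtain ⟨s, hs, m, n, h', a, b, rfl⟩ := hx
      refine Submodule.subset_span ⟨s, hs, m, n + e, by omega, a, A.mul rfl b c, ?_⟩
      exact A.mul_assoc h' h rfl (by omega) a b c
    | zero => simp
    | add x y _ _ hx hy => simpa using add_mem hx hy
    | smul t x _ hx => simpa using Submodule.smul_mem _ t hx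

/-- The idempotent truncation `⨁ s t, 1ₛ A 1ₜ` with `s, t ∈ T`, with distinguished idempotents
`1ₛ` (`s ∈ T`). For finite `T` this is the unital algebra `e A e` with `e = ∑ s ∈ T, 1ₛ`. -/
abbrev corner (A : LUGAlg k I) (T : Set I) : LUGAlg k T where
  piece s t d := A.piece s t d
  one s := A.one s
  mul h := A.mul h
  one_mul h a := A.one_mul h a
  mul_one h a := A.mul_one h a
  mul_assoc h₁ h₂ h₃ h₄ a b c := A.mul_assoc h₁ h₂ h₃ h₄ a b c

end LUGAlg

/-! ### Inflation, truncation and its adjoints -/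

namespace GMod

variable {A : LUGAlg k I}

/-- A module over a quotient algebra, viewed as a module over the algebra itself. -/
def inflate (J : A.TwoIdeal) (V : GMod (A.quot J)) : GMod A where
  piece := V.piece
  act h := (V.act h).comp (J.piece _ _ _).mkQ
  one_act h v := V.one_act h v
  mul_act h₁ h₂ h₃ h₄ a b v := V.mul_act h₁ h₂ h₃ h₄ ((J.piece _ _ _).mkQ a) ((J.piece _ _ _).mkQ b) v

/-- The idempotent truncation functor on objects: `V ↦ e V = ⨁ s ∈ T, 1ₛ V`. -/
abbrev truncate (T : Set I) (V : GMod A) : GMod (A.corner T) where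
  piece s n := V.piece s n
  act h := V.act h
  one_act h v := V.one_act h v
  mul_act h₁ h₂ h₃ h₄ a b v := V.mul_act h₁ h₂ h₃ h₄ a b v

/-- The submodule `A e V` of `V` generated by `e V = ⨁ s ∈ T, 1ₛ V`. -/
def generatedBy (T : Set I) (V : GMod A) : V.Sub where
  piece i p := Submodule.span k {x | ∃ s ∈ T, ∃ (m n : ℤ) (h : m + n = p)
    (a : A.piece i s m) (v : V.piece s n), x = V.act h a v}
  act_mem {i j d n m} h c x hx := by
    induction hx using Submodule.span_induction with
    | mem x hx =>
      obtain ⟨s, hs, m', n', h', a, v, rfl⟩ := hx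
      refine Submodule.subset_span ⟨s, hs, d + m', n', by omega, A.mul rfl c a, v, ?_⟩
      exact (V.mul_act rfl (by omega) h' h c a v).symm
    | zero => simp
    | add x y _ _ hx hy => simpa using add_mem hx hy
    | smul t x _ hx => simpa using Submodule.smul_mem _ t hx

section jShriek

variable {T : Set I} (V : GMod (A.corner T))

/-- The index set of the pieces `1ᵢ A_m 1ₜ ⊗ 1ₜ V_n`, `t ∈ T`, `m + n = d`, of the degree `d` part
of `1ᵢ (A e ⊗ V)`. -/
abbrev TensorIdx (T : Set I) (d : ℤ) : Type u := {p : T × ℤ × ℤ // p.2.1 + p.2.2 = d}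

/-- The degree `d` part of `1ᵢ A e ⊗_k V`, where `e V = V`, restricted to
`⨁ t ∈ T, 1ᵢ A 1ₜ ⊗_k 1ₜ V`. -/
abbrev TensorPiece (i : I) (d : ℤ) : Type u :=
  ⨁ p : TensorIdx T d, A.piece i p.1.1 p.1.2.1 ⊗[k] V.piece p.1.1 p.1.2.2

open Classical in
/-- The bilinear map `(a, v) ↦ a ⊗ v`, for `a ∈ 1ᵢ A_m 1ₜ`, `v ∈ 1ₜ V_n`, `m + n = d`. -/
def pureTensor (i : I) {m n d : ℤ} (t : T) (h : m + n = d) :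
    A.piece i t m →ₗ[k] V.piece t n →ₗ[k] TensorPiece V i d :=
  (TensorProduct.mk k (A.piece i t m) (V.piece t n)).compr₂
    (DirectSum.lof k (TensorIdx T d)
      (fun p => A.piece i p.1.1 p.1.2.1 ⊗[k] V.piece p.1.1 p.1.2.2) ⟨(t, m, n), h⟩)

/-- The span of the relations `a b ⊗ v = a ⊗ b v` with `a ∈ A e`, `b ∈ e A e`, `v ∈ V`. -/
def balanced (i : I) (d : ℤ) : Submodule k (TensorPiece V i d) :=
  Submodule.span k {x | ∃ (s t : T) (m e n m' n' : ℤ) (h₁ : m + e = m') (h₂ : e + n = n')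
    (h₃ : m' + n = d) (h₄ : m + n' = d) (a : A.piece i s m) (b : A.piece s t e)
    (v : V.piece t n),
    x = pureTensor V i t h₃ (A.mul h₁ a b) v -
      pureTensor V i s h₄ a (V.act (i := s) (j := t) h₂ b v)}

open Classical in
/-- Left multiplication by `A` on `A e ⊗_k V`. -/
def tensorAct {i j : I} {d n m : ℤ} (h : d + n = m) :
    A.piece i j d →ₗ[k] TensorPiece V j n →ₗ[k] TensorPiece V i m :=
  LinearMap.flip <| DirectSum.toModule k _ _ fun p => TensorProduct.lift <|
    LinearMap.mk₂ k (fun a v =>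
      ((pureTensor V i (m := d + p.1.2.1) p.1.1 (by have := p.2; omega)).flip v).comp
        ((A.mul rfl).flip a))
      (fun _ _ _ => by ext; simp) (fun _ _ _ => by ext; simp)
      (fun _ _ _ => by ext; simp) (fun _ _ _ => by ext; simp)

theorem tensorAct_pure {i j : I} {d n m p q dp : ℤ} (h : d + n = m) (t : T) (h' : p + q = n)
    (h₁ : d + p = dp) (h₂ : dp + q = m)
    (c : A.piece i j d) (a : A.piece j t p) (v : V.piece t q) :
    tensorAct V h c (pureTensor V j t h' a v) = pureTensor V i t h₂ (A.mul h₁ c a) v := by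
  subst h₁
  simp [tensorAct, pureTensor]

theorem tensor_induction {i : I} {d : ℤ} {P : TensorPiece V i d → Prop} (x : TensorPiece V i d)
    (hz : P 0) (ha : ∀ x y, P x → P y → P (x + y))
    (hp : ∀ (t : T) (m n : ℤ) (h : m + n = d) (a : A.piece i t m) (v : V.piece t n),
      P (pureTensor V i t h a v)) : P x := by
  classical
  induction x using DirectSum.induction_on with
  | zero => exact hz
  | of p x =>
    obtain ⟨⟨t, m, n⟩, h⟩ := p
    induction x using TensorProduct.induction_on with
    | zero => simpa using hz
    | tmul a v => exact hp t m n h a v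
    | add x y hx hy => simpa using ha _ _ hx hy
  | add x y hx hy => exact ha _ _ hx hy

theorem tensorAct_balanced {i j : I} {d n m : ℤ} (h : d + n = m) (c : A.piece i j d)
    (x : TensorPiece V j n) (hx : x ∈ balanced V j n) : tensorAct V h c x ∈ balanced V i m := by
  induction hx using Submodule.span_induction with
  | mem x hx =>
    obtain ⟨s, t, p, e, q, p', q', h₁, h₂, h₃, h₄, a, b, v, rfl⟩ := hx
    rw [map_sub, tensorAct_pure V h t h₃ rfl (by omega), tensorAct_pure V h s h₄ rfl (by omega),
      ← A.mul_assoc (rfl : d + p = d + p) (show d + p + e = d + p' by omega) h₁ rfl c a b]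
    exact Submodule.subset_span ⟨s, t, d + p, e, q, d + p', q', by omega, h₂, by omega, by omega,
      A.mul rfl c a, b, v, rfl⟩
  | zero => simp
  | add x y _ _ hx hy => simpa using add_mem hx hy
  | smul t x _ hx => simpa using Submodule.smul_mem _ t hx

/-- The left adjoint `j_! V = A e ⊗_{e A e} V` of the truncation functor. -/
def jShriek : GMod A where
  piece i d := TensorPiece V i d ⧸ balanced V i d
  act {i j d n m} h := LinearMap.flip <| Submodule.liftQ (balanced V j n)
    ((tensorAct V h).compr₂ (balanced V i m).mkQ).flip (by
      intro x hx
      refine LinearMap.ext fun c => ?_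
      exact (Submodule.Quotient.mk_eq_zero _).2 (tensorAct_balanced V h c x hx))
  one_act {i n} h x := by
    obtain ⟨x, rfl⟩ := Submodule.mkQ_surjective _ x
    refine congrArg (Submodule.mkQ _) (?_ : tensorAct V h (A.one i) x = x)
    induction x using tensor_induction with
    | hz => simp
    | ha x y hx hy => rw [map_add, hx, hy]
    | hp t m n h' a v => rw [tensorAct_pure V h t h' (zero_add m) h', A.one_mul]
  mul_act {i j l d e f n m p} h₁ h₂ h₃ h₄ a b x := by
    obtain ⟨x, rfl⟩ := Submodule.mkQ_surjective _ x
    refine congrArg (Submodule.mkQ _)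
      (?_ : tensorAct V h₂ (A.mul h₁ a b) x = tensorAct V h₄ a (tensorAct V h₃ b x))
    induction x using tensor_induction with
    | hz => simp
    | ha x y hx hy => rw [map_add, hx, hy, map_add, map_add]
    | hp t r q h' c v =>
      rw [tensorAct_pure V h₂ t h' rfl (by omega), tensorAct_pure V h₃ t h' rfl (by omega),
        tensorAct_pure V h₄ t _ (show d + (e + r) = f + r by omega) (by omega),
        A.mul_assoc h₁ rfl rfl]

end jShriek

section jStar

variable {T : Set I} (V : GMod (A.corner T))

/-- The index set of the pieces `1ₜ A_n 1ᵢ → 1ₜ V_m`, `t ∈ T`, `n + d = m`, of a homomorphism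
`e A 1ᵢ → V` of degree `d`. -/
abbrev HomIdx (T : Set I) (d : ℤ) : Type u := {p : T × ℤ × ℤ // p.2.1 + d = p.2.2}

/-- `Hom_{e A e}(e A 1ᵢ, V)_d`: the families of linear maps `1ₜ A_n 1ᵢ → 1ₜ V_{n+d}` (`t ∈ T`)
that commute with the left action of `e A e`. -/
def cornerHom (i : I) (d : ℤ) :
    Submodule k (∀ p : HomIdx T d, A.piece p.1.1 i p.1.2.1 →ₗ[k] V.piece p.1.1 p.1.2.2) where
  carrier := {f | ∀ (s t : T) (e n n' m m' : ℤ) (h₁ : e + n = n') (h₂ : n + d = m)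
    (h₃ : n' + d = m') (h₄ : e + m = m') (b : A.piece s t e) (a : A.piece t i n),
    f ⟨(s, n', m'), h₃⟩ (A.mul h₁ b a) =
      V.act (i := s) (j := t) h₄ b (f ⟨(t, n, m), h₂⟩ a)}
  add_mem' hf hg := by
    intro s t e n n' m m' h₁ h₂ h₃ h₄ b a
    simp [hf s t e n n' m m' h₁ h₂ h₃ h₄ b a, hg s t e n n' m m' h₁ h₂ h₃ h₄ b a]
  zero_mem' := by
    intro s t e n n' m m' h₁ h₂ h₃ h₄ b a
    simp
  smul_mem' c f hf := by
    intro s t e n n' m m' h₁ h₂ h₃ h₄ b a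
    simp [hf s t e n n' m m' h₁ h₂ h₃ h₄ b a]

/-- The right adjoint `j_* V = ⨁ i, Hom_{e A e}(e A 1ᵢ, V)` of the truncation functor, the action
being `(c f)(a) = f(a c)`. -/
def jStar : GMod A where
  piece i d := cornerHom V i d
  act {i j d n m} h := LinearMap.mk₂ k
    (fun c f => (⟨fun p => (f.1 ⟨(p.1.1, p.1.2.1 + d, p.1.2.2), show p.1.2.1 + d + n = p.1.2.2 by have := p.2; omega⟩).comp
        ((A.mul rfl).flip c), by
      intro s t e p p' q q' h₁ h₂ h₃ h₄ b a
      simp only [LinearMap.comp_apply, LinearMap.flip_apply]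
      rw [A.mul_assoc h₁ rfl rfl (show e + (p + d) = p' + d by omega)]
      exact f.2 s t e (p + d) (p' + d) q q' _ _ _ h₄ b _⟩ : cornerHom V i m))
    (fun _ _ _ => by ext; simp) (fun _ _ _ => by ext; simp)
    (fun _ _ _ => by ext; simp) (fun _ _ _ => by ext; simp)
  one_act {i n} h f := by
    refine Subtype.ext (funext fun p => LinearMap.ext fun a => ?_)
    obtain ⟨⟨t, p, q⟩, hpq⟩ := p
    have key : ∀ (p' : ℤ) (h' : p + 0 = p') (h'' : p' + n = q),
        f.1 ⟨(t, p', q), h''⟩ (A.mul h' a (A.one i)) = f.1 ⟨(t, p, q), hpq⟩ a := by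
      intro p' h' h''
      obtain rfl : p = p' := by omega
      rw [A.mul_one]
    exact key _ rfl _
  mul_act {i j l d e g n m p} h₁ h₂ h₃ h₄ a b f := by
    refine Subtype.ext (funext fun p => LinearMap.ext fun c => ?_)
    obtain ⟨⟨t, r, q⟩, hrq⟩ := p
    have key : ∀ (r' : ℤ) (h' : r + d + e = r') (h'' : r' + n = q) (hk : r + g + n = q),
        f.1 ⟨(t, r + g, q), hk⟩ (A.mul rfl c (A.mul h₁ a b)) =
          f.1 ⟨(t, r', q), h''⟩ (A.mul h' (A.mul rfl c a) b) := by
      intro r' h' h'' hk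
      obtain rfl : r + g = r' := by omega
      rw [A.mul_assoc rfl h' h₁ rfl]
    exact key _ rfl _ _

end jStar

end GMod

/-! ### Weights -/

/-- A set `S ⊆ I` of special idempotents together with a function `s ↦ ṡ` to the set of weights. -/
structure Weights (I : Type u) (Λ : Type v) where
  S : Set I
  dot : S → Λ

namespace Weights

variable {Λ : Type v}

/-- The set `{s ∈ S | ṡ ∈ Γ}`, as a subset of `I`. -/
def indices (w : Weights I Λ) (Γ : Set Λ) : Set I := {i | ∃ h : i ∈ w.S, w.dot ⟨i, h⟩ ∈ Γ}

/-- The restriction to a set `Γ` of weights: all elements of `S_Γ = {s ∈ S | ṡ ∈ Γ}` are special,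
with weights in `Γ`. -/
def restrict (w : Weights I Λ) (Γ : Set Λ) : Weights (w.indices Γ) Γ where
  S := Set.univ
  dot s := ⟨w.dot ⟨s.1.1, s.1.2.1⟩, s.1.2.2⟩

variable [PartialOrder Λ] (A : LUGAlg k I) (w : Weights I Λ)

/-- The ideal generated by the weight idempotents `e_μ = ∑ ṡ = μ, 1ₛ` with `μ ≱ lam`; equivalently,
by the `1ₛ` with `ṡ ≱ lam`. -/
def geIdeal (lam : Λ) : A.TwoIdeal := A.idealOf (w.indices {μ | ¬ lam ≤ μ})

/-- The quotient algebra `A_{≥ lam}`. -/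
abbrev algGE (lam : Λ) : LUGAlg k I := A.quot (w.geIdeal A lam)

/-- The algebra `A_lam = e_lam A_{≥ lam} e_lam`. -/
abbrev algAt (lam : Λ) : LUGAlg k (w.indices {lam}) := (w.algGE A lam).corner (w.indices {lam})

variable {A} {lam : Λ}

/-- The standardization functor `j^lam_!` on objects, with values in `A-gmod`. -/
def standardize (M : GMod (w.algAt A lam)) : GMod A := M.jShriek.inflate

/-- The costandardization functor `j^lam_*` on objects, with values in `A-gmod`. -/
def costandardize (M : GMod (w.algAt A lam)) : GMod A := M.jStar.inflate

/-- `Δ`-layers of type `lam`: the modules isomorphic to `j^lam_! M` with `M` a projective graded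
`A_lam`-module that is locally finite-dimensional and bounded below. -/
def IsDeltaLayer (lam : Λ) (V : GMod A) : Prop :=
  ∃ M : GMod (w.algAt A lam), Projective M ∧ M.LocallyFinite ∧ M.BoundedBelow ∧
    Nonempty (V ≅ w.standardize M)

/-- `Δ̄`-layers of type `lam`: the modules isomorphic to `j^lam_! M` with `M` an arbitrary graded
`A_lam`-module that is locally finite-dimensional and bounded below. -/
def IsDeltaBarLayer (lam : Λ) (V : GMod A) : Prop :=
  ∃ M : GMod (w.algAt A lam), M.LocallyFinite ∧ M.BoundedBelow ∧ Nonempty (V ≅ w.standardize M)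

/-- `V` has a finite graded filtration `0 = V₀ ⊆ V₁ ⊆ ⋯ ⊆ Vₙ = V` and there are distinct weights
`lam₁, …, lamₙ` such that `V_r / V_{r-1}` is a layer of type `lam_r` for each `r`. -/
def HasFlag (layer : Λ → GMod A → Prop) (V : GMod A) : Prop :=
  ∃ (n : ℕ) (F : Fin (n + 1) → V.Sub) (wt : Fin n → Λ),
    (∀ i d, (F 0).piece i d = ⊥) ∧ (∀ i d, (F (Fin.last n)).piece i d = ⊤) ∧
    (∀ (r : Fin n) (i : I) (d : ℤ), (F r.castSucc).piece i d ≤ (F r.succ).piece i d) ∧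
    Function.Injective wt ∧
    ∀ r : Fin n, layer (wt r) ((F r.castSucc).subquot (F r.succ))

/-- `V` has a `Δ`-flag. -/
def HasDeltaFlag (V : GMod A) : Prop := HasFlag w.IsDeltaLayer V

/-- `V` has a `Δ̄`-flag. -/
def HasDeltaBarFlag (V : GMod A) : Prop := HasFlag w.IsDeltaBarLayer V

/-- The submodule `V_Γ = A e_Γ V` of `V`. -/
def lowerPart (V : GMod A) (Γ : Set Λ) : V.Sub := V.generatedBy (w.indices Γ)

/-- `V` has an ascending `Δ`-flag: `V_Γ` has a `Δ`-flag for every finite lower set `Γ`. -/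
def HasAscendingDeltaFlag (V : GMod A) : Prop :=
  ∀ Γ : Set Λ, IsLowerSet Γ → Γ.Finite → w.HasDeltaFlag (w.lowerPart V Γ).toGMod

/-- `V` has an ascending `Δ̄`-flag: `V_Γ` has a `Δ̄`-flag for every finite lower set `Γ`. -/
def HasAscendingDeltaBarFlag (V : GMod A) : Prop :=
  ∀ Γ : Set Λ, IsLowerSet Γ → Γ.Finite → w.HasDeltaBarFlag (w.lowerPart V Γ).toGMod

end Weights

/-! ### Graded triangular bases -/

/-- The triples `(x, h, y) ∈ X(i,s) × H(s,t) × Y(t,j)`, for `s, t ∈ S`, of total degree `d`. -/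
structure BasisTriple (A : LUGAlg k I) {S : Set I}
    (X : ∀ (i : I) (s : S), Set (Σ d : ℤ, A.piece i s d))
    (H : ∀ s t : S, Set (Σ d : ℤ, A.piece s t d))
    (Y : ∀ (t : S) (j : I), Set (Σ d : ℤ, A.piece t j d)) (i j : I) (d : ℤ) where
  s : S
  t : S
  x : X i s
  h : H s t
  y : Y t j
  deg_eq : x.1.1 + h.1.1 + y.1.1 = d

/-- The product `x h y` of a triple. -/
def BasisTriple.product {A : LUGAlg k I} {S : Set I}
    {X : ∀ (i : I) (s : S), Set (Σ d : ℤ, A.piece i s d)}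
    {H : ∀ s t : S, Set (Σ d : ℤ, A.piece s t d)}
    {Y : ∀ (t : S) (j : I), Set (Σ d : ℤ, A.piece t j d)} {i j : I} {d : ℤ}
    (q : BasisTriple A X H Y i j d) : A.piece i j d :=
  A.mul q.deg_eq (A.mul rfl q.x.1.2 q.h.1.2) q.y.1.2

/-- A graded triangular basis of `A`. A homogeneous subset of `1ᵢ A 1ⱼ` is given as a set of
homogeneous elements together with their degrees. -/
structure TriangularBasis (A : LUGAlg k I) (Λ : Type v) [PartialOrder Λ] extends
    Weights I Λ where
  lowerFinite : ∀ lam : Λ, (Set.Iic lam).Finite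
  finite_fibers : ∀ lam : Λ, {s : S | dot s = lam}.Finite
  X : ∀ (i : I) (s : S), Set (Σ d : ℤ, A.piece i s d)
  H : ∀ s t : S, Set (Σ d : ℤ, A.piece s t d)
  Y : ∀ (t : S) (j : I), Set (Σ d : ℤ, A.piece t j d)
  /-- The products `x h y` form a basis of `A`: those that lie in `1ᵢ A_d 1ⱼ` form a basis of this
  piece, for all `i, j, d`. -/
  basis : ∀ (i j : I) (d : ℤ),
    LinearIndependent k (fun q : BasisTriple A X H Y i j d => q.product) ∧
      Submodule.span k (Set.range fun q : BasisTriple A X H Y i j d => q.product) = ⊤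
  X_self : ∀ s : S, X s s = {⟨0, A.one s⟩}
  Y_self : ∀ s : S, Y s s = {⟨0, A.one s⟩}
  X_lt : ∀ s t : S, s ≠ t → (X s t).Nonempty → dot t < dot s
  H_eq : ∀ s t : S, s ≠ t → (H s t).Nonempty → dot s = dot t
  Y_lt : ∀ s t : S, s ≠ t → (Y s t).Nonempty → dot s < dot t
  finite_special : ∀ i : I, i ∉ S → {s : S | (X i s).Nonempty ∨ (Y s i).Nonempty}.Finite

/-- A choice of a full set `L_lam(b)`, `b ∈ B_lam`, of irreducible graded left `A_lam`-modules up to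
isomorphism and degree shift, for every weight `lam`. -/
structure Irreducibles (A : LUGAlg k I) {Λ : Type v} [PartialOrder Λ] (w : Weights I Λ) where
  B : Λ → Type w
  L : ∀ {lam : Λ}, B lam → GMod (w.algAt A lam)
  simple : ∀ {lam : Λ} (b : B lam), Simple (L b)
  eq_of_iso : ∀ {lam : Λ} (b c : B lam) (n : ℤ), Nonempty (L b ≅ (L c).shift n) → b = c
  exists_iso : ∀ {lam : Λ} (M : GMod (w.algAt A lam)), Simple M →
    ∃ (b : B lam) (n : ℤ), Nonempty (M ≅ (L b).shift n)

namespace GMod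

variable {A : LUGAlg k I}

/-- The coefficients of the formal series `∑ d, dim Hom_A(V, W)_d q^d`. -/
def homSeries (V W : GMod A) (d : ℤ) : ℕ := Module.finrank k (homDeg V W d)

/-- The series `∑ d, dim Hom_A(V, W)_d q^d` is well defined and lies in `ℕ((q⁻¹))`: all its
coefficients are finite, and they vanish in large degrees. -/
def HomSeriesDefined (V W : GMod A) : Prop :=
  (∀ d, FiniteDimensional k (homDeg V W d)) ∧ ∃ N : ℤ, ∀ d > N, Subsingleton (homDeg V W d)

end GMod

end

-- Write j_! and j_* for standardization and costandardization at a weight λ. The theorem rests on a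
-- few Ext vanishing results and one descending induction over weights.
--
-- Triangularity. Straightening shows that, for a lower set Γ, the ideal A e_Γ A is spanned by the
-- products xhy whose middle weight lies in Γ (`mul_mem_triSpan`, `idealOf_indices`). Hence A_{≥λ}
-- e_λ is a free right A_λ-module on the elements x (`stdX_bijective`), so j_! is exact, and the
-- layers of a free A-module F with respect to F_Γ are j_! of free A_λ-modules. On the other side,
-- Hom(V_Γ, j_*N) = 0 if λ ∉ Γ, while restriction Hom(V, j_*N) → Hom(V_Γ, j_*N) is bijective if λ ∈
-- Γ. This accounts for the multiplicity formulas, and for the passage of Ext¹ vanishing from V to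
-- V/V_Γ.
--
-- Ext vanishing. For M projective and arbitrary N, at any two weights, Ext^n(j_!M, j_*N) = 0 for n
-- ≥ 1 (`acyclic_standardize`): by induction on λ, j_!M is a summand of F/F_{<λ} with F free, and
-- F_{<λ} is filtered by standard modules of smaller weight. Dimension shifting yields the same for
-- arbitrary M and injective N (`ext_std_costd_injective`), and Ext^n(W, j_*N) = 0 for all n when
-- e_Γ W = 0 and λ ∈ Γ (`ext_costd_eq_zero`). So V/V_Γ is invisible to costandard modules with
-- weights in Γ, and (a) ⇒ (d) follows.
--
-- From Ext¹ to flags. Let Q = V_{Γ∪λ}/V_Γ and let K be the kernel of the surjection j_!e_λQ → Q. If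
-- Ext¹(V_{Γ∪λ}, –) vanishes on the test costandard modules with weights in a finite lower set Γ₂,
-- then so does Ext¹(Q, –). This makes e_λQ projective (in the Δ case) and leaves no nonzero map
-- from K to these modules, so e_{Γ₂}K = 0. Then Ext²(Q, –) vanishes too, and therefore Ext¹(V_Γ,
-- –): the induction continues downwards (`LayerTest.step`). Enlarging Γ₂ gives K = 0.
--
-- Truncation. The filtration by the V_Γ truncates to a flag of j^Γ V. Conversely, Ext¹ into a
-- costandard module of weight in Γ can be tested after truncation (`ext_one_of_truncate`).
--
-- Both parts run through the interface `LayerTest`: projective modules tested by shifts of simple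
-- ones, or arbitrary modules tested by shifts of injective hulls. For the first, a module with no
-- Ext¹ to simple modules is shown to be projective by means of a minimal supplement
-- (`projective_of_ext_simple`).

noncomputable section

variable {k : Type u} [Field k] {I : Type u}

namespace GMod

variable {A : LUGAlg k I}

/-! ### Short exact sequences and vanishing of Ext groups -/

/-- A short exact sequence of graded modules, described on homogeneous pieces. -/
structure SES {X Y Z : GMod A} (f : X ⟶ Y) (g : Y ⟶ Z) : Prop where
  inj : ∀ i n, Function.Injective (f.app i n)
  surj : ∀ i n, Function.Surjective (g.app i n)
  zero : ∀ i n x, g.app i n (f.app i n x) = 0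
  exact : ∀ i n y, g.app i n y = 0 → ∃ x, f.app i n x = y

variable {X Y Z W : GMod A}

theorem eq_zero_of_app {f : X ⟶ Y} (h : ∀ i n x, f.app i n x = 0) : f = 0 := hom_ext h

theorem sub_app (f g : X ⟶ Y) (i : I) (n : ℤ) (x : X.piece i n) :
    (f - g).app i n x = f.app i n x - g.app i n x := by
  rw [sub_eq_add_neg, add_app, neg_app, ← sub_eq_add_neg]

namespace SES

variable {f : X ⟶ Y} {g : Y ⟶ Z}

theorem comp_eq_zero (h : SES f g) : f ≫ g = 0 := eq_zero_of_app h.zero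

theorem exists_desc (h : SES f g) (φ : Y ⟶ W) (hφ : f ≫ φ = 0) : ∃ ψ : Z ⟶ W, g ≫ ψ = φ := by
  have hker : ∀ i n (y : Y.piece i n), g.app i n y = 0 → φ.app i n y = 0 := by
    intro i n y hy
    obtain ⟨x, rfl⟩ := h.exact i n y hy
    exact app_eq_zero hφ i n x
  let e : (ker g).quot ≅ Z := isoOfBijective ((ker g).desc g fun i n v hv => hv) fun i n => by
    constructor
    · rw [injective_iff_map_eq_zero]
      intro x hx
      obtain ⟨x, rfl⟩ := Submodule.mkQ_surjective _ x
      exact (Submodule.Quotient.mk_eq_zero _).2 hx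
    · intro z
      obtain ⟨y, rfl⟩ := h.surj i n z
      exact ⟨Submodule.mkQ _ y, rfl⟩
  refine ⟨e.inv ≫ (ker g).desc φ hker, ?_⟩
  change ((ker g).proj ≫ e.hom) ≫ e.inv ≫ (ker g).desc φ hker = φ
  rw [Category.assoc, e.hom_inv_id_assoc]
  rfl

theorem exists_lift (h : SES f g) (φ : W ⟶ Y) (hφ : φ ≫ g = 0) : ∃ ψ : W ⟶ X, ψ ≫ f = φ := by
  let e : X ≅ (ker g).toGMod := isoOfBijective ((ker g).lift f h.zero) fun i n => by
    constructor
    · intro x y hxy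
      exact h.inj i n (congrArg Subtype.val hxy)
    · rintro ⟨y, hy⟩
      obtain ⟨x, rfl⟩ := h.exact i n y hy
      exact ⟨x, rfl⟩
  refine ⟨(ker g).lift φ (app_eq_zero hφ) ≫ e.inv, ?_⟩
  change ((ker g).lift φ (app_eq_zero hφ) ≫ e.inv) ≫ e.hom ≫ (ker g).incl = φ
  rw [Category.assoc, e.inv_hom_id_assoc]
  rfl

theorem shortExact (h : SES f g) : (ShortComplex.mk f g h.comp_eq_zero).ShortExact := by
  have hf : Mono f := mono_of_injective f h.inj
  have hg : Epi g := epi_of_surjective g h.surj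
  refine ShortComplex.ShortExact.mk' ?_ hf hg
  refine ShortComplex.exact_of_f_is_kernel _ ?_
  refine KernelFork.IsLimit.ofι' _ _ fun φ hφ => ?_
  exact ⟨(h.exists_lift φ hφ).choose, (h.exists_lift φ hφ).choose_spec⟩

theorem ext_mid (h : SES f g) {n : ℕ} (h₁ : Subsingleton (Abelian.Ext X W n))
    (h₃ : Subsingleton (Abelian.Ext Z W n)) : Subsingleton (Abelian.Ext Y W n) := by
  refine subsingleton_of_forall_eq 0 fun x => ?_
  obtain ⟨z, rfl⟩ := Abelian.Ext.contravariant_sequence_exact₂ h.shortExact W x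
    (Subsingleton.elim _ _)
  rw [Subsingleton.elim z 0, Abelian.Ext.comp_zero]

theorem ext_left (h : SES f g) {n : ℕ} (h₂ : Subsingleton (Abelian.Ext Y W n))
    (h₃ : Subsingleton (Abelian.Ext Z W (n + 1))) : Subsingleton (Abelian.Ext X W n) := by
  refine subsingleton_of_forall_eq 0 fun x => ?_
  obtain ⟨z, rfl⟩ := Abelian.Ext.contravariant_sequence_exact₁ h.shortExact W x (add_comm 1 n)
    (Subsingleton.elim (α := Abelian.Ext Z W (n + 1)) _ _)
  rw [Subsingleton.elim (α := Abelian.Ext Y W n) z 0, Abelian.Ext.comp_zero]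

theorem ext_right (h : SES f g) {n : ℕ} (h₁ : Subsingleton (Abelian.Ext X W n))
    (h₂ : Subsingleton (Abelian.Ext Y W (n + 1))) : Subsingleton (Abelian.Ext Z W (n + 1)) := by
  refine subsingleton_of_forall_eq 0 fun x => ?_
  obtain ⟨z, rfl⟩ := Abelian.Ext.contravariant_sequence_exact₃ h.shortExact W x
    (Subsingleton.elim (α := Abelian.Ext Y W (n + 1)) _ _) (add_comm 1 n)
  rw [Subsingleton.elim (α := Abelian.Ext X W n) z 0, Abelian.Ext.comp_zero]

/-- The bottom of every dimension shift: if all maps X → W extend to Y, the connecting map Hom(X, W)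
→ Ext¹(Z, W) is zero, so Ext¹(Z, W) embeds in Ext¹(Y, W). Hom(X, W) itself need not vanish. -/
theorem ext_right_one (h : SES f g) (h₁ : ∀ φ : X ⟶ W, ∃ ψ : Y ⟶ W, f ≫ ψ = φ)
    (h₂ : Subsingleton (Abelian.Ext Y W 1)) : Subsingleton (Abelian.Ext Z W 1) := by
  refine subsingleton_of_forall_eq 0 fun x => ?_
  obtain ⟨z, rfl⟩ := Abelian.Ext.contravariant_sequence_exact₃ h.shortExact W x
    (Subsingleton.elim (α := Abelian.Ext Y W 1) _ _) (add_zero 1)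
  obtain ⟨φ, rfl⟩ := Abelian.Ext.homEquiv₀.symm.surjective z
  obtain ⟨ψ, rfl⟩ := h₁ φ
  change h.shortExact.extClass.comp (Abelian.Ext.mk₀ (f ≫ ψ)) _ = 0
  rw [← Abelian.Ext.mk₀_comp_mk₀]
  exact ShortComplex.ShortExact.extClass_comp_assoc h.shortExact _

theorem exists_extension (h : SES f g) (h₃ : Subsingleton (Abelian.Ext Z W 1)) (φ : X ⟶ W) :
    ∃ ψ : Y ⟶ W, f ≫ ψ = φ := by
  obtain ⟨z, hz⟩ := Abelian.Ext.contravariant_sequence_exact₁ h.shortExact W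
    (Abelian.Ext.mk₀ φ) (add_zero 1) (Subsingleton.elim (α := Abelian.Ext Z W 1) _ _)
  obtain ⟨ψ, rfl⟩ := Abelian.Ext.homEquiv₀.symm.surjective z
  refine ⟨ψ, ?_⟩
  change (Abelian.Ext.mk₀ f).comp (Abelian.Ext.mk₀ ψ) _ = _ at hz
  rw [Abelian.Ext.mk₀_comp_mk₀] at hz
  exact Abelian.Ext.homEquiv₀.symm.injective hz

end SES

theorem ext_of_retract {n : ℕ} (i : X ⟶ Y) (r : Y ⟶ X) (h : i ≫ r = 𝟙 X)
    (hY : Subsingleton (Abelian.Ext Y W n)) : Subsingleton (Abelian.Ext X W n) := by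
  refine subsingleton_of_forall_eq 0 fun x => ?_
  have h0 : (Abelian.Ext.mk₀ r).comp x (zero_add n) = 0 := Subsingleton.elim _ _
  have h1 : (Abelian.Ext.mk₀ (i ≫ r)).comp x (zero_add n) = 0 := by
    rw [← Abelian.Ext.mk₀_comp_mk₀, Abelian.Ext.comp_assoc_of_second_deg_zero, h0,
      Abelian.Ext.comp_zero]
  rwa [h, Abelian.Ext.mk₀_id_comp] at h1

theorem ext_of_iso {n : ℕ} (e : X ≅ Y) (hY : Subsingleton (Abelian.Ext Y W n)) :
    Subsingleton (Abelian.Ext X W n) :=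
  ext_of_retract e.hom e.inv e.hom_inv_id hY

theorem ext_of_iso_right {n : ℕ} (e : X ≅ Y) (hY : Subsingleton (Abelian.Ext W Y n)) :
    Subsingleton (Abelian.Ext W X n) := by
  refine subsingleton_of_forall_eq 0 fun x => ?_
  have h0 : x.comp (Abelian.Ext.mk₀ e.hom) (add_zero n) = 0 := Subsingleton.elim _ _
  have h1 : x.comp (Abelian.Ext.mk₀ (e.hom ≫ e.inv)) (add_zero n) = 0 := by
    rw [← Abelian.Ext.mk₀_comp_mk₀, ← Abelian.Ext.comp_assoc_of_second_deg_zero, h0,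
      Abelian.Ext.zero_comp]
  rwa [e.hom_inv_id, Abelian.Ext.comp_mk₀_id] at h1

theorem ext_zero_of_hom (h : ∀ f : X ⟶ W, f = 0) : Subsingleton (Abelian.Ext X W 0) :=
  subsingleton_of_forall_eq 0 fun x => by
    obtain ⟨φ, rfl⟩ := Abelian.Ext.homEquiv₀.symm.surjective x
    change Abelian.Ext.mk₀ φ = 0
    rw [h φ, Abelian.Ext.mk₀_zero]

theorem ext_of_projective [Projective X] (n : ℕ) : Subsingleton (Abelian.Ext X W (n + 1)) :=
  Abelian.Ext.subsingleton_of_projective _ _ _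

/-! ### Graded submodules -/

section sub

variable {V : GMod A}

instance : PartialOrder V.Sub where
  le N M := ∀ i n, N.piece i n ≤ M.piece i n
  le_refl _ _ _ := le_rfl
  le_trans _ _ _ h h' i n := (h i n).trans (h' i n)
  le_antisymm N M h h' := by
    cases N
    cases M
    congr 1
    exact funext fun i => funext fun n => le_antisymm (h i n) (h' i n)

theorem Sub.ses_proj (N : V.Sub) : SES N.incl N.proj where
  inj _ _ := Subtype.val_injective
  surj _ _ := Submodule.mkQ_surjective _
  zero _ _ x := (Submodule.Quotient.mk_eq_zero _).2 x.2
  exact _ _ y hy := ⟨⟨y, (Submodule.Quotient.mk_eq_zero _).1 hy⟩, rfl⟩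

theorem ses_ker {f : V ⟶ W} (hf : ∀ i n, Function.Surjective (f.app i n)) :
    SES (ker f).incl f where
  inj _ _ := Subtype.val_injective
  surj := hf
  zero _ _ x := x.2
  exact _ _ y hy := ⟨⟨y, hy⟩, rfl⟩

/-- The inclusion of a graded submodule in a larger one. -/
def Sub.inclLE {N M : V.Sub} (h : N ≤ M) : N.toGMod ⟶ M.toGMod :=
  M.lift N.incl fun i n v => h i n v.2

/-- An element of a graded submodule. -/
def Sub.elem (N : V.Sub) {i : I} {n : ℤ} (v : V.piece i n) (hv : v ∈ N.piece i n) :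
    N.toGMod.piece i n :=
  (⟨v, hv⟩ : N.piece i n)

theorem Sub.act_elem (N : V.Sub) {i j : I} {d n m : ℤ} (h : d + n = m) (a : A.piece i j d)
    (v : V.piece j n) (hv : v ∈ N.piece j n) :
    N.toGMod.act h a (N.elem v hv) = N.elem (V.act h a v) (N.act_mem h a v hv) := rfl

theorem Sub.incl_elem (N : V.Sub) {i : I} {n : ℤ} (v : V.piece i n) (hv : v ∈ N.piece i n) :
    N.incl.app i n (N.elem v hv) = v := rfl

theorem Sub.ses_subquot {N M : V.Sub} (h : N ≤ M) :
    SES (Sub.inclLE h) (N.within M).proj where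
  inj i n _ _ hxy := Subtype.ext (congrArg (fun z : M.piece i n => (z : V.piece i n)) hxy)
  surj _ _ := Submodule.mkQ_surjective _
  zero _ _ x := (Submodule.Quotient.mk_eq_zero _).2 x.2
  exact i n y hy := ⟨⟨y.1, (Submodule.Quotient.mk_eq_zero ((N.within M).piece i n)).1 hy⟩, rfl⟩

theorem LocallyFinite.of_injective (hW : W.LocallyFinite) (f : V ⟶ W)
    (hf : ∀ i n, Function.Injective (f.app i n)) : V.LocallyFinite := fun i n =>
  have := hW i n
  FiniteDimensional.of_injective (f.app i n) (hf i n)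

theorem LocallyFinite.of_surjective (hV : V.LocallyFinite) (f : V ⟶ W)
    (hf : ∀ i n, Function.Surjective (f.app i n)) : W.LocallyFinite := fun i n =>
  have := hV i n
  Module.Finite.of_surjective (f.app i n) (hf i n)

theorem BoundedBelow.of_injective (hW : W.BoundedBelow) (f : V ⟶ W)
    (hf : ∀ i n, Function.Injective (f.app i n)) : V.BoundedBelow := fun i =>
  let ⟨N, hN⟩ := hW i
  ⟨N, fun n hn => have := hN n hn; (hf i n).subsingleton⟩

theorem BoundedBelow.of_surjective (hV : V.BoundedBelow) (f : V ⟶ W)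
    (hf : ∀ i n, Function.Surjective (f.app i n)) : W.BoundedBelow := fun i =>
  let ⟨N, hN⟩ := hV i
  ⟨N, fun n hn => have := hN n hn; (hf i n).subsingleton⟩

theorem bijective_of_iso (e : V ≅ W) (i : I) (n : ℤ) : Function.Bijective (e.hom.app i n) :=
  ⟨injective_of_mono e.hom i n, surjective_of_epi e.hom i n⟩

end sub

end GMod

theorem finiteDimensional_directSum {α : Type*} (M : α → Type*) [∀ a, AddCommGroup (M a)]
    [∀ a, Module k (M a)] (hM : ∀ a, FiniteDimensional k (M a))
    (h : {a | ¬ Subsingleton (M a)}.Finite) : FiniteDimensional k (⨁ a, M a) := by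
  classical
  have : Finite {a | ¬ Subsingleton (M a)} := h
  suffices hs : (⊤ : Submodule k (⨁ a, M a)) ≤ Submodule.span k
      (⋃ a : {a | ¬ Subsingleton (M a)}, Set.range fun b : Module.Free.ChooseBasisIndex k (M a.1) =>
        DirectSum.lof k α M a.1 (Module.Free.chooseBasis k (M a.1) b)) by
    refine ⟨Submodule.fg_def.2 ⟨_, ?_, top_le_iff.1 hs⟩⟩
    exact Set.finite_iUnion fun a => Set.finite_range _
  intro x _
  induction x using DirectSum.induction_on with
  | zero => exact zero_mem _
  | add x y hx hy => exact add_mem (hx trivial) (hy trivial)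
  | of a x =>
    by_cases ha : Subsingleton (M a)
    · rw [Subsingleton.elim x 0, map_zero]
      exact zero_mem _
    · have hx := (Module.Free.chooseBasis k (M a)).mem_span x
      have := Submodule.mem_map_of_mem (f := DirectSum.lof k α M a) hx
      rw [Submodule.map_span] at this
      refine Submodule.span_mono ?_ this
      rintro _ ⟨_, ⟨b, rfl⟩, rfl⟩
      exact Set.mem_iUnion.2 ⟨⟨a, ha⟩, b, rfl⟩

namespace GMod

variable {A : LUGAlg k I}

/-! ### Free graded modules -/

section free

variable (A) {ι : Type u} (σ : ι → I) (δ : ι → ℤ)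

/-- The index set of the pieces `1ᵢ A_p v_g` with `p + deg v_g = n`. -/
abbrev FreeIdx (δ : ι → ℤ) (n : ℤ) : Type u := {x : ι × ℤ // x.2 + δ x.1 = n}

/-- The degree `n` part of `⨁ g, 1ᵢ A v_g`. -/
abbrev FreePiece (i : I) (n : ℤ) : Type u := ⨁ x : FreeIdx δ n, A.piece i (σ x.1.1) x.1.2

open Classical in
/-- The map `a ↦ a v_g`. -/
def freePure {i : I} {p n : ℤ} (g : ι) (h : p + δ g = n) :
    A.piece i (σ g) p →ₗ[k] FreePiece A σ δ i n :=
  DirectSum.lof k (FreeIdx δ n) (fun x => A.piece i (σ x.1.1) x.1.2) ⟨(g, p), h⟩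

variable {A σ δ} in
theorem free_induction {i : I} {n : ℤ} {P : FreePiece A σ δ i n → Prop} (x : FreePiece A σ δ i n)
    (hz : P 0) (ha : ∀ x y, P x → P y → P (x + y))
    (hp : ∀ (g : ι) (p : ℤ) (h : p + δ g = n) (a : A.piece i (σ g) p),
      P (freePure A σ δ g h a)) : P x := by
  classical
  induction x using DirectSum.induction_on with
  | zero => exact hz
  | of x a => exact hp x.1.1 x.1.2 x.2 a
  | add x y hx hy => exact ha _ _ hx hy

open Classical in
/-- The linear map on `⨁ g, 1ᵢ A v_g` with prescribed components. -/
def freeLift {i : I} {n : ℤ} {M : Type*} [AddCommGroup M] [Module k M]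
    (f : ∀ (g : ι) (p : ℤ), p + δ g = n → A.piece i (σ g) p →ₗ[k] M) :
    FreePiece A σ δ i n →ₗ[k] M :=
  DirectSum.toModule k _ _ fun x => f x.1.1 x.1.2 x.2

theorem freeLift_pure {i : I} {n : ℤ} {M : Type*} [AddCommGroup M] [Module k M]
    (f : ∀ (g : ι) (p : ℤ), p + δ g = n → A.piece i (σ g) p →ₗ[k] M) (g : ι) (p : ℤ)
    (h : p + δ g = n) (a : A.piece i (σ g) p) :
    freeLift A σ δ f (freePure A σ δ g h a) = f g p h a := by
  simp [freeLift, freePure]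

/-- Left multiplication on a free module. -/
def freeAct {i j : I} {d n m : ℤ} (h : d + n = m) :
    A.piece i j d →ₗ[k] FreePiece A σ δ j n →ₗ[k] FreePiece A σ δ i m :=
  LinearMap.flip <| freeLift A σ δ fun g p hp =>
    ((A.mul (rfl : d + p = d + p)).compr₂
      (freePure A σ δ g (show d + p + δ g = m by omega))).flip

theorem freeAct_pure {i j : I} {d n m p dp : ℤ} (h : d + n = m) (g : ι) (hp : p + δ g = n)
    (h₁ : d + p = dp) (h₂ : dp + δ g = m) (c : A.piece i j d) (a : A.piece j (σ g) p) :
    freeAct A σ δ h c (freePure A σ δ g hp a) = freePure A σ δ g h₂ (A.mul h₁ c a) := by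
  subst h₁
  simp [freeAct, freeLift_pure]

/-- The free graded `A`-module on generators `v_g ∈ 1_{σ g} V_{δ g}`. -/
def free : GMod A where
  piece i n := FreePiece A σ δ i n
  act h := freeAct A σ δ h
  one_act h v := by
    induction v using free_induction with
    | hz => simp
    | ha x y hx hy => rw [map_add, hx, hy]
    | hp g p hp a => rw [freeAct_pure A σ δ h g hp (zero_add p) hp, A.one_mul]
  mul_act {i j l d e f n m p'} h₁ h₂ h₃ h₄ a b v := by
    induction v using free_induction with
    | hz => simp
    | ha x y hx hy => rw [map_add, hx, hy, map_add, map_add]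
    | hp g p hp c =>
      rw [freeAct_pure A σ δ h₂ g hp rfl (by omega), freeAct_pure A σ δ h₃ g hp rfl (by omega),
        freeAct_pure A σ δ h₄ g _ (show d + (e + p) = f + p by omega) (by omega),
        A.mul_assoc h₁ _ rfl (by omega)]

variable {A σ δ}

/-- The map `a ↦ a v_g`, with values in the free module. -/
def freeMk {i : I} {p n : ℤ} (g : ι) (h : p + δ g = n) :
    A.piece i (σ g) p →ₗ[k] (free A σ δ).piece i n :=
  freePure A σ δ g h

theorem freeMk_induction {i : I} {n : ℤ} {P : (free A σ δ).piece i n → Prop}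
    (x : (free A σ δ).piece i n) (hz : P 0) (ha : ∀ x y, P x → P y → P (x + y))
    (hp : ∀ (g : ι) (p : ℤ) (h : p + δ g = n) (a : A.piece i (σ g) p), P (freeMk g h a)) : P x :=
  free_induction x hz ha hp

theorem act_freeMk {i j : I} {d n m p dp : ℤ} (h : d + n = m) (g : ι) (hp : p + δ g = n)
    (h₁ : d + p = dp) (h₂ : dp + δ g = m) (c : A.piece i j d) (a : A.piece j (σ g) p) :
    (free A σ δ).act h c (freeMk g hp a) = freeMk g h₂ (A.mul h₁ c a) :=
  freeAct_pure A σ δ h g hp h₁ h₂ c a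

/-- The linear map on a piece of the free module with prescribed components. -/
def freeMkLift {i : I} {n : ℤ} {M : Type*} [AddCommGroup M] [Module k M]
    (f : ∀ (g : ι) (p : ℤ), p + δ g = n → A.piece i (σ g) p →ₗ[k] M) :
    (free A σ δ).piece i n →ₗ[k] M :=
  freeLift A σ δ f

theorem freeMkLift_mk {i : I} {n : ℤ} {M : Type*} [AddCommGroup M] [Module k M]
    (f : ∀ (g : ι) (p : ℤ), p + δ g = n → A.piece i (σ g) p →ₗ[k] M) (g : ι) (p : ℤ)
    (h : p + δ g = n) (a : A.piece i (σ g) p) : freeMkLift f (freeMk g h a) = f g p h a :=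
  freeLift_pure A σ δ f g p h a

/-- The generator `v_g`. -/
def freeGen (g : ι) : (free A σ δ).piece (σ g) (δ g) :=
  freeMk g (zero_add _) (A.one (σ g))

theorem act_freeGen {i : I} {p n : ℤ} (g : ι) (h : p + δ g = n) (a : A.piece i (σ g) p) :
    (free A σ δ).act h a (freeGen g) = freeMk g h a := by
  rw [freeGen, act_freeMk h g (zero_add _) (add_zero p) h, A.mul_one]

variable {V W : GMod A}

/-- The components of `freeDesc`. -/
def freeDescApp (v : ∀ g : ι, V.piece (σ g) (δ g)) (i : I) (n : ℤ) :
    (free A σ δ).piece i n →ₗ[k] V.piece i n :=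
  freeMkLift fun g _ h => (V.act h).flip (v g)

theorem freeDescApp_mk (v : ∀ g : ι, V.piece (σ g) (δ g)) {i : I} {p n : ℤ} (g : ι)
    (h : p + δ g = n) (a : A.piece i (σ g) p) :
    freeDescApp v i n (freeMk g h a) = V.act h a (v g) :=
  freeMkLift_mk _ g p h a

theorem freeDescApp_act (v : ∀ g : ι, V.piece (σ g) (δ g)) {i j : I} {d n m : ℤ} (h : d + n = m)
    (a : A.piece i j d) (x : (free A σ δ).piece j n) :
    freeDescApp v i m ((free A σ δ).act h a x) = V.act h a (freeDescApp v j n x) := by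
  induction x using freeMk_induction with
  | hz => simp only [map_zero]
  | ha x y hx hy => simp only [map_add, hx, hy]
  | hp g p hp c =>
    rw [act_freeMk h g hp rfl (by omega), freeDescApp_mk, freeDescApp_mk]
    exact V.mul_act rfl (by omega) hp h a c (v g)

/-- The homomorphism from a free module with prescribed values on the generators. -/
def freeDesc (v : ∀ g : ι, V.piece (σ g) (δ g)) : free A σ δ ⟶ V :=
  Hom.mk (freeDescApp v) (freeDescApp_act v)

theorem freeDesc_mk (v : ∀ g : ι, V.piece (σ g) (δ g)) {i : I} {p n : ℤ} (g : ι)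
    (h : p + δ g = n) (a : A.piece i (σ g) p) :
    (freeDesc v).app i n (freeMk g h a) = V.act h a (v g) :=
  freeDescApp_mk v g h a

theorem freeDesc_gen (v : ∀ g : ι, V.piece (σ g) (δ g)) (g : ι) :
    (freeDesc v).app (σ g) (δ g) (freeGen g) = v g := by
  rw [freeGen, freeDesc_mk, V.one_act]

theorem free_hom_ext {f f' : free A σ δ ⟶ V}
    (h : ∀ g, f.app (σ g) (δ g) (freeGen g) = f'.app (σ g) (δ g) (freeGen g)) : f = f' := by
  refine hom_ext fun i n x => ?_
  induction x using freeMk_induction with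
  | hz => simp only [map_zero]
  | ha x y hx hy => simp only [map_add, hx, hy]
  | hp g p hp a => rw [← act_freeGen, f.app_act, f'.app_act, h]

instance : Projective (free A σ δ) where
  factors {E X} f e _ := by
    choose v hv using fun g : ι => surjective_of_epi e (σ g) (δ g) (f.app (σ g) (δ g) (freeGen g))
    refine ⟨freeDesc v, free_hom_ext fun g => ?_⟩
    rw [comp_app, freeDesc_gen, hv]

end free

/-! ### Free covers -/

section cover

variable (V : GMod A)

/-- The elements of bases of the homogeneous pieces of `V`. -/
abbrev CoverIdx : Type u := Σ (j : I) (m : ℤ), Module.Basis.ofVectorSpaceIndex k (V.piece j m)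

/-- A free module with a surjection onto `V`. -/
def cover : GMod A := free A (fun g : V.CoverIdx => g.1) (fun g => g.2.1)

instance : Projective V.cover := inferInstanceAs (Projective (free A _ _))

/-- The projection from the free cover. -/
def coverMap : V.cover ⟶ V :=
  freeDesc (σ := fun g : V.CoverIdx => g.1) (δ := fun g => g.2.1)
    fun g => (g.2.2 : V.piece g.1 g.2.1)

theorem coverMap_surjective (i : I) (n : ℤ) : Function.Surjective (V.coverMap.app i n) := by
  intro v
  suffices h : (⊤ : Submodule k (V.piece i n)) ≤ LinearMap.range (V.coverMap.app i n) from
    h (Submodule.mem_top (x := v))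
  rw [← (Module.Basis.ofVectorSpace k (V.piece i n)).span_eq, Submodule.span_le]
  rintro _ ⟨b, rfl⟩
  refine ⟨freeGen (σ := fun g : V.CoverIdx => g.1) (δ := fun g => g.2.1) ⟨i, n, b⟩, ?_⟩
  rw [Module.Basis.ofVectorSpace_apply_self]
  exact freeDesc_gen (σ := fun g : V.CoverIdx => g.1) (δ := fun g => g.2.1) _ ⟨i, n, b⟩

theorem exists_lower_bound {α : Type*} [Finite α] {P : α → ℤ → Prop}
    (h : ∀ a, ∃ N : ℤ, ∀ n < N, P a n) : ∃ N : ℤ, ∀ a, ∀ n < N, P a n := by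
  classical
  choose N hN using h
  have := Fintype.ofFinite α
  obtain ⟨M, hM⟩ := (Set.finite_range N).bddBelow
  exact ⟨M, fun a n hn => hN a n (hn.trans_le (hM ⟨a, rfl⟩))⟩

/-- A summand 1ᵢA_p v of degree n has v of degree m with p + m = n. Both p and m are bounded below,
uniformly over the finite index set, so only finitely many m and v contribute. -/
theorem cover_locallyFinite [Finite I] (hA : A.FiniteBelow) (hV : V.LocallyFinite)
    (hb : V.BoundedBelow) : V.cover.LocallyFinite := by
  intro i n
  obtain ⟨N, hN⟩ := exists_lower_bound hb
  obtain ⟨M, hM⟩ := exists_lower_bound (hA.2 i)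
  refine finiteDimensional_directSum _ (fun x => hA.1 _ _ _) ?_
  have hfin : ∀ j m, Finite (Module.Basis.ofVectorSpaceIndex k (V.piece j m)) := fun j m =>
    have := hV j m
    Module.Finite.finite_basis (Module.Basis.ofVectorSpace k (V.piece j m))
  have h1 : Finite (Σ (j : I) (m : Set.Icc N (n - M)),
      Module.Basis.ofVectorSpaceIndex k (V.piece j m)) := inferInstance
  refine (Set.finite_range fun g : Σ (j : I) (m : Set.Icc N (n - M)),
      Module.Basis.ofVectorSpaceIndex k (V.piece j m) =>
    (⟨(⟨g.1, g.2.1.1, g.2.2⟩, n - g.2.1.1), by simp⟩ :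
      FreeIdx (fun g : V.CoverIdx => g.2.1) n)).subset ?_
  rintro ⟨⟨⟨j, m, b⟩, p⟩, hp⟩ hx
  have hp' : p + m = n := hp
  have hm1 : N ≤ m := by
    by_contra hlt
    have := hN j m (not_le.1 hlt)
    exact (Module.Basis.ofVectorSpace k (V.piece j m)).ne_zero b (Subsingleton.elim _ _)
  have hm2 : M ≤ p := by
    by_contra hlt
    exact hx (hM j p (not_le.1 hlt))
  obtain rfl : p = n - m := by omega
  exact ⟨⟨j, ⟨m, hm1, by omega⟩, b⟩, rfl⟩

end cover

end GMod

/-! ### Ideals and the triangular basis -/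

namespace Weights

variable {Λ : Type v} (w : Weights I Λ)

theorem indices_mono {Γ Γ' : Set Λ} (h : Γ ⊆ Γ') : w.indices Γ ⊆ w.indices Γ' :=
  fun _ ⟨hi, hΓ⟩ => ⟨hi, h hΓ⟩

end Weights

namespace LUGAlg

variable (A : LUGAlg k I)

theorem mul_mem_idealOf {T : Set I} {i s j : I} {m n d : ℤ} (hs : s ∈ T) (h : m + n = d)
    (a : A.piece i s m) (b : A.piece s j n) : A.mul h a b ∈ (A.idealOf T).piece i j d :=
  Submodule.subset_span ⟨s, hs, m, n, h, a, b, rfl⟩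

theorem mem_idealOf_left {T : Set I} {i j : I} {d : ℤ} (hi : i ∈ T) (a : A.piece i j d) :
    a ∈ (A.idealOf T).piece i j d := by
  rw [← A.one_mul (zero_add d) a]
  exact A.mul_mem_idealOf hi _ _ _

theorem mem_idealOf_right {T : Set I} {i j : I} {d : ℤ} (hj : j ∈ T) (a : A.piece i j d) :
    a ∈ (A.idealOf T).piece i j d := by
  rw [← A.mul_one (add_zero d) a]
  exact A.mul_mem_idealOf hj _ _ _

theorem idealOf_mono {T T' : Set I} (h : T ⊆ T') (i j : I) (d : ℤ) :
    (A.idealOf T).piece i j d ≤ (A.idealOf T').piece i j d :=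
  Submodule.span_mono fun _ ⟨s, hs, hx⟩ => ⟨s, h hs, hx⟩

end LUGAlg

namespace GMod

variable {A : LUGAlg k I} (V : GMod A)

theorem act_mem_generatedBy {T : Set I} {i s : I} {m n p : ℤ} (hs : s ∈ T) (h : m + n = p)
    (a : A.piece i s m) (v : V.piece s n) : V.act h a v ∈ (V.generatedBy T).piece i p :=
  Submodule.subset_span ⟨s, hs, m, n, h, a, v, rfl⟩

theorem act_mem_generatedBy_of_mem {T : Set I} {i j : I} {m n p : ℤ} (h : m + n = p)
    {a : A.piece i j m} (ha : a ∈ (A.idealOf T).piece i j m) (v : V.piece j n) :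
    V.act h a v ∈ (V.generatedBy T).piece i p := by
  induction ha using Submodule.span_induction with
  | mem x hx =>
    obtain ⟨s, hs, m', n', h', a, b, rfl⟩ := hx
    rw [V.mul_act h' h rfl (by omega)]
    exact V.act_mem_generatedBy hs _ _ _
  | zero => simp
  | add x y _ _ hx hy => simpa using add_mem hx hy
  | smul t x _ hx => simpa using Submodule.smul_mem _ t hx

theorem act_eq_zero_of_mem {T : Set I} (hT : ∀ s ∈ T, ∀ n, Subsingleton (V.piece s n))
    {i j : I} {m n p : ℤ} (h : m + n = p) {a : A.piece i j m}
    (ha : a ∈ (A.idealOf T).piece i j m) (v : V.piece j n) : V.act h a v = 0 := by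
  have h0 : (V.generatedBy T).piece i p = ⊥ := by
    refine Submodule.span_eq_bot.2 ?_
    rintro _ ⟨s, hs, m', n', h', a, b, rfl⟩
    have := hT s hs n'
    rw [Subsingleton.elim b 0, map_zero]
  have := V.act_mem_generatedBy_of_mem h ha v
  rwa [h0] at this

theorem generatedBy_mono {T T' : Set I} (h : T ⊆ T') : V.generatedBy T ≤ V.generatedBy T' :=
  fun _ _ => Submodule.span_mono fun _ ⟨s, hs, hx⟩ => ⟨s, h hs, hx⟩

theorem mem_generatedBy {T : Set I} {s : I} (hs : s ∈ T) {n : ℤ} (v : V.piece s n) :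
    v ∈ (V.generatedBy T).piece s n := by
  rw [← V.one_act (zero_add n) v]
  exact V.act_mem_generatedBy hs _ _ _

end GMod

namespace TriangularBasis

variable {A : LUGAlg k I} {Λ : Type v} [PartialOrder Λ] (T : TriangularBasis A Λ)

theorem X_dot_le {i : I} (hi : i ∈ T.S) {s : T.S} (x : T.X i s) : T.dot s ≤ T.dot ⟨i, hi⟩ := by
  by_cases h : (⟨i, hi⟩ : T.S) = s
  · rw [h]
  · exact (T.X_lt ⟨i, hi⟩ s h ⟨x.1, x.2⟩).le

theorem Y_dot_le {j : I} (hj : j ∈ T.S) {t : T.S} (y : T.Y t j) : T.dot t ≤ T.dot ⟨j, hj⟩ := by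
  by_cases h : t = (⟨j, hj⟩ : T.S)
  · rw [h]
  · exact (T.Y_lt t ⟨j, hj⟩ h ⟨y.1, y.2⟩).le

theorem H_dot_eq {s t : T.S} (h : T.H s t) : T.dot s = T.dot t := by
  by_cases hst : s = t
  · rw [hst]
  · exact T.H_eq s t hst ⟨h.1, h.2⟩

include T in
theorem wellFoundedLT : WellFoundedLT Λ := by
  refine ⟨Subrelation.wf (r := InvImage (· < ·) fun l : Λ => (Set.Iic l).ncard) ?_
    (InvImage.wf _ wellFounded_lt)⟩
  intro a b hab
  exact Set.ncard_lt_ncard (Set.Iic_ssubset_Iic.2 hab) (T.lowerFinite b)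

/-- The triples `(x, h, y)` of basis elements. -/
abbrev Triple (i j : I) (d : ℤ) := BasisTriple A T.X T.H T.Y i j d

variable {T} in
theorem dot_eq {i j : I} {d : ℤ} (q : T.Triple i j d) : T.dot q.s = T.dot q.t := T.H_dot_eq q.h

theorem mem_span_product {i j : I} {d : ℤ} (a : A.piece i j d) :
    a ∈ Submodule.span k (Set.range fun q : T.Triple i j d => q.product) := by
  rw [(T.basis i j d).2]
  trivial

/-- The span of the triple products `x h y` with `x h ∈ A 1ₛ` and the weight of `s` in `Γ`. -/
def triSpan (Γ : Set Λ) (i j : I) (d : ℤ) : Submodule k (A.piece i j d) :=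
  Submodule.span k {a | ∃ q : T.Triple i j d, T.dot q.s ∈ Γ ∧ q.product = a}

theorem triSpan_mono {Γ Γ' : Set Λ} (h : Γ ⊆ Γ') (i j : I) (d : ℤ) :
    T.triSpan Γ i j d ≤ T.triSpan Γ' i j d :=
  Submodule.span_mono fun _ ⟨q, hq, hx⟩ => ⟨q, h hq, hx⟩

/-- Straightening, by well-founded induction on the weight: rewriting a product through an
idempotent of weight l in the triangular basis either produces a basis element or passes through a
strictly smaller weight. -/
theorem mul_mem_triSpan (l : Λ) : ∀ {i j r : I} {d e f : ℤ} (h : d + e = f) (hr : r ∈ T.S)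
    (_ : T.dot ⟨r, hr⟩ = l) (a : A.piece i r d) (b : A.piece r j e),
    A.mul h a b ∈ T.triSpan (Set.Iic l) i j f := by
  have := T.wellFoundedLT
  have hwf : WellFounded ((· < ·) : Λ → Λ → Prop) := wellFounded_lt
  induction l using hwf.induction with
  | _ l ih =>
  -- The case where the left factor is a basis element x. The general case reduces to it by
  -- expanding the left factor: its triples end at r, so their weight is at most l by triangularity
  -- of Y.
  have key : ∀ {i j : I} {s : T.S} {d e f : ℤ} (h : d + e = f) (_ : T.dot s ≤ l)
      (x : A.piece i s d) (_ : ⟨d, x⟩ ∈ T.X i s) (c : A.piece s j e),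
      A.mul h x c ∈ T.triSpan (Set.Iic l) i j f := by
    intro i j s d e f h hs x hx c
    induction T.mem_span_product c using Submodule.span_induction with
    | zero => simp
    | add a b _ _ ha hb => simpa using add_mem ha hb
    | smul t a _ ha => simpa using Submodule.smul_mem _ t ha
    | mem c hc =>
      obtain ⟨⟨s', t', x', h', y', deg⟩, rfl⟩ := hc
      by_cases hss : s = s'
      · subst hss
        obtain ⟨x', hx'⟩ := x'
        have hx'' := hx'
        rw [T.X_self s] at hx''
        obtain rfl : x' = ⟨0, A.one s⟩ := hx''
        have deg' : 0 + h'.1.1 + y'.1.1 = e := deg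
        have deg₂ : d + h'.1.1 + y'.1.1 = f := by omega
        have deg₃ : d + (h'.1.1 + y'.1.1) = f := by omega
        refine Submodule.subset_span ⟨⟨s, t', ⟨⟨d, x⟩, hx⟩, h', y', deg₂⟩, hs, ?_⟩
        · change A.mul _ (A.mul rfl x h'.1.2) y'.1.2 =
            A.mul h x (A.mul deg (A.mul rfl (A.one s) h'.1.2) y'.1.2)
          rw [A.mul_assoc rfl deg₂ (rfl : h'.1.1 + y'.1.1 = _) deg₃,
            A.mul_assoc rfl _ (rfl : h'.1.1 + y'.1.1 = _) (by omega)]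
          have : ∀ {e' : ℤ} (z : A.piece s j e') (h₁ : 0 + e' = e) (h₂ : d + e' = f),
              A.mul h₂ x z = A.mul h x (A.mul h₁ (A.one s) z) := by
            intro e' z h₁ h₂
            obtain rfl : e' = e := by omega
            rw [A.one_mul]
          exact this _ _ _
      -- Here x x' is no longer a basis element, but the product passes through s', of smaller
      -- weight, and the induction hypothesis applies.
      · have hlt : T.dot s' < T.dot s := T.X_lt s s' hss ⟨x'.1, x'.2⟩
        have deg' : x'.1.1 + h'.1.1 + y'.1.1 = e := deg
        have := ih (T.dot s') (hlt.trans_le hs)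
          (show (d + x'.1.1) + (h'.1.1 + y'.1.1) = f by omega) s'.2 rfl (A.mul rfl x x'.1.2)
          (A.mul rfl h'.1.2 y'.1.2)
        change A.mul h x (A.mul deg (A.mul rfl x'.1.2 h'.1.2) y'.1.2) ∈ _
        rw [A.mul_assoc rfl deg rfl (by omega), ← A.mul_assoc rfl (show d + x'.1.1 + (h'.1.1 + y'.1.1) = f by omega) _ _]
        · exact T.triSpan_mono (Set.Iic_subset_Iic.2 (hlt.le.trans hs)) _ _ _ this
  intro i j r d e f h hr hrl a b
  induction T.mem_span_product a using Submodule.span_induction with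
  | zero => simp
  | add a b _ _ ha hb => simpa using add_mem ha hb
  | smul t a _ ha => simpa using Submodule.smul_mem _ t ha
  | mem a ha =>
    obtain ⟨⟨s', t', x', h', y', deg⟩, rfl⟩ := ha
    have deg' : x'.1.1 + h'.1.1 + y'.1.1 = d := deg
    have h1 : T.dot s' ≤ l := by
      rw [T.H_dot_eq h', ← hrl]
      exact T.Y_dot_le hr y'
    change A.mul h (A.mul deg (A.mul rfl x'.1.2 h'.1.2) y'.1.2) b ∈ _
    rw [A.mul_assoc rfl deg rfl (by omega), A.mul_assoc _ h rfl
      (show x'.1.1 + (h'.1.1 + y'.1.1 + e) = f by omega)]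
    exact key _ h1 _ x'.2 _

/-- The basis is adapted to the ideals of lower sets. All later computations in quotients of A
become statements about which triples survive. -/
theorem idealOf_indices {Γ : Set Λ} (hΓ : IsLowerSet Γ) (i j : I) (d : ℤ) :
    (A.idealOf (T.indices Γ)).piece i j d = T.triSpan Γ i j d := by
  refine le_antisymm (Submodule.span_le.2 ?_) (Submodule.span_le.2 ?_)
  · rintro _ ⟨s, ⟨hs, hsΓ⟩, m, n, h, a, b, rfl⟩
    exact T.triSpan_mono (fun x (hx : x ≤ _) => hΓ hx hsΓ) _ _ _ (T.mul_mem_triSpan _ h hs rfl a b)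
  · rintro a ⟨⟨s, t, x, h, y, deg⟩, hq, rfl⟩
    have deg' : x.1.1 + h.1.1 + y.1.1 = d := deg
    change A.mul deg (A.mul rfl x.1.2 h.1.2) y.1.2 ∈ (A.idealOf (T.indices Γ)).piece i j d
    rw [A.mul_assoc rfl deg rfl (by omega)]
    have hs : (s : I) ∈ T.indices Γ := ⟨s.2, hq⟩
    exact A.mul_mem_idealOf hs _ _ _

theorem triSpan_inter_left {Γ : Set Λ} {l : Λ} {s : I} (hs : s ∈ T.indices {l}) (j : I) (d : ℤ) :
    T.triSpan Γ s j d ≤ T.triSpan (Γ ∩ Set.Iic l) s j d := by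
  refine Submodule.span_mono ?_
  rintro _ ⟨q, hq, rfl⟩
  obtain ⟨hs, rfl⟩ := hs
  exact ⟨q, ⟨hq, T.X_dot_le hs q.x⟩, rfl⟩

theorem triSpan_inter_right {Γ : Set Λ} {l : Λ} {t : I} (ht : t ∈ T.indices {l}) (i : I) (d : ℤ) :
    T.triSpan Γ i t d ≤ T.triSpan (Γ ∩ Set.Iic l) i t d := by
  refine Submodule.span_mono ?_
  rintro _ ⟨q, hq, rfl⟩
  obtain ⟨ht, rfl⟩ := ht
  exact ⟨q, ⟨hq, (dot_eq q).trans_le (T.Y_dot_le ht q.y)⟩, rfl⟩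

theorem isLowerSet_not_ge (l : Λ) : IsLowerSet {m : Λ | ¬ l ≤ m} :=
  fun _ _ hab ha hb => ha (hb.trans hab)

theorem not_ge_inter_Iic (l : Λ) : {m : Λ | ¬ l ≤ m} ∩ Set.Iic l = Set.Iio l := by
  ext m
  simp only [Set.mem_inter_iff, Set.mem_ofPred_eq, Set.mem_Iic, Set.mem_Iio, lt_iff_le_not_ge]
  exact and_comm

/-- A triple starting at weight l has weight ≤ l by triangularity of X. If its weight is also not ≥
l, it is < l. Thus, next to e_l, only the smaller weights matter in the ideal defining A_{≥l}, and
incomparable weights may be ignored. -/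
theorem geIdeal_le_left {l : Λ} {s : I} (hs : s ∈ T.indices {l}) (j : I) (d : ℤ) :
    (T.geIdeal A l).piece s j d ≤ (A.idealOf (T.indices (Set.Iio l))).piece s j d := by
  rw [Weights.geIdeal, T.idealOf_indices (isLowerSet_not_ge l), T.idealOf_indices (isLowerSet_Iio l),
    ← not_ge_inter_Iic l]
  exact T.triSpan_inter_left hs j d

theorem geIdeal_le_right {l : Λ} {t : I} (ht : t ∈ T.indices {l}) (i : I) (d : ℤ) :
    (T.geIdeal A l).piece i t d ≤ (A.idealOf (T.indices (Set.Iio l))).piece i t d := by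
  rw [Weights.geIdeal, T.idealOf_indices (isLowerSet_not_ge l), T.idealOf_indices (isLowerSet_Iio l),
    ← not_ge_inter_Iic l]
  exact T.triSpan_inter_right ht i d

theorem Iio_le_geIdeal (l : Λ) (i j : I) (d : ℤ) :
    (A.idealOf (T.indices (Set.Iio l))).piece i j d ≤ (T.geIdeal A l).piece i j d :=
  A.idealOf_mono (T.indices_mono fun _ h => not_le_of_gt h) i j d

theorem lowerPart_inter {V : GMod A} {Γ : Set Λ} (hΓ : IsLowerSet Γ) {l : Λ} {s : I}
    (hs : s ∈ T.indices {l}) (n : ℤ) :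
    (T.lowerPart V Γ).piece s n ≤ (T.lowerPart V (Γ ∩ Set.Iic l)).piece s n := by
  refine Submodule.span_le.2 ?_
  rintro _ ⟨r, hr, m, n', h, a, v, rfl⟩
  refine V.act_mem_generatedBy_of_mem h ?_ v
  rw [T.idealOf_indices (hΓ.inter (isLowerSet_Iic l))]
  refine T.triSpan_inter_left hs _ _ ?_
  rw [← T.idealOf_indices hΓ]
  exact A.mem_idealOf_right hr a

theorem lowerPart_mono (V : GMod A) {Γ Γ' : Set Λ} (h : Γ ⊆ Γ') :
    T.lowerPart V Γ ≤ T.lowerPart V Γ' :=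
  V.generatedBy_mono (T.indices_mono h)

/-- A weight idempotent outside of a lower set only sees the strictly smaller weights. -/
theorem lowerPart_le_Iio {V : GMod A} {Γ : Set Λ} (hΓ : IsLowerSet Γ) {l : Λ} (hl : l ∉ Γ) {s : I}
    (hs : s ∈ T.indices {l}) (n : ℤ) :
    (T.lowerPart V Γ).piece s n ≤ (T.lowerPart V (Γ ∩ Set.Iio l)).piece s n := by
  refine (T.lowerPart_inter hΓ hs n).trans (T.lowerPart_mono V ?_ s n)
  rintro m ⟨hm, hml⟩
  exact ⟨hm, lt_of_le_of_ne hml fun h => hl (h ▸ hm)⟩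

/-- Only finitely many weights are needed to bound the triples starting at i: the weight of i itself
if i is special, and those allowed by `finite_special` otherwise. A module killed by e_Γ for the
resulting Γ has zero component at i. -/
theorem exists_idealOf_eq_top (i : I) {Γ₀ : Set Λ} (h₀ : Γ₀.Finite) (hl₀ : IsLowerSet Γ₀) :
    ∃ Γ : Set Λ, Γ₀ ⊆ Γ ∧ Γ.Finite ∧ IsLowerSet Γ ∧
      ∀ j d, (A.idealOf (T.indices Γ)).piece i j d = ⊤ := by
  have key : ∃ F : Set T.S, F.Finite ∧ ∀ s, (T.X i s).Nonempty → ∃ t ∈ F, T.dot s ≤ T.dot t := by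
    by_cases hi : i ∈ T.S
    · exact ⟨{⟨i, hi⟩}, Set.finite_singleton _, fun s ⟨x, hx⟩ =>
        ⟨⟨i, hi⟩, rfl, T.X_dot_le hi ⟨x, hx⟩⟩⟩
    · exact ⟨_, T.finite_special i hi, fun s hs => ⟨s, Or.inl hs, le_rfl⟩⟩
  obtain ⟨F, hF, hX⟩ := key
  have hlow : IsLowerSet (Γ₀ ∪ ⋃ s ∈ F, Set.Iic (T.dot s)) :=
    hl₀.union (isLowerSet_iUnion₂ fun _ _ => isLowerSet_Iic _)
  refine ⟨Γ₀ ∪ ⋃ s ∈ F, Set.Iic (T.dot s), Set.subset_union_left,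
    h₀.union (hF.biUnion fun s _ => T.lowerFinite _), hlow, fun j d => ?_⟩
  rw [T.idealOf_indices hlow, eq_top_iff, ← (T.basis i j d).2]
  refine Submodule.span_mono ?_
  rintro _ ⟨q, rfl⟩
  obtain ⟨t, ht, hle⟩ := hX q.s ⟨q.x.1, q.x.2⟩
  exact ⟨q, Or.inr (Set.mem_biUnion ht hle), rfl⟩

end TriangularBasis

/-! ### Costandard modules -/

namespace Weights

variable {Λ : Type v} [PartialOrder Λ] {A : LUGAlg k I} (w : Weights I Λ) {l : Λ}

/-- The projection `A → A_{≥ l}`. -/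
def toGE (l : Λ) (i j : I) (d : ℤ) : A.piece i j d →ₗ[k] (w.algGE A l).piece i j d :=
  ((w.geIdeal A l).piece i j d).mkQ

theorem toGE_surjective (i j : I) (d : ℤ) :
    Function.Surjective (w.toGE (A := A) l i j d) :=
  Submodule.mkQ_surjective _

theorem toGE_eq_zero {i j : I} {d : ℤ} {a : A.piece i j d} :
    w.toGE l i j d a = 0 ↔ a ∈ (w.geIdeal A l).piece i j d :=
  Submodule.Quotient.mk_eq_zero _

/-- The projection `e_l A e_l → A_l`. -/
def bar (s t : w.indices {l}) (d : ℤ) : A.piece s t d →ₗ[k] (w.algAt A l).piece s t d :=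
  w.toGE l s t d

theorem bar_surjective (s t : w.indices {l}) (d : ℤ) :
    Function.Surjective (w.bar (A := A) s t d) :=
  Submodule.mkQ_surjective _

theorem bar_mul {s t r : w.indices {l}} {d e f : ℤ} (h : d + e = f) (a : A.piece s t d)
    (b : A.piece t r e) :
    w.bar s r f (A.mul h a b) = (w.algAt A l).mul h (w.bar s t d a) (w.bar t r e b) := rfl

theorem bar_one (s : w.indices {l}) : w.bar s s 0 (A.one s) = (w.algAt A l).one s := rfl

variable (N : GMod (w.algAt A l))

/-- The value of an element of `j^l_* N`, viewed as a homomorphism, at an element of `A`. -/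
def costdApply {i : I} {s : w.indices {l}} {p n m : ℤ} (h : p + n = m) :
    (w.costandardize N).piece i n →ₗ[k] A.piece s i p →ₗ[k] N.piece s m :=
  ((LinearMap.proj (R := k) (φ := fun p : GMod.HomIdx (w.indices {l}) n =>
      (w.algGE A l).piece p.1.1 i p.1.2.1 →ₗ[k] N.piece p.1.1 p.1.2.2) ⟨(s, p, m), h⟩).comp
    (GMod.cornerHom N i n).subtype).compr₂ LinearMap.id |>.compl₂ (w.toGE l s i p)

theorem costdApply_act {i j : I} {s : w.indices {l}} {d n m p p' q : ℤ} (h : d + n = m)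
    (h₁ : p + d = p') (h₂ : p + m = q) (h₃ : p' + n = q) (c : A.piece i j d)
    (y : (w.costandardize N).piece j n) (a : A.piece s i p) :
    w.costdApply N h₂ ((w.costandardize N).act h c y) a =
      w.costdApply N h₃ y (A.mul h₁ a c) := by
  subst h₁
  rfl

theorem costdApply_mul {i : I} {s t : w.indices {l}} {e n n' m m' d : ℤ} (h₁ : e + n = n')
    (h₂ : n + d = m) (h₃ : n' + d = m') (h₄ : e + m = m') (b : A.piece s t e) (a : A.piece t i n)
    (y : (w.costandardize N).piece i d) :
    w.costdApply N h₃ y (A.mul h₁ b a) = N.act h₄ (w.bar s t e b) (w.costdApply N h₂ y a) :=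
  y.2 s t e n n' m m' h₁ h₂ h₃ h₄ (w.bar s t e b) (w.toGE l t i n a)

theorem costd_ext {i : I} {n : ℤ} {y y' : (w.costandardize N).piece i n}
    (h : ∀ (s : w.indices {l}) (p m : ℤ) (hp : p + n = m) (a : A.piece s i p),
      w.costdApply N hp y a = w.costdApply N hp y' a) : y = y' := by
  refine Subtype.ext (funext fun p => LinearMap.ext fun a => ?_)
  obtain ⟨⟨s, p, m⟩, hp⟩ := p
  obtain ⟨a, rfl⟩ := w.toGE_surjective _ _ _ a
  exact h s p m hp a

/-- Evaluation of an element of `e_l j^l_* N` at the idempotent. -/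
def ev (s : w.indices {l}) (n : ℤ) : (w.costandardize N).piece s n →ₗ[k] N.piece s n :=
  (w.costdApply N (zero_add n)).flip (A.one s)

theorem ev_act {i : I} {s : w.indices {l}} {p n m : ℤ} (h : p + n = m) (a : A.piece s i p)
    (y : (w.costandardize N).piece i n) :
    w.ev N s m ((w.costandardize N).act h a y) = w.costdApply N h y a := by
  change w.costdApply N (zero_add m) ((w.costandardize N).act h a y) (A.one s) = _
  rw [w.costdApply_act N h (zero_add p) (zero_add m) h, A.one_mul]

theorem ev_act_bar {s t : w.indices {l}} {p n m : ℤ} (h : p + n = m) (a : A.piece s t p)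
    (y : (w.costandardize N).piece t n) :
    w.ev N s m ((w.costandardize N).act h a y) = N.act h (w.bar s t p a) (w.ev N t n y) := by
  rw [ev_act, ← A.mul_one (add_zero p) a]
  rw [w.costdApply_mul N (add_zero p) (zero_add n) h h, A.mul_one]
  rfl

/-- An element of j_*N is a homomorphism on e_l A_{≥l} 1ᵢ, and its values are recovered by acting
and then evaluating at an idempotent. So a nonzero submodule of j_*N always has a nonzero part of
weight l; uniqueness of maps into j_*N rests on this. -/
theorem costd_eq_zero {i : I} {n : ℤ} {y : (w.costandardize N).piece i n}
    (h : ∀ (s : w.indices {l}) (p m : ℤ) (hp : p + n = m) (a : A.piece s i p),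
      w.ev N s m ((w.costandardize N).act hp a y) = 0) : y = 0 := by
  refine w.costd_ext N fun s p m hp a => ?_
  rw [← ev_act, h, map_zero, LinearMap.zero_apply]

theorem costd_subsingleton {r : I} (hr : r ∈ w.indices {m | ¬ l ≤ m}) (n : ℤ) :
    Subsingleton ((w.costandardize N).piece r n) := by
  refine subsingleton_of_forall_eq 0 fun y => w.costd_ext N fun s p m hp a => ?_
  have : w.toGE l s r p a = 0 := w.toGE_eq_zero.2 (A.mem_idealOf_right hr a)
  change y.1 ⟨(s, p, m), hp⟩ (w.toGE l s r p a) = _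
  rw [this, map_zero, map_zero, LinearMap.zero_apply]

theorem costd_subsingleton_of_lt {r : I} (hr : r ∈ w.indices (Set.Iio l)) (n : ℤ) :
    Subsingleton ((w.costandardize N).piece r n) :=
  w.costd_subsingleton N (w.indices_mono (Γ := Set.Iio l) (Γ' := {m | ¬ l ≤ m})
    (fun _ hx => not_le_of_gt hx) hr) n

variable {N} in
theorem hom_costd_ext {W : GMod A} {f g : W ⟶ w.costandardize N}
    (h : ∀ (s : w.indices {l}) n v, w.ev N s n (f.app s n v) = w.ev N s n (g.app s n v)) :
    f = g := by
  rw [← sub_eq_zero]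
  refine GMod.eq_zero_of_app fun i n x => w.costd_eq_zero N fun s p m hp a => ?_
  rw [← (f - g).app_act, GMod.sub_app, map_sub, h, sub_self]

theorem hom_costd_eq_zero {W : GMod A} (f : W ⟶ w.costandardize N)
    (h : ∀ (s : w.indices {l}) n v, w.ev N s n (f.app s n v) = 0) : f = 0 :=
  w.hom_costd_ext fun s n v => by rw [h, GMod.zero_app, map_zero]

end Weights

-- Maps into costandard modules

namespace TriangularBasis

variable {A : LUGAlg k I} {Λ : Type v} [PartialOrder Λ] (T : TriangularBasis A Λ) {l : Λ}
  {N : GMod (T.algAt A l)}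

section

variable {W : GMod A} (ψ : ∀ (s : T.indices {l}) (n : ℤ), W.piece s n →ₗ[k] N.piece s n)
  (hψ : ∀ (s t : T.indices {l}) (d n m : ℤ) (h : d + n = m) (a : A.piece s t d) (v : W.piece t n),
    ψ s m (W.act h a v) = N.act h (T.bar s t d a) (ψ t n v))
  (h₀ : ∀ (s : T.indices {l}) (r : I) (_ : r ∈ T.indices (Set.Iio l)) (d n m : ℤ) (h : d + n = m)
    (a : A.piece s r d) (v : W.piece r n), ψ s m (W.act h a v) = 0)

include h₀ in
theorem costd_lift_ker {i : I} {s : T.indices {l}} {d n m : ℤ} (h : d + n = m) (v : W.piece i n)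
    (a : A.piece s i d) (ha : a ∈ (T.geIdeal A l).piece s i d) : ψ s m (W.act h a v) = 0 := by
  have := W.act_mem_generatedBy_of_mem h (T.geIdeal_le_left s.2 i d ha) v
  suffices h1 : (W.generatedBy (T.indices (Set.Iio l))).piece s m ≤ LinearMap.ker (ψ s m) from
    h1 this
  refine Submodule.span_le.2 ?_
  rintro _ ⟨r, hr, p, q, hpq, a, v, rfl⟩
  exact h₀ s r hr p q m hpq a v

-- Adjunction for an arbitrary module W: send v to a ↦ ψ(av). This descends to A_{≥l} because, by
-- `geIdeal_le_left`, an element of the defining ideal next to e_l sends v into what is generated by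
-- weights < l, and `h₀` says that ψ kills this.
include hψ h₀ in
theorem exists_hom_costd :
    ∃ f : W ⟶ T.costandardize N, ∀ s n v, T.ev N s n (f.app s n v) = ψ s n v := by
  let F (i : I) (n : ℤ) : W.piece i n →ₗ[k] (T.costandardize N).piece i n :=
    { toFun := fun v => (⟨fun p => Submodule.liftQ ((T.geIdeal A l).piece p.1.1 i p.1.2.1)
          ((ψ p.1.1 p.1.2.2).comp ((W.act p.2).flip v))
          fun a ha => T.costd_lift_ker ψ h₀ p.2 v a ha, by
        intro s t e p p' q q' h₁ h₂ h₃ h₄ b a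
        obtain ⟨a, rfl⟩ := T.toGE_surjective _ _ _ a
        obtain ⟨b, rfl⟩ := T.bar_surjective _ _ _ b
        change ψ s q' (W.act h₃ (A.mul h₁ b a) v) = N.act h₄ (T.bar s t e b) (ψ t q (W.act h₂ a v))
        rw [W.mul_act h₁ h₃ h₂ h₄, hψ]⟩ : GMod.cornerHom N i n)
      map_add' := fun x y => Subtype.ext (funext fun p => LinearMap.ext fun a => by
        obtain ⟨a, rfl⟩ := T.toGE_surjective _ _ _ a
        change ψ p.1.1 p.1.2.2 (W.act p.2 a (x + y)) =
          ψ p.1.1 p.1.2.2 (W.act p.2 a x) + ψ p.1.1 p.1.2.2 (W.act p.2 a y)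
        rw [map_add, map_add])
      map_smul' := fun c x => Subtype.ext (funext fun p => LinearMap.ext fun a => by
        obtain ⟨a, rfl⟩ := T.toGE_surjective _ _ _ a
        change ψ p.1.1 p.1.2.2 (W.act p.2 a (c • x)) = c • ψ p.1.1 p.1.2.2 (W.act p.2 a x)
        rw [map_smul, map_smul]) }
  have hF : ∀ {i : I} {s : T.indices {l}} {p n m : ℤ} (h : p + n = m) (v : W.piece i n)
      (a : A.piece s i p), T.costdApply N h (F i n v) a = ψ s m (W.act h a v) :=
    fun h v a => rfl
  refine ⟨GMod.Hom.mk F fun {i j d n m} h c v => T.costd_ext N fun s p q hp a => ?_, ?_⟩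
  · rw [hF, T.costdApply_act N h rfl hp (by omega), hF, W.mul_act rfl _ h hp]
  · intro s n v
    change T.costdApply N (zero_add n) (F s n v) (A.one s) = _
    rw [hF, W.one_act]

end

variable {V : GMod A} {Γ : Set Λ}

/-- The weight l part of V_Γ is generated by vectors of weight < l (`lowerPart_le_Iio`), and a
costandard module of weight l has no such vectors. -/
theorem hom_lowerPart_eq_zero (hΓ : IsLowerSet Γ) (hl : l ∉ Γ)
    (f : (T.lowerPart V Γ).toGMod ⟶ T.costandardize N) : f = 0 := by
  refine T.hom_costd_eq_zero N f fun s n v => ?_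
  obtain ⟨v, hv⟩ := v
  have h1 := T.lowerPart_le_Iio hΓ hl s.2 n hv
  -- The span defining V_Γ lives in V, so vanishing on V_Γ is phrased as an inclusion of submodules
  -- of 1ₛV and checked on generators.
  suffices h : (T.lowerPart V (Γ ∩ Set.Iio l)).piece s n ≤
      ((LinearMap.ker ((T.ev N s n).comp (f.app s n))).map
        ((T.lowerPart V Γ).piece s n).subtype) by
    obtain ⟨⟨v', hv'⟩, h2, h3⟩ := h h1
    obtain rfl : v' = v := h3
    exact h2
  refine Submodule.span_le.2 ?_
  rintro _ ⟨r, hr, p, q, hpq, a, x, rfl⟩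
  have hrΓ := T.indices_mono Set.inter_subset_left hr
  refine ⟨(T.lowerPart V Γ).elem (V.act hpq a x) (V.act_mem_generatedBy hrΓ _ _ _), ?_, rfl⟩
  change T.ev N s n (f.app s n _) = 0
  have h5 := T.costd_subsingleton_of_lt N (T.indices_mono Set.inter_subset_right hr) q
  rw [← (T.lowerPart V Γ).act_elem hpq a x (V.mem_generatedBy hrΓ x), f.app_act,
    Subsingleton.elim (f.app r q _) 0, map_zero, map_zero]

/-- For l ∈ Γ the weight spaces e_l V and e_l V_Γ coincide, and maps into j_*N are determined by and
constructed from the weight l part. -/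
theorem exists_extension_lowerPart (hΓ : IsLowerSet Γ) (hl : l ∈ Γ)
    (g : (T.lowerPart V Γ).toGMod ⟶ T.costandardize N) :
    ∃ f : V ⟶ T.costandardize N, (T.lowerPart V Γ).incl ≫ f = g := by
  have hmem : ∀ (s : T.indices {l}) n (v : V.piece s n), v ∈ (T.lowerPart V Γ).piece s n :=
    fun s n v => V.mem_generatedBy (T.indices_mono (by simpa using hl) s.2) v
  let c (s : T.indices {l}) (n : ℤ) : V.piece s n →ₗ[k] (T.lowerPart V Γ).toGMod.piece s n :=
    LinearMap.codRestrict ((T.lowerPart V Γ).piece s n) LinearMap.id (hmem s n)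
  obtain ⟨f, hf⟩ := T.exists_hom_costd (N := N) (W := V)
    (fun s n => (T.ev N s n).comp ((g.app s n).comp (c s n))) (by
      intro s t d n m h a v
      change T.ev N s m (g.app s m ((T.lowerPart V Γ).toGMod.act h a (c t n v))) = _
      rw [g.app_act, T.ev_act_bar]
      rfl) (by
      intro s r hr d n m h a v
      have hrΓ := T.indices_mono (fun x hx => hΓ (le_of_lt hx) hl) hr
      change T.ev N s m (g.app s m ((T.lowerPart V Γ).toGMod.act h a
        ((T.lowerPart V Γ).elem v (V.mem_generatedBy hrΓ v)))) = 0
      have h5 := T.costd_subsingleton_of_lt N hr n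
      rw [g.app_act, Subsingleton.elim (g.app r n _) 0, map_zero, map_zero])
  exact ⟨f, T.hom_costd_ext fun s n v => hf s n v.1⟩

theorem hom_ext_lowerPart (hl : l ∈ Γ) {f g : V ⟶ T.costandardize N}
    (h : (T.lowerPart V Γ).incl ≫ f = (T.lowerPart V Γ).incl ≫ g) : f = g := by
  refine T.hom_costd_ext fun s n v => ?_
  have hs : (s : I) ∈ T.indices Γ := T.indices_mono (by simpa using hl) s.2
  have := congrArg (fun φ : (T.lowerPart V Γ).toGMod ⟶ T.costandardize N => φ.app s n
    ((T.lowerPart V Γ).elem v (V.mem_generatedBy hs v))) h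
  exact congrArg (T.ev N s n) this

theorem exists_extension_inclLE {Γ' : Set Λ} (hΓ' : IsLowerSet Γ') (h : Γ' ⊆ Γ)
    (g : (T.lowerPart V Γ').toGMod ⟶ T.costandardize N) :
    ∃ f : (T.lowerPart V Γ).toGMod ⟶ T.costandardize N,
      GMod.Sub.inclLE (T.lowerPart_mono V h) ≫ f = g := by
  by_cases hl : l ∈ Γ'
  · obtain ⟨f, rfl⟩ := T.exists_extension_lowerPart hΓ' hl g
    exact ⟨(T.lowerPart V Γ).incl ≫ f, rfl⟩
  · exact ⟨0, by rw [T.hom_lowerPart_eq_zero hΓ' hl g, comp_zero]⟩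

/-- Either the map extends or only the zero map exists. This feeds `ext_right_one` for 0 → V_Γ → V →
V/V_Γ → 0, whatever the weight. -/
theorem exists_extension_lowerPart' (hΓ : IsLowerSet Γ)
    (g : (T.lowerPart V Γ).toGMod ⟶ T.costandardize N) :
    ∃ f : V ⟶ T.costandardize N, (T.lowerPart V Γ).incl ≫ f = g := by
  by_cases hl : l ∈ Γ
  · exact T.exists_extension_lowerPart hΓ hl g
  · exact ⟨0, by rw [T.hom_lowerPart_eq_zero hΓ hl g, comp_zero]⟩

end TriangularBasis

/-! ### Standard modules -/

namespace Weights

variable {Λ : Type v} [PartialOrder Λ] {A : LUGAlg k I} (w : Weights I Λ) {l : Λ}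

section standardize

variable (M : GMod (w.algAt A l))

/-- The element `a ⊗ v` of `j^l_! M`. -/
def stdMk {i : I} {m n d : ℤ} (t : w.indices {l}) (h : m + n = d) :
    A.piece i t m →ₗ[k] M.piece t n →ₗ[k] (w.standardize M).piece i d :=
  ((GMod.pureTensor M i t h).compr₂ (GMod.balanced M i d).mkQ).comp (w.toGE l i t m)

theorem stdMk_eq_zero {i : I} {m n d : ℤ} {t : w.indices {l}} (h : m + n = d)
    {a : A.piece i t m} (ha : a ∈ (w.geIdeal A l).piece i t m) (v : M.piece t n) :
    w.stdMk M t h a v = 0 := by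
  change (GMod.balanced M i d).mkQ (GMod.pureTensor M i t h (w.toGE l i t m a) v) = 0
  rw [w.toGE_eq_zero.2 ha, map_zero, LinearMap.zero_apply, map_zero]

theorem stdMk_mul {i : I} {s t : w.indices {l}} {m e n m' n' d : ℤ} (h₁ : m + e = m')
    (h₂ : e + n = n') (h₃ : m' + n = d) (h₄ : m + n' = d) (a : A.piece i s m) (b : A.piece s t e)
    (v : M.piece t n) :
    w.stdMk M t h₃ (A.mul h₁ a b) v = w.stdMk M s h₄ a (M.act h₂ (w.bar s t e b) v) := by
  refine (Submodule.Quotient.eq _).2 (Submodule.subset_span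
    ⟨s, t, m, e, n, m', n', h₁, h₂, h₃, h₄, w.toGE l i s m a, w.bar s t e b, v, rfl⟩)

theorem act_stdMk {i j : I} {d n m p q dp : ℤ} (h : d + n = m) (t : w.indices {l})
    (h' : p + q = n) (h₁ : d + p = dp) (h₂ : dp + q = m) (c : A.piece i j d) (a : A.piece j t p)
    (v : M.piece t q) :
    (w.standardize M).act h c (w.stdMk M t h' a v) = w.stdMk M t h₂ (A.mul h₁ c a) v :=
  congrArg (Submodule.mkQ _) (GMod.tensorAct_pure M h t h' h₁ h₂ (w.toGE l i j d c)
    (w.toGE l j t p a) v)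

variable {M} in
theorem std_induction {i : I} {d : ℤ} {P : (w.standardize M).piece i d → Prop}
    (x : (w.standardize M).piece i d) (hz : P 0) (ha : ∀ x y, P x → P y → P (x + y))
    (hp : ∀ (t : w.indices {l}) (m n : ℤ) (h : m + n = d) (a : A.piece i t m) (v : M.piece t n),
      P (w.stdMk M t h a v)) : P x := by
  obtain ⟨x, rfl⟩ := Submodule.mkQ_surjective _ x
  induction x using GMod.tensor_induction with
  | hz => exact hz
  | ha x y hx hy => exact ha _ _ hx hy
  | hp t m n h a v =>
    obtain ⟨a, rfl⟩ := w.toGE_surjective _ _ _ a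
    exact hp t m n h a v

section lift

variable {M} {i : I} {d : ℤ} {E : Type*} [AddCommGroup E] [Module k E]
  (f : ∀ (t : w.indices {l}) (m n : ℤ), m + n = d → A.piece i t m →ₗ[k] M.piece t n →ₗ[k] E)
  (h₁ : ∀ (t : w.indices {l}) (m n : ℤ) (h : m + n = d) (a : A.piece i t m),
    a ∈ (w.geIdeal A l).piece i t m → f t m n h a = 0)

open Classical in
/-- The map on tensors before passing to the balanced quotient. -/
def stdPreLift : GMod.TensorPiece M i d →ₗ[k] E :=
  DirectSum.toModule k _ _ fun p => TensorProduct.lift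
    (Submodule.liftQ ((w.geIdeal A l).piece i p.1.1 p.1.2.1) (f p.1.1 p.1.2.1 p.1.2.2 p.2)
      fun a ha => h₁ p.1.1 p.1.2.1 p.1.2.2 p.2 a ha)

theorem stdPreLift_pure (t : w.indices {l}) (m n : ℤ) (h : m + n = d) (a : A.piece i t m)
    (v : M.piece t n) :
    w.stdPreLift f h₁ (GMod.pureTensor M i t h (w.toGE l i t m a) v) = f t m n h a v := by
  classical
  refine (congrArg _ (?_ : _ = DirectSum.lof k (GMod.TensorIdx (w.indices {l}) d)
      (fun p => (w.algGE A l).piece i p.1.1 p.1.2.1 ⊗[k] M.piece p.1.1 p.1.2.2) ⟨(t, m, n), h⟩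
      (w.toGE l i t m a ⊗ₜ v))).trans ?_
  · rfl
  · rw [stdPreLift]
    refine (DirectSum.toModule_lof k _ _).trans ?_
    exact TensorProduct.lift.tmul _ _

variable (h₂ : ∀ (s t : w.indices {l}) (m e n m' n' : ℤ) (h₁ : m + e = m') (h₂ : e + n = n')
    (h₃ : m' + n = d) (h₄ : m + n' = d) (a : A.piece i s m) (b : A.piece s t e) (v : M.piece t n),
    f t m' n h₃ (A.mul h₁ a b) v = f s m n' h₄ a (M.act h₂ (w.bar s t e b) v))

/-- The linear map on a piece of `j^l_! M` defined by a balanced family of bilinear maps. -/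
def stdLift : (w.standardize M).piece i d →ₗ[k] E :=
  Submodule.liftQ (GMod.balanced M i d) (w.stdPreLift f h₁) (by
    refine Submodule.span_le.2 ?_
    rintro _ ⟨s, t, m, e, n, m', n', h₅, h₆, h₇, h₈, a, b, v, rfl⟩
    obtain ⟨a, rfl⟩ := w.toGE_surjective _ _ _ a
    obtain ⟨b, rfl⟩ := w.bar_surjective _ _ _ b
    have e1 := w.stdPreLift_pure f h₁ t m' n h₇ (A.mul h₅ a b) v
    have e2 := w.stdPreLift_pure f h₁ s m n' h₈ a (M.act h₆ (w.bar s t e b) v)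
    refine (map_sub _ _ _).trans (sub_eq_zero.2 ?_)
    exact e1.trans ((h₂ s t m e n m' n' h₅ h₆ h₇ h₈ a b v).trans e2.symm))

theorem stdLift_mk (t : w.indices {l}) (m n : ℤ) (h : m + n = d) (a : A.piece i t m)
    (v : M.piece t n) : w.stdLift f h₁ h₂ (w.stdMk M t h a v) = f t m n h a v :=
  w.stdPreLift_pure f h₁ t m n h a v

end lift

theorem std_subsingleton {r : I} (hr : r ∈ w.indices {m | ¬ l ≤ m}) (n : ℤ) :
    Subsingleton ((w.standardize M).piece r n) := by
  refine subsingleton_of_forall_eq 0 fun x => ?_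
  induction x using std_induction with
  | hz => rfl
  | ha x y hx hy => rw [hx, hy, add_zero]
  | hp t m n h a v => exact w.stdMk_eq_zero M h (A.mem_idealOf_left hr a) v

/-- The unit `M → e_l j^l_! M`. -/
def stdUnit (s : w.indices {l}) (n : ℤ) : M.piece s n →ₗ[k] (w.standardize M).piece s n :=
  w.stdMk M s (zero_add n) (A.one s)

theorem act_stdUnit {i : I} {t : w.indices {l}} {m n d : ℤ} (h : m + n = d) (a : A.piece i t m)
    (v : M.piece t n) : (w.standardize M).act h a (w.stdUnit M t n v) = w.stdMk M t h a v := by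
  rw [stdUnit, w.act_stdMk M h t (zero_add n) (add_zero m) h, A.mul_one]

theorem stdUnit_act {s t : w.indices {l}} {m n d : ℤ} (h : m + n = d) (a : A.piece s t m)
    (v : M.piece t n) :
    w.stdUnit M s d (M.act h (w.bar s t m a) v) =
      (w.standardize M).act h a (w.stdUnit M t n v) := by
  rw [act_stdUnit, stdUnit, ← w.stdMk_mul M (zero_add m) h h (zero_add d), A.one_mul]

/-- Since e_l A_{≥l} e_l is A_l, the action map a ⊗ v ↦ av inverts the unit. -/
theorem stdUnit_bijective (s : w.indices {l}) (n : ℤ) : Function.Bijective (w.stdUnit M s n) := by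
  let r : (w.standardize M).piece s n →ₗ[k] M.piece s n := w.stdLift
    (fun t m q h => (M.act h).comp (w.bar s t m))
    (fun t m q h a ha => by
      have : w.bar s t m a = 0 := w.toGE_eq_zero.2 ha
      rw [LinearMap.comp_apply, this, map_zero])
    (fun s' t m e q m' n' h₁ h₂ h₃ h₄ a b v => by
      rw [LinearMap.comp_apply, LinearMap.comp_apply, w.bar_mul]
      exact M.mul_act h₁ h₃ h₂ h₄ _ _ _)
  have hr : ∀ v, r (w.stdUnit M s n v) = v := fun v => by
    refine (w.stdLift_mk _ _ _ s 0 n (zero_add n) (A.one s) v).trans ?_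
    rw [LinearMap.comp_apply, w.bar_one]
    exact M.one_act _ v
  refine ⟨Function.LeftInverse.injective hr, fun x => ?_⟩
  induction x using std_induction with
  | hz => exact ⟨0, map_zero _⟩
  | ha x y hx hy =>
    obtain ⟨x, rfl⟩ := hx
    obtain ⟨y, rfl⟩ := hy
    exact ⟨x + y, map_add _ _ _⟩
  | hp t m q h a v => exact ⟨M.act h (w.bar s t m a) v, by rw [stdUnit_act, act_stdUnit]⟩

variable {M} in
theorem std_hom_ext {Q : GMod A} {f g : w.standardize M ⟶ Q}
    (h : ∀ (s : w.indices {l}) n v,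
      f.app s n (w.stdUnit M s n v) = g.app s n (w.stdUnit M s n v)) : f = g := by
  refine GMod.hom_ext fun i n x => ?_
  induction x using std_induction with
  | hz => simp only [map_zero]
  | ha x y hx hy => simp only [map_add, hx, hy]
  | hp t m n h' a v => rw [← act_stdUnit, f.app_act, g.app_act, h]

end standardize

/-- The weight idempotents for weights smaller than `l` act as zero. -/
def Below (l : Λ) (Q : GMod A) : Prop :=
  ∀ r ∈ w.indices (Set.Iio l), ∀ n, Subsingleton (Q.piece r n)

theorem below_standardize (M : GMod (w.algAt A l)) : w.Below l (w.standardize M) := fun _ hr n =>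
  w.std_subsingleton M (w.indices_mono (Γ := Set.Iio l) (Γ' := {m | ¬ l ≤ m})
    (fun _ hx => not_le_of_gt hx) hr) n

variable {w}

theorem Below.of_injective {Q Q' : GMod A} (h : w.Below l Q') (f : Q ⟶ Q')
    (hf : ∀ i n, Function.Injective (f.app i n)) : w.Below l Q := fun r hr n =>
  have := h r hr n
  (hf r n).subsingleton

end Weights

-- Weight spaces and their adjunction with standardization

namespace TriangularBasis

variable {A : LUGAlg k I} {Λ : Type v} [PartialOrder Λ] (T : TriangularBasis A Λ) {l : Λ}

/-- Lets A_l act on e_l Q although Q need not be an A_{≥l}-module: next to e_l the defining ideal is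
generated by weights < l, which `Below` kills. -/
theorem act_eq_zero_of_below {Q : GMod A} (hQ : T.Below l Q) {i : I} {t : T.indices {l}}
    {m n d : ℤ} (h : m + n = d) {a : A.piece i t m} (ha : a ∈ (T.geIdeal A l).piece i t m)
    (v : Q.piece t n) : Q.act h a v = 0 :=
  Q.act_eq_zero_of_mem hQ h (T.geIdeal_le_right t.2 i m ha) v

/-- The weight space `e_l Q` of a module, as a module over `A_l`. -/
def weightSpace (Q : GMod A) (hQ : T.Below l Q) : GMod (T.algAt A l) where
  piece s n := Q.piece s n
  act {s t d n m} h := Submodule.liftQ ((T.geIdeal A l).piece s t d) (Q.act h) fun a ha =>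
    LinearMap.ext fun v => T.act_eq_zero_of_below hQ h ha v
  one_act h v := Q.one_act h v
  mul_act h₁ h₂ h₃ h₄ a b v := by
    obtain ⟨a, rfl⟩ := T.bar_surjective _ _ _ a
    obtain ⟨b, rfl⟩ := T.bar_surjective _ _ _ b
    exact Q.mul_act h₁ h₂ h₃ h₄ a b v

theorem weightSpace_act (Q : GMod A) (hQ : T.Below l Q) {s t : T.indices {l}} {d n m : ℤ}
    (h : d + n = m) (a : A.piece s t d) (v : Q.piece t n) :
    (T.weightSpace Q hQ).act h (T.bar s t d a) v = Q.act h a v := rfl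

/-- The map on weight spaces. -/
def weightSpaceMap {Q Q' : GMod A} (hQ : T.Below l Q) (hQ' : T.Below l Q') (f : Q ⟶ Q') :
    T.weightSpace Q hQ ⟶ T.weightSpace Q' hQ' :=
  GMod.Hom.mk (fun s n => f.app s n) fun {s t d n m} h a v => by
    obtain ⟨a, rfl⟩ := T.bar_surjective _ _ _ a
    exact f.app_act h a v

section desc

variable {M : GMod (T.algAt A l)} {Q : GMod A} (hQ : T.Below l Q)

/-- The components of `stdDesc`. -/
def stdDescApp (φ : M ⟶ T.weightSpace Q hQ) (i : I) (d : ℤ) :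
    (T.standardize M).piece i d →ₗ[k] Q.piece i d :=
  T.stdLift (fun t _ n h => (Q.act h).compl₂ (φ.app t n))
    (fun t m n h a ha => LinearMap.ext fun v => T.act_eq_zero_of_below hQ h ha (φ.app t n v))
    (fun s t m e n m' n' h₁ h₂ h₃ h₄ a b v => by
      change Q.act h₃ (A.mul h₁ a b) (φ.app t n v) =
        Q.act h₄ a (φ.app s n' (M.act h₂ (T.bar s t e b) v))
      rw [φ.app_act]
      exact Q.mul_act h₁ h₃ h₂ h₄ a b (φ.app t n v))

theorem stdDescApp_mk (φ : M ⟶ T.weightSpace Q hQ) {i : I} {m n d : ℤ} (t : T.indices {l})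
    (h : m + n = d) (a : A.piece i t m) (v : M.piece t n) :
    T.stdDescApp hQ φ i d (T.stdMk M t h a v) = Q.act h a (φ.app t n v) :=
  T.stdLift_mk _ _ _ t m n h a v

/-- The homomorphism `j^l_! M → Q` adjoint to `M → e_l Q`. -/
def stdDesc (φ : M ⟶ T.weightSpace Q hQ) : T.standardize M ⟶ Q :=
  GMod.Hom.mk (T.stdDescApp hQ φ) fun {i j d n m} h c x => by
    induction x using Weights.std_induction with
    | hz => simp only [map_zero]
    | ha x y hx hy => simp only [map_add, hx, hy]
    | hp t p q h' a v =>
      rw [T.act_stdMk M h t h' rfl (by omega), stdDescApp_mk, stdDescApp_mk]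
      exact Q.mul_act _ _ _ _ _ _ _

theorem stdDesc_mk (φ : M ⟶ T.weightSpace Q hQ) {i : I} {m n d : ℤ} (t : T.indices {l})
    (h : m + n = d) (a : A.piece i t m) (v : M.piece t n) :
    (T.stdDesc hQ φ).app i d (T.stdMk M t h a v) = Q.act h a (φ.app t n v) :=
  T.stdDescApp_mk hQ φ t h a v

theorem stdDesc_unit (φ : M ⟶ T.weightSpace Q hQ) (s : T.indices {l}) (n : ℤ) (v : M.piece s n) :
    (T.stdDesc hQ φ).app s n (T.stdUnit M s n v) = φ.app s n v := by
  rw [Weights.stdUnit, stdDesc_mk]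
  exact Q.one_act _ _

/-- The counit `j^l_! e_l Q → Q`. -/
def counit : T.standardize (T.weightSpace Q hQ) ⟶ Q := T.stdDesc hQ (𝟙 _)

theorem counit_mk {i : I} {m n d : ℤ} (t : T.indices {l}) (h : m + n = d) (a : A.piece i t m)
    (v : Q.piece t n) : (T.counit hQ).app i d (T.stdMk (T.weightSpace Q hQ) t h a v) = Q.act h a v :=
  T.stdDesc_mk hQ (𝟙 _) t h a v

theorem counit_unit (s : T.indices {l}) (n : ℤ) (v : Q.piece s n) :
    (T.counit hQ).app s n (T.stdUnit (T.weightSpace Q hQ) s n v) = v :=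
  T.stdDesc_unit hQ (𝟙 _) s n v

end desc

section map

variable {M M' M'' : GMod (T.algAt A l)}

/-- The unit as a homomorphism of `A_l`-modules. -/
def unitHom (M : GMod (T.algAt A l)) :
    M ⟶ T.weightSpace (T.standardize M) (T.below_standardize M) :=
  GMod.Hom.mk (T.stdUnit M) fun {s t d n m} h a v => by
    obtain ⟨a, rfl⟩ := T.bar_surjective _ _ _ a
    exact T.stdUnit_act M h a v

/-- Standardization on morphisms. -/
def standardizeMap (f : M ⟶ M') : T.standardize M ⟶ T.standardize M' :=
  T.stdDesc (T.below_standardize M') (f ≫ T.unitHom M')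

theorem standardizeMap_mk (f : M ⟶ M') {i : I} {m n d : ℤ} (t : T.indices {l})
    (h : m + n = d) (a : A.piece i t m) (v : M.piece t n) :
    (T.standardizeMap f).app i d (T.stdMk M t h a v) = T.stdMk M' t h a (f.app t n v) :=
  (T.stdDesc_mk _ _ t h a v).trans (T.act_stdUnit M' h a (f.app t n v))

theorem standardizeMap_unit (f : M ⟶ M') (s : T.indices {l}) (n : ℤ) (v : M.piece s n) :
    (T.standardizeMap f).app s n (T.stdUnit M s n v) = T.stdUnit M' s n (f.app s n v) :=
  T.standardizeMap_mk f s _ _ v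

theorem standardizeMap_comp (f : M ⟶ M') (g : M' ⟶ M'') :
    T.standardizeMap (f ≫ g) = T.standardizeMap f ≫ T.standardizeMap g :=
  T.std_hom_ext fun s n v => by
    rw [GMod.comp_app, standardizeMap_unit, standardizeMap_unit, standardizeMap_unit,
      GMod.comp_app]

theorem standardizeMap_surjective (f : M ⟶ M') (hf : ∀ s n, Function.Surjective (f.app s n))
    (i : I) (n : ℤ) : Function.Surjective ((T.standardizeMap f).app i n) := by
  intro x
  induction x using Weights.std_induction with
  | hz => exact ⟨0, map_zero _⟩
  | ha x y hx hy =>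
    obtain ⟨x, rfl⟩ := hx
    obtain ⟨y, rfl⟩ := hy
    exact ⟨x + y, map_add _ _ _⟩
  | hp t m q h a v =>
    obtain ⟨v, rfl⟩ := hf t q v
    exact ⟨T.stdMk M t h a v, T.standardizeMap_mk f t h a v⟩

/-- Distinct weights: there are no homomorphisms from standard to costandard modules. -/
theorem hom_std_costd_eq_zero {l' : Λ} (hl : l ≠ l') {N : GMod (T.algAt A l')}
    (f : T.standardize M ⟶ T.costandardize N) : f = 0 := by
  by_cases h : l' ≤ l
  · refine T.hom_costd_eq_zero N f fun s n x => ?_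
    have hs : (s : I) ∈ T.indices {m | ¬ l ≤ m} :=
      T.indices_mono (Γ := {l'}) (by
        rintro _ rfl h'
        exact hl (le_antisymm h' h)) s.2
    have := T.std_subsingleton M hs n
    rw [Subsingleton.elim x 0, map_zero, map_zero]
  · refine T.std_hom_ext fun s n v => ?_
    have hs : (s : I) ∈ T.indices {m | ¬ l' ≤ m} :=
      T.indices_mono (Γ := {l}) (by
        rintro _ rfl
        exact h) s.2
    have := T.costd_subsingleton N hs n
    exact Subsingleton.elim _ _

end map

/-! ### Finiteness of standard modules -/

theorem finite_indices (l : Λ) : Finite (T.indices {l}) := by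
  have := T.finite_fibers l
  refine Set.Finite.to_subtype ((this.image Subtype.val).subset ?_)
  rintro i ⟨hi, h⟩
  exact ⟨⟨i, hi⟩, h, rfl⟩

theorem algGE_finiteBelow (hA : A.FiniteBelow) (l : Λ) : (T.algGE A l).FiniteBelow := by
  refine ⟨fun i j d => ?_, fun i j => ?_⟩
  · have := hA.1 i j d
    exact Module.Finite.of_surjective _ (T.toGE_surjective (l := l) i j d)
  · obtain ⟨N, hN⟩ := hA.2 i j
    exact ⟨N, fun d hd => have := hN d hd; (T.toGE_surjective (l := l) i j d).subsingleton⟩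

theorem algAt_finiteBelow (hA : A.FiniteBelow) (l : Λ) : (T.algAt A l).FiniteBelow :=
  ⟨fun i j d => (T.algGE_finiteBelow hA l).1 i j d, fun i j => (T.algGE_finiteBelow hA l).2 i j⟩

theorem standardize_locallyFinite (hA : A.FiniteBelow) {M : GMod (T.algAt A l)}
    (hM : M.LocallyFinite) (hb : M.BoundedBelow) : (T.standardize M).LocallyFinite := by
  intro i d
  have := T.finite_indices l
  have hB := T.algGE_finiteBelow hA l
  obtain ⟨N, hN⟩ := GMod.exists_lower_bound hb
  obtain ⟨N', hN'⟩ := GMod.exists_lower_bound fun t : T.indices {l} => hB.2 i t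
  suffices h : FiniteDimensional k (GMod.TensorPiece M i d) from
    Module.Finite.of_surjective _ (Submodule.mkQ_surjective (GMod.balanced M i d))
  refine finiteDimensional_directSum _ (fun p => ?_) ?_
  · have := hB.1 i p.1.1 p.1.2.1
    have := hM p.1.1 p.1.2.2
    infer_instance
  · refine (Set.finite_range fun x : T.indices {l} × Set.Icc N (d - N') =>
      (⟨(x.1, d - x.2.1, x.2.1), by simp⟩ : GMod.TensorIdx (T.indices {l}) d)).subset ?_
    rintro ⟨⟨t, m, n⟩, h⟩ hx
    have h' : m + n = d := h
    have h1 : N ≤ n := by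
      by_contra hlt
      have := hN t n (not_le.1 hlt)
      exact hx (inferInstanceAs (Subsingleton ((T.algGE A l).piece i t m ⊗[k] M.piece t n)))
    have h2 : N' ≤ m := by
      by_contra hlt
      have := hN' t m (not_le.1 hlt)
      exact hx (inferInstanceAs (Subsingleton ((T.algGE A l).piece i t m ⊗[k] M.piece t n)))
    obtain rfl : m = d - n := by omega
    exact ⟨⟨t, n, h1, by omega⟩, rfl⟩

theorem standardize_boundedBelow (hA : A.FiniteBelow) {M : GMod (T.algAt A l)}
    (hb : M.BoundedBelow) : (T.standardize M).BoundedBelow := by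
  intro i
  have := T.finite_indices l
  obtain ⟨N, hN⟩ := GMod.exists_lower_bound hb
  obtain ⟨N', hN'⟩ := GMod.exists_lower_bound fun t : T.indices {l} => hA.2 i t
  refine ⟨N + N', fun n hn => subsingleton_of_forall_eq 0 fun x => ?_⟩
  induction x using Weights.std_induction with
  | hz => rfl
  | ha x y hx hy => rw [hx, hy, add_zero]
  | hp t p q h a v =>
    by_cases hp : p < N'
    · have := hN' t p hp
      rw [Subsingleton.elim a 0, map_zero, LinearMap.zero_apply]
    · have := hN t q (by omega)
      rw [Subsingleton.elim v 0, map_zero]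

end TriangularBasis

/-! ### Coordinates with respect to the triangular basis -/

namespace TriangularBasis

variable {A : LUGAlg k I} {Λ : Type v} [PartialOrder Λ] (T : TriangularBasis A Λ) {l : Λ}

/-- An idempotent of weight `l` as a special idempotent. -/
abbrev sp (s : T.indices {l}) : T.S := ⟨s.1, s.2.1⟩

theorem dot_sp (s : T.indices {l}) : T.dot (T.sp s) = l := s.2.2

/-- The idempotent of weight `l` given by a special idempotent. -/
abbrev ofSp (s : T.S) (h : T.dot s = l) : T.indices {l} := ⟨s.1, s.2, h⟩

/-- The basis elements in `X(i, s)` with `s` of weight `l`. -/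
abbrev XIdx (l : Λ) (i : I) : Type u := Σ s : T.indices {l}, T.X i (T.sp s)

/-- The positions of the summands of `⨁ x, x E` in degree `n`. -/
abbrev XPos (l : Λ) (i : I) (n : ℤ) : Type u := {p : T.XIdx l i × ℤ // p.1.2.1.1 + p.2 = n}

/-- The degree `n` part of `⨁ x, x E`. -/
abbrev XSum (E : T.indices {l} → ℤ → Type u) [∀ s n, AddCommGroup (E s n)]
    [∀ s n, Module k (E s n)] (i : I) (n : ℤ) : Type u :=
  ⨁ p : T.XPos l i n, E p.1.1.1 p.1.2

section XSum

variable (E : T.indices {l} → ℤ → Type u) [∀ s n, AddCommGroup (E s n)] [∀ s n, Module k (E s n)]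

open Classical in
/-- The inclusion of a summand. -/
def xMk {i : I} {e n : ℤ} (ξ : T.XIdx l i) (h : ξ.2.1.1 + e = n) :
    E ξ.1 e →ₗ[k] T.XSum E i n :=
  DirectSum.lof k (T.XPos l i n) (fun p => E p.1.1.1 p.1.2) ⟨(ξ, e), h⟩

variable {E} in
theorem xSum_induction {i : I} {n : ℤ} {P : T.XSum E i n → Prop} (z : T.XSum E i n) (hz : P 0)
    (ha : ∀ x y, P x → P y → P (x + y))
    (hp : ∀ (ξ : T.XIdx l i) (e : ℤ) (h : ξ.2.1.1 + e = n) (v : E ξ.1 e), P (T.xMk E ξ h v)) :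
    P z := by
  classical
  induction z using DirectSum.induction_on with
  | zero => exact hz
  | of p v => exact hp p.1.1 p.1.2 p.2 v
  | add x y hx hy => exact ha _ _ hx hy

open Classical in
/-- The linear map with prescribed components. -/
def xLift {i : I} {n : ℤ} {F : Type*} [AddCommGroup F] [Module k F]
    (f : ∀ (ξ : T.XIdx l i) (e : ℤ), ξ.2.1.1 + e = n → E ξ.1 e →ₗ[k] F) :
    T.XSum E i n →ₗ[k] F :=
  DirectSum.toModule k _ _ fun p => f p.1.1 p.1.2 p.2

theorem xLift_mk {i : I} {n : ℤ} {F : Type*} [AddCommGroup F] [Module k F]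
    (f : ∀ (ξ : T.XIdx l i) (e : ℤ), ξ.2.1.1 + e = n → E ξ.1 e →ₗ[k] F) (ξ : T.XIdx l i) (e : ℤ)
    (h : ξ.2.1.1 + e = n) (v : E ξ.1 e) : T.xLift E f (T.xMk E ξ h v) = f ξ e h v := by
  simp [xLift, xMk]

end XSum

/-- The basis of `1ᵢ A_d 1ⱼ` given by the triple products. -/
def tripleBasis (i j : I) (d : ℤ) : Module.Basis (T.Triple i j d) k (A.piece i j d) :=
  Module.Basis.mk (T.basis i j d).1 (T.basis i j d).2.ge

theorem tripleBasis_apply {i j : I} {d : ℤ} (q : T.Triple i j d) :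
    T.tripleBasis i j d q = q.product := Module.Basis.mk_apply _ _ _

/-- The rows of `A_{≥ l}`. -/
abbrev Row (l : Λ) (j : I) (s : T.indices {l}) (e : ℤ) : Type u := (T.algGE A l).piece s j e

open Classical in
/-- The coordinates `x h y ↦ x ⊗ h y` of an element of `A`. -/
def coord (l : Λ) (i j : I) (d : ℤ) : A.piece i j d →ₗ[k] T.XSum (T.Row l j) i d :=
  (T.tripleBasis i j d).constr k fun q =>
    if h : T.dot q.s = l then
      T.xMk (T.Row l j) (e := q.h.1.1 + q.y.1.1) ⟨T.ofSp q.s h, q.x⟩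
        ((add_assoc _ _ _).symm.trans q.deg_eq)
        (T.toGE l q.s j (q.h.1.1 + q.y.1.1) (A.mul rfl q.h.1.2 q.y.1.2))
    else 0

theorem coord_product_of_ne {i j : I} {d : ℤ} (q : T.Triple i j d) (h : T.dot q.s ≠ l) :
    T.coord l i j d q.product = 0 := by
  rw [coord, ← tripleBasis_apply, Module.Basis.constr_basis, dif_neg h]

theorem coord_eq_zero {Γ : Set Λ} (hΓ : IsLowerSet Γ) (hl : l ∉ Γ) {i j : I} {d : ℤ}
    {a : A.piece i j d} (ha : a ∈ (A.idealOf (T.indices Γ)).piece i j d) :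
    T.coord l i j d a = 0 := by
  rw [T.idealOf_indices hΓ] at ha
  suffices h : T.triSpan Γ i j d ≤ LinearMap.ker (T.coord l i j d) from h ha
  refine Submodule.span_le.2 ?_
  rintro _ ⟨q, hq, rfl⟩
  exact T.coord_product_of_ne q fun h => hl (h ▸ hq)

theorem product_mem_Iio {i j : I} {d : ℤ} (q : T.Triple i j d) (h : T.dot q.s < l) :
    q.product ∈ (A.idealOf (T.indices (Set.Iio l))).piece i j d := by
  rw [T.idealOf_indices (isLowerSet_Iio l)]
  exact Submodule.subset_span ⟨q, h, rfl⟩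

theorem toGE_eq_zero_of_Iio {i j : I} {d : ℤ} {a : A.piece i j d}
    (ha : a ∈ (A.idealOf (T.indices (Set.Iio l))).piece i j d) : T.toGE l i j d a = 0 :=
  T.toGE_eq_zero.2 (T.Iio_le_geIdeal l i j d ha)

/-- Coordinates split left multiplication by x. For a = x'h'y' starting at s, either s' = s, when x'
= 1ₛ and x h'y' is again a basis element, or the weight of s' is smaller than l and both sides
vanish. -/
theorem coord_mul_left {i j : I} {d e : ℤ} (ξ : T.XIdx l i) (h : ξ.2.1.1 + e = d)
    (a : A.piece ξ.1 j e) :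
    T.coord l i j d (A.mul h ξ.2.1.2 a) = T.xMk (T.Row l j) ξ h (T.toGE l ξ.1 j e a) := by
  induction T.mem_span_product a using Submodule.span_induction with
  | zero => simp
  | add a b _ _ ha hb => simp only [map_add, ha, hb]
  | smul t a _ ha => simp only [map_smul, ha]
  | mem a ha =>
    obtain ⟨q, rfl⟩ := ha
    obtain ⟨s, x⟩ := ξ
    by_cases hs : T.sp s = q.s
    · obtain ⟨s', t', x', h', y', deg⟩ := q
      change T.sp s = s' at hs
      subst hs
      obtain ⟨x', hx'⟩ := x'
      have hx'' : x' ∈ T.X (T.sp s) (T.sp s) := hx'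
      rw [T.X_self] at hx''
      obtain rfl : x' = ⟨0, A.one s⟩ := hx''
      have deg' : 0 + h'.1.1 + y'.1.1 = e := deg
      have deg₀ : h'.1.1 + y'.1.1 = e := by omega
      subst deg₀
      have deg₂ : x.1.1 + h'.1.1 + y'.1.1 = d := (add_assoc _ _ _).trans h
      let q' : T.Triple i j d := ⟨T.sp s, t', x, h', y', deg₂⟩
      have e1 : (BasisTriple.mk (T.sp s) t' (⟨⟨0, A.one s⟩, hx'⟩ : T.X (T.sp s) (T.sp s)) h' y' deg :
          T.Triple s j (h'.1.1 + y'.1.1)).product = A.mul rfl h'.1.2 y'.1.2 := by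
        change A.mul deg (A.mul rfl (A.one s) h'.1.2) y'.1.2 = _
        rw [A.mul_assoc rfl deg (rfl : h'.1.1 + y'.1.1 = _) (zero_add _), A.one_mul]
      have e2 : A.mul h x.1.2 (A.mul rfl h'.1.2 y'.1.2) = q'.product :=
        (A.mul_assoc rfl deg₂ rfl h _ _ _).symm
      refine (congrArg (fun z => T.coord l i j d (A.mul h x.1.2 z)) e1).trans ?_
      refine (congrArg _ e2).trans ?_
      rw [coord, ← tripleBasis_apply, Module.Basis.constr_basis, dif_pos (T.dot_sp s)]
      exact congrArg (fun z => T.xMk (T.Row l j) (⟨s, x⟩ : T.XIdx l i) h (T.toGE l s j _ z)) e1.symm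
    · have hlt : T.dot q.s < l := (T.X_lt (T.sp s) q.s hs ⟨q.x.1, q.x.2⟩).trans_eq (T.dot_sp s)
      have h1 := T.product_mem_Iio q hlt
      rw [T.toGE_eq_zero_of_Iio h1, map_zero]
      exact T.coord_eq_zero (isLowerSet_Iio l) (by simp)
        ((A.idealOf _).mul_mem_left h x.1.2 _ h1)

/-- Right multiplication on coordinates. -/
def coordMul (l : Λ) (i : I) {j r : I} {d e f : ℤ} (h : d + e = f) (c : A.piece j r e) :
    T.XSum (T.Row l j) i d →ₗ[k] T.XSum (T.Row l r) i f :=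
  T.xLift (T.Row l j) fun ξ p hp =>
    (T.xMk (T.Row l r) ξ (show ξ.2.1.1 + (p + e) = f by omega)).comp
      (((T.algGE A l).mul (rfl : p + e = p + e)).flip (T.toGE l j r e c))

/-- Right multiplication keeps the factor x of a triple of weight l, and triples of smaller weight
stay in the ideal that `coord` kills. The restriction to weights ≤ l is needed, since a triple of
another weight may acquire components of weight l. -/
theorem coord_mul_right {i j r : I} {d e f : ℤ} (h : d + e = f) {b : A.piece i j d}
    (hb : b ∈ (A.idealOf (T.indices (Set.Iic l))).piece i j d) (c : A.piece j r e) :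
    T.coord l i r f (A.mul h b c) = T.coordMul l i h c (T.coord l i j d b) := by
  rw [T.idealOf_indices (isLowerSet_Iic l)] at hb
  induction hb using Submodule.span_induction with
  | zero => simp
  | add a b _ _ ha hb => simp only [map_add, LinearMap.add_apply, ha, hb]
  | smul t a _ ha => simp only [map_smul, LinearMap.smul_apply, ha]
  | mem a ha =>
    obtain ⟨q, hq, rfl⟩ := ha
    rcases eq_or_lt_of_le (show T.dot q.s ≤ l from hq) with hq | hq
    · have hd : q.x.1.1 + (q.h.1.1 + q.y.1.1) = d := (add_assoc _ _ _).symm.trans q.deg_eq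
      have h1 : q.product = A.mul hd q.x.1.2 (A.mul rfl q.h.1.2 q.y.1.2) :=
        A.mul_assoc rfl _ rfl _ _ _ _
      rw [h1, A.mul_assoc hd h rfl (show q.x.1.1 + (q.h.1.1 + q.y.1.1 + e) = f by omega)]
      refine (T.coord_mul_left (⟨T.ofSp q.s hq, q.x⟩ : T.XIdx l i) _ _).trans ?_
      refine Eq.trans ?_ (congrArg (T.coordMul l i h c)
        (T.coord_mul_left (⟨T.ofSp q.s hq, q.x⟩ : T.XIdx l i) hd _)).symm
      rw [coordMul, xLift_mk]
      rfl
    · have h1 := T.product_mem_Iio q hq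
      rw [T.coord_eq_zero (isLowerSet_Iio l) (by simp) h1, map_zero]
      exact T.coord_eq_zero (isLowerSet_Iio l) (by simp) ((A.idealOf _).mul_mem_right h _ c h1)

/-! ### Standard modules are free over their weight spaces -/

section standardize

variable (M : GMod (T.algAt A l))

/-- The map `⨁ x, x M → j^l_! M`. -/
def stdX (i : I) (n : ℤ) : T.XSum M.piece i n →ₗ[k] (T.standardize M).piece i n :=
  T.xLift M.piece fun ξ _ h => T.stdMk M ξ.1 h ξ.2.1.2

theorem stdX_mk {i : I} {e n : ℤ} (ξ : T.XIdx l i) (h : ξ.2.1.1 + e = n) (v : M.piece ξ.1 e) :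
    T.stdX M i n (T.xMk M.piece ξ h v) = T.stdMk M ξ.1 h ξ.2.1.2 v :=
  T.xLift_mk _ _ ξ e h v

theorem stdX_surjective (i : I) (n : ℤ) : Function.Surjective (T.stdX M i n) := by
  intro x
  induction x using Weights.std_induction with
  | hz => exact ⟨0, map_zero _⟩
  | ha x y hx hy =>
    obtain ⟨x, rfl⟩ := hx
    obtain ⟨y, rfl⟩ := hy
    exact ⟨x + y, map_add _ _ _⟩
  | hp t p q h a v =>
    change T.stdMk M t h a v ∈ LinearMap.range (T.stdX M i n)
    induction T.mem_span_product a using Submodule.span_induction with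
    | zero => simp
    | add a b _ _ ha hb => simpa using add_mem ha hb
    | smul c a _ ha => simpa using Submodule.smul_mem _ c ha
    | mem a ha =>
      obtain ⟨r, rfl⟩ := ha
      have hle : T.dot r.s ≤ l :=
        (dot_eq r).trans_le ((T.Y_dot_le t.2.1 r.y).trans_eq (T.dot_sp t))
      rcases eq_or_lt_of_le hle with hr | hr
      · have hd : r.x.1.1 + (r.h.1.1 + r.y.1.1) = p := (add_assoc _ _ _).symm.trans r.deg_eq
        have h1 : r.product = A.mul hd r.x.1.2 (A.mul rfl r.h.1.2 r.y.1.2) :=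
          A.mul_assoc rfl _ rfl _ _ _ _
        refine ⟨T.xMk M.piece ⟨T.ofSp r.s hr, r.x⟩ (show r.x.1.1 + (r.h.1.1 + r.y.1.1 + q) = n
          by omega) (M.act rfl (T.bar (T.ofSp r.s hr) t _ (A.mul rfl r.h.1.2 r.y.1.2)) v), ?_⟩
        rw [stdX_mk]
        change _ = T.stdMk M t h r.product v
        rw [h1]
        exact (T.stdMk_mul M (s := T.ofSp r.s hr) hd rfl h _ r.x.1.2 _ v).symm
      · rw [T.stdMk_eq_zero M h (T.Iio_le_geIdeal _ _ _ _ (T.product_mem_Iio r hr))]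
        exact zero_mem _

/-- The map from coordinates to `⨁ x, x M` given by acting on an element of `M`. -/
def coordAct (i : I) {t : T.indices {l}} {p q n : ℤ} (h : p + q = n) :
    T.XSum (T.Row l t) i p →ₗ[k] M.piece t q →ₗ[k] T.XSum M.piece i n :=
  T.xLift (T.Row l t) fun ξ e he =>
    (M.act (i := ξ.1) (j := t) (rfl : e + q = e + q)).compr₂
      (T.xMk M.piece ξ (show ξ.2.1.1 + (e + q) = n by omega))

theorem coordAct_mk {i : I} {t : T.indices {l}} {p q n e : ℤ} (h : p + q = n) (ξ : T.XIdx l i)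
    (he : ξ.2.1.1 + e = p) (z : (T.algAt A l).piece ξ.1 t e) (v : M.piece t q) :
    T.coordAct M i h (T.xMk (T.Row l t) ξ he z) v =
      T.xMk M.piece ξ (show ξ.2.1.1 + (e + q) = n by omega) (M.act rfl z v) := by
  rw [coordAct, xLift_mk]
  rfl

theorem coordAct_mul {i : I} {s t : T.indices {l}} {m e m' n n' d : ℤ} (h₁ : m + e = m')
    (h₂ : e + n = n') (h₃ : m' + n = d) (h₄ : m + n' = d) (z : T.XSum (T.Row l s) i m)
    (b : A.piece s t e) (v : M.piece t n) :
    T.coordAct M i h₃ (T.coordMul l i h₁ b z) v =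
      T.coordAct M i h₄ z (M.act h₂ (T.bar s t e b) v) := by
  induction z using xSum_induction with
  | hz => simp
  | ha x y hx hy => simp only [map_add, LinearMap.add_apply, hx, hy]
  | hp ξ p hp z =>
    have e1 : T.coordMul l i h₁ b (T.xMk (T.Row l s) ξ hp z) =
        T.xMk (T.Row l t) ξ (show ξ.2.1.1 + (p + e) = m' by omega)
          ((T.algAt A l).mul (rfl : p + e = _) z (T.bar s t e b)) :=
      T.xLift_mk _ _ _ _ _ _
    rw [e1, coordAct_mk, coordAct_mk, M.mul_act rfl rfl h₂ (show p + n' = p + e + n by omega)]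
    have key : ∀ {x y : ℤ} (hx : ξ.2.1.1 + x = d) (hy : ξ.2.1.1 + y = d) (h₅ : p + n' = x)
        (h₆ : p + n' = y) (v' : M.piece s n'),
        T.xMk M.piece ξ hx (M.act h₅ z v') = T.xMk M.piece ξ hy (M.act h₆ z v') := by
      rintro x y hx hy rfl rfl v'
      rfl
    exact key _ _ _ _ _

/-- The inverse of `stdX`. -/
def stdCoord (i : I) (n : ℤ) : (T.standardize M).piece i n →ₗ[k] T.XSum M.piece i n :=
  T.stdLift (fun t p _ h => (T.coordAct M i h).comp (T.coord l i t p))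
    (fun t p q h a ha => by
      rw [LinearMap.comp_apply, T.coord_eq_zero (isLowerSet_not_ge l) (by simp) ha, map_zero])
    (fun s t m e n m' n' h₁ h₂ h₃ h₄ a b v => by
      rw [LinearMap.comp_apply, LinearMap.comp_apply, T.coord_mul_right h₁
        (A.mem_idealOf_right (T.indices_mono (by simp) s.2) a) b,
        T.coordAct_mul M h₁ h₂ h₃ h₄])

theorem stdCoord_stdX (i : I) (n : ℤ) (z : T.XSum M.piece i n) :
    T.stdCoord M i n (T.stdX M i n z) = z := by
  induction z using xSum_induction with
  | hz => simp
  | ha x y hx hy => simp only [map_add, hx, hy]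
  | hp ξ e h v =>
    rw [stdX_mk]
    refine (T.stdLift_mk _ _ _ ξ.1 _ e h _ v).trans ?_
    rw [LinearMap.comp_apply, ← A.mul_one (add_zero _) ξ.2.1.2,
      T.coord_mul_left ξ (add_zero _) (A.one ξ.1)]
    refine (T.coordAct_mk M h ξ (add_zero _) _ v).trans ?_
    have key : ∀ {x : ℤ} (hx : ξ.2.1.1 + x = n) (h₅ : 0 + e = x),
        T.xMk M.piece ξ hx (M.act h₅ ((T.algAt A l).one ξ.1) v) = T.xMk M.piece ξ h v := by
      intro x hx h₅
      obtain rfl : e = x := by omega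
      rw [M.one_act]
    exact key _ _

/-- A_{≥l} e_l is a free right A_l-module on the elements x ending at weight l. Spanning comes from
the expansion in triples, independence from the coordinate map. Exactness of standardization is a
consequence. -/
theorem stdX_bijective (i : I) (n : ℤ) : Function.Bijective (T.stdX M i n) :=
  ⟨Function.LeftInverse.injective (T.stdCoord_stdX M i n), T.stdX_surjective M i n⟩

end standardize

/-- The map `⨁ x, x e_l Q → Q`. -/
def xMap (l : Λ) (Q : GMod A) (i : I) (n : ℤ) :
    T.XSum (fun s : T.indices {l} => Q.piece s) i n →ₗ[k] Q.piece i n :=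
  T.xLift _ fun ξ _ h => Q.act h ξ.2.1.2

theorem xMap_mk {Q : GMod A} {i : I} {e n : ℤ} (ξ : T.XIdx l i) (h : ξ.2.1.1 + e = n)
    (v : Q.piece ξ.1 e) :
    T.xMap l Q i n (T.xMk (fun s : T.indices {l} => Q.piece s) ξ h v) = Q.act h ξ.2.1.2 v :=
  T.xLift_mk (fun s : T.indices {l} => Q.piece s) (fun ξ _ h => Q.act h ξ.2.1.2) ξ e h v

theorem counit_stdX {Q : GMod A} (hQ : T.Below l Q) (i : I) (n : ℤ)
    (z : T.XSum (T.weightSpace Q hQ).piece i n) :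
    (T.counit hQ).app i n (T.stdX _ i n z) = T.xMap l Q i n z := by
  induction z using xSum_induction with
  | hz => exact (congrArg _ (map_zero _)).trans ((map_zero _).trans (map_zero (T.xMap l Q i n)).symm)
  | ha x y hx hy =>
    rw [map_add, map_add, hx, hy]
    exact (map_add (T.xMap l Q i n) x y).symm
  | hp ξ e h v =>
    refine (congrArg _ (T.stdX_mk _ ξ h v)).trans ?_
    exact (T.counit_mk hQ ξ.1 h ξ.2.1.2 v).trans (T.xMap_mk ξ h v).symm

/-- Trades the tensor product in the source of the counit for ⨁ x e_l Q, so that injectivity can be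
transferred along maps that are injective on weight spaces. -/
theorem counit_injective_iff {Q : GMod A} (hQ : T.Below l Q) (i : I) (n : ℤ) :
    Function.Injective ((T.counit hQ).app i n) ↔ Function.Injective (T.xMap l Q i n) := by
  have h : (T.counit hQ).app i n ∘ T.stdX (T.weightSpace Q hQ) i n = T.xMap l Q i n :=
    funext (T.counit_stdX hQ i n)
  exact (Function.Injective.of_comp_iff' _ (T.stdX_bijective (T.weightSpace Q hQ) i n)).symm.trans
    (Iff.of_eq (congrArg _ h))

end TriangularBasis

/-! ### Layers of free modules -/

namespace TriangularBasis

variable {A : LUGAlg k I} {Λ : Type v} [PartialOrder Λ] (T : TriangularBasis A Λ) {l : Λ}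

theorem quot_subsingleton (V : GMod A) {Γ : Set Λ} {r : I} (hr : r ∈ T.indices Γ) (n : ℤ) :
    Subsingleton ((T.lowerPart V Γ).quot.piece r n) := by
  refine subsingleton_of_forall_eq 0 fun x => ?_
  obtain ⟨v, rfl⟩ := Submodule.mkQ_surjective _ x
  exact (Submodule.Quotient.mk_eq_zero _).2 (V.mem_generatedBy hr v)

theorem below_quot (V : GMod A) {Γ : Set Λ} (h : Set.Iio l ⊆ Γ) :
    T.Below l (T.lowerPart V Γ).quot :=
  fun _ hr n => T.quot_subsingleton V (T.indices_mono h hr) n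

section free

variable {ι : Type u} {σ : ι → I} {δ : ι → ℤ} {Γ : Set Λ} (hΓ : IsLowerSet Γ) (hl : l ∉ Γ)
  (hlt : Set.Iio l ⊆ Γ)

variable (A σ δ Γ) in
/-- The quotient of a free module by its part of weights in `Γ`. -/
abbrev freeQuot : GMod A := (T.lowerPart (GMod.free A σ δ) Γ).quot

include hlt in
theorem freeMk_mem_lowerPart {i : I} {p n : ℤ} (g : ι) (h : p + δ g = n) {a : A.piece i (σ g) p}
    (ha : a ∈ (A.idealOf (T.indices (Set.Iio l))).piece i (σ g) p) :
    GMod.freeMk g h a ∈ (T.lowerPart (GMod.free A σ δ) Γ).piece i n := by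
  rw [← GMod.act_freeGen]
  exact T.lowerPart_mono _ hlt i n (GMod.act_mem_generatedBy_of_mem _ h ha _)

/-- The map `a ↦ a v_g` from `e_l A_{≥ l}`. -/
def rowToQuot (g : ι) (s : T.indices {l}) (p : ℤ) :
    (T.algGE A l).piece s (σ g) p →ₗ[k] (T.freeQuot A σ δ Γ).piece s (p + δ g) :=
  Submodule.liftQ ((T.geIdeal A l).piece s (σ g) p)
    (((T.lowerPart (GMod.free A σ δ) Γ).proj.app s (p + δ g)).comp (GMod.freeMk g rfl))
    fun _ ha => (Submodule.Quotient.mk_eq_zero _).2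
      (T.freeMk_mem_lowerPart hlt g rfl (T.geIdeal_le_left s.2 _ p ha))

/-- The coordinates of an element of a free module. -/
def freeCoord (i : I) (n : ℤ) : (GMod.free A σ δ).piece i n →ₗ[k]
    T.XSum (fun s : T.indices {l} => (T.freeQuot A σ δ Γ).piece s) i n :=
  GMod.freeMkLift fun g p h => (T.xLift (T.Row l (σ g)) fun ξ e he =>
    (T.xMk (fun s : T.indices {l} => (T.freeQuot A σ δ Γ).piece s) ξ
      (show ξ.2.1.1 + (e + δ g) = n by omega)).comp (T.rowToQuot hlt g ξ.1 e)).comp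
    (T.coord l i (σ g) p)

theorem freeCoord_act {i : I} {e n : ℤ} (ξ : T.XIdx l i) (h : ξ.2.1.1 + e = n)
    (p : (GMod.free A σ δ).piece ξ.1 e) :
    T.freeCoord hlt i n ((GMod.free A σ δ).act h ξ.2.1.2 p) =
      T.xMk (fun s : T.indices {l} => (T.freeQuot A σ δ Γ).piece s) ξ h
        ((T.lowerPart (GMod.free A σ δ) Γ).proj.app ξ.1 e p) := by
  induction p using GMod.freeMk_induction with
  | hz => simp only [map_zero]
  | ha x y hx hy => simp only [map_add, hx, hy]
  | hp g p hp c =>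
    have key : ∀ (e : ℤ) (hp : p + δ g = e) (h : ξ.2.1.1 + e = n),
        T.freeCoord hlt i n ((GMod.free A σ δ).act h ξ.2.1.2 (GMod.freeMk g hp c)) =
          T.xMk (fun s : T.indices {l} => (T.freeQuot A σ δ Γ).piece s) ξ h
            ((T.lowerPart (GMod.free A σ δ) Γ).proj.app ξ.1 e (GMod.freeMk g hp c)) := by
      rintro _ rfl h
      rw [GMod.act_freeMk h g rfl rfl (by omega), freeCoord, GMod.freeMkLift_mk,
        LinearMap.comp_apply, T.coord_mul_left ξ rfl c, xLift_mk]
      rfl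
    exact key e hp h

include hΓ hl in
theorem freeCoord_eq_zero {i : I} {n : ℤ} {p : (GMod.free A σ δ).piece i n}
    (hp : p ∈ (T.lowerPart (GMod.free A σ δ) Γ).piece i n) : T.freeCoord hlt i n p = 0 := by
  suffices h : (T.lowerPart (GMod.free A σ δ) Γ).piece i n ≤
      LinearMap.ker (T.freeCoord hlt i n) from h hp
  refine Submodule.span_le.2 ?_
  rintro _ ⟨r, hr, m, n', h, a, v, rfl⟩
  change T.freeCoord hlt i n _ = 0
  induction v using GMod.freeMk_induction with
  | hz => simp only [map_zero]
  | ha x y hx hy => simp only [map_add, hx, hy, add_zero]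
  | hp g p hp c =>
    rw [GMod.act_freeMk h g hp rfl (by omega), freeCoord, GMod.freeMkLift_mk,
      LinearMap.comp_apply, T.coord_eq_zero hΓ hl (A.mul_mem_idealOf hr rfl a c), map_zero]

-- For a free module the coordinates of a in a v_g give a left inverse. It is well defined on the
-- quotient because A e_Γ A is spanned by triples with weights in Γ, none of which equals l.
include hΓ hl hlt in
theorem xMap_freeQuot_injective (i : I) (n : ℤ) :
    Function.Injective (T.xMap l (T.freeQuot A σ δ Γ) i n) := by
  let r : (T.freeQuot A σ δ Γ).piece i n →ₗ[k] _ := Submodule.liftQ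
    ((T.lowerPart (GMod.free A σ δ) Γ).piece i n) (T.freeCoord hlt i n)
    fun p hp => T.freeCoord_eq_zero hΓ hl hlt hp
  refine Function.LeftInverse.injective (g := r) fun z => ?_
  induction z using xSum_induction with
  | hz => rw [map_zero, map_zero]
  | ha x y hx hy => rw [map_add, map_add, hx, hy]
  | hp ξ e h v =>
    obtain ⟨v, rfl⟩ := Submodule.mkQ_surjective _ v
    refine (congrArg r (T.xMap_mk ξ h _)).trans ?_
    exact T.freeCoord_act hlt ξ h v

/-! ### Weight spaces of layers of free modules are free -/

/-- The basis elements in `Y(t, j)` with `t` of weight `l`. -/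
abbrev YIdx (l : Λ) (j : I) : Type u := Σ t : T.indices {l}, T.Y (T.sp t) j

/-- The positions of the summands of `⨁ y, A_l y` in degree `d`. -/
abbrev YPos (l : Λ) (j : I) (d : ℤ) : Type u := {p : T.YIdx l j × ℤ // p.2 + p.1.2.1.1 = d}

/-- The degree `d` part of `⨁ y, A_l y`. -/
abbrev YSum (l : Λ) (s : T.indices {l}) (j : I) (d : ℤ) : Type u :=
  ⨁ p : T.YPos l j d, (T.algAt A l).piece s p.1.1.1 p.1.2

open Classical in
/-- The inclusion of a summand. -/
def yMk {s : T.indices {l}} {j : I} {e d : ℤ} (υ : T.YIdx l j) (h : e + υ.2.1.1 = d) :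
    (T.algAt A l).piece s υ.1 e →ₗ[k] T.YSum l s j d :=
  DirectSum.lof k (T.YPos l j d) (fun p => (T.algAt A l).piece s p.1.1.1 p.1.2) ⟨(υ, e), h⟩

open Classical in
/-- The linear map with prescribed components. -/
def yLift {s : T.indices {l}} {j : I} {d : ℤ} {F : Type*} [AddCommGroup F] [Module k F]
    (f : ∀ (υ : T.YIdx l j) (e : ℤ), e + υ.2.1.1 = d → (T.algAt A l).piece s υ.1 e →ₗ[k] F) :
    T.YSum l s j d →ₗ[k] F :=
  DirectSum.toModule k _ _ fun p => f p.1.1 p.1.2 p.2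

theorem yLift_mk {s : T.indices {l}} {j : I} {d : ℤ} {F : Type*} [AddCommGroup F] [Module k F]
    (f : ∀ (υ : T.YIdx l j) (e : ℤ), e + υ.2.1.1 = d → (T.algAt A l).piece s υ.1 e →ₗ[k] F)
    (υ : T.YIdx l j) (e : ℤ) (h : e + υ.2.1.1 = d) (v : (T.algAt A l).piece s υ.1 e) :
    T.yLift f (T.yMk υ h v) = f υ e h v := by
  simp [yLift, yMk]

open Classical in
/-- The coordinates `x h y ↦ x h ⊗ y` of an element of `e_l A`. -/
def coordY (s : T.indices {l}) (j : I) (d : ℤ) : A.piece s j d →ₗ[k] T.YSum l s j d :=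
  (T.tripleBasis s j d).constr k fun q =>
    if h : T.dot q.t = l then
      T.yMk (e := q.x.1.1 + q.h.1.1) ⟨T.ofSp q.t h, q.y⟩ q.deg_eq
        (T.bar s (T.ofSp q.t h) (q.x.1.1 + q.h.1.1) (A.mul rfl q.x.1.2 q.h.1.2))
    else 0

theorem coordY_eq_zero {s : T.indices {l}} {j : I} {d : ℤ} {a : A.piece s j d}
    (ha : a ∈ (A.idealOf (T.indices (Set.Iio l))).piece s j d) : T.coordY s j d a = 0 := by
  rw [T.idealOf_indices (isLowerSet_Iio l)] at ha
  suffices h : T.triSpan (Set.Iio l) s j d ≤ LinearMap.ker (T.coordY s j d) from h ha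
  refine Submodule.span_le.2 ?_
  rintro _ ⟨q, hq, rfl⟩
  change T.coordY s j d _ = 0
  rw [coordY, ← tripleBasis_apply, Module.Basis.constr_basis,
    dif_neg (by rw [← dot_eq q]; exact ne_of_lt hq)]

theorem coordY_mul {s : T.indices {l}} {j : I} {e d : ℤ} (υ : T.YIdx l j) (h : e + υ.2.1.1 = d)
    (a : A.piece s υ.1 e) :
    T.coordY s j d (A.mul h a υ.2.1.2) = T.yMk υ h (T.bar s υ.1 e a) := by
  induction T.mem_span_product a using Submodule.span_induction with
  | zero => simp only [map_zero, LinearMap.zero_apply]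
  | add a b _ _ ha hb => simp only [map_add, LinearMap.add_apply, ha, hb]
  | smul t a _ ha => simp only [map_smul, LinearMap.smul_apply, ha]
  | mem a ha =>
    obtain ⟨q, rfl⟩ := ha
    obtain ⟨t, y⟩ := υ
    by_cases ht : q.t = T.sp t
    · obtain ⟨s', t', x', h', y', deg⟩ := q
      change t' = T.sp t at ht
      subst ht
      obtain ⟨y', hy'⟩ := y'
      have hy'' : y' ∈ T.Y (T.sp t) (T.sp t) := hy'
      rw [T.Y_self] at hy''
      obtain rfl : y' = ⟨0, A.one t⟩ := hy''
      have deg' : x'.1.1 + h'.1.1 + 0 = e := deg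
      have deg₀ : x'.1.1 + h'.1.1 = e := by omega
      subst deg₀
      let q' : T.Triple s j d := ⟨s', T.sp t, x', h', y, h⟩
      have e1 : (BasisTriple.mk s' (T.sp t) x' h' (⟨⟨0, A.one t⟩, hy'⟩ : T.Y (T.sp t) (T.sp t)) deg :
          T.Triple s t (x'.1.1 + h'.1.1)).product = A.mul rfl x'.1.2 h'.1.2 := by
        change A.mul deg (A.mul rfl x'.1.2 h'.1.2) (A.one t) = _
        rw [A.mul_one]
      refine (congrArg (fun z => T.coordY s j d (A.mul h z y.1.2)) e1).trans ?_
      refine (congrArg _ (show A.mul h (A.mul rfl x'.1.2 h'.1.2) y.1.2 = q'.product from rfl)).trans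
        ?_
      rw [coordY, ← tripleBasis_apply, Module.Basis.constr_basis, dif_pos (T.dot_sp t)]
      exact congrArg (fun z => T.yMk (⟨t, y⟩ : T.YIdx l j) h (T.bar s t _ z)) e1.symm
    · have hlt : T.dot q.s < l :=
        (dot_eq q).trans_lt ((T.Y_lt q.t (T.sp t) ht ⟨q.y.1, q.y.2⟩).trans_eq (T.dot_sp t))
      have h1 := T.product_mem_Iio q hlt
      have h2 : T.bar s t e q.product = 0 := T.toGE_eq_zero_of_Iio h1
      refine (T.coordY_eq_zero ((A.idealOf _).mul_mem_right h _ y.1.2 h1)).trans ?_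
      exact ((congrArg _ h2).trans (map_zero _)).symm

variable (σ) in
/-- The generators of the weight space of a layer of a free module. -/
abbrev LayerIdx (l : Λ) : Type u := Σ g : ι, T.YIdx l (σ g)

variable (l σ δ) in
/-- The free `A_l`-module with the generators `y v_g`. -/
abbrev layerFree : GMod (T.algAt A l) :=
  GMod.free (T.algAt A l) (fun x : T.LayerIdx σ l => x.2.1) (fun x => x.2.2.1.1 + δ x.1)

/-- The homomorphism from the free module on the elements `y v_g`. -/
def layerMap : T.layerFree l σ δ ⟶ T.weightSpace (T.freeQuot A σ δ Γ) (T.below_quot _ hlt) :=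
  GMod.freeDesc (σ := fun x : T.LayerIdx σ l => x.2.1) (δ := fun x => x.2.2.1.1 + δ x.1)
    fun x => (T.lowerPart (GMod.free A σ δ) Γ).proj.app x.2.1 _ (GMod.freeMk x.1 rfl x.2.2.1.2)

theorem layerMap_mk {s : T.indices {l}} {p p' n : ℤ} (g : ι) (υ : T.YIdx l (σ g))
    (h : p + (υ.2.1.1 + δ g) = n) (h₁ : p + υ.2.1.1 = p') (h' : p' + δ g = n)
    (a : A.piece s υ.1 p) :
    (T.layerMap hlt).app s n (GMod.freeMk (σ := fun x : T.LayerIdx σ l => x.2.1)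
        (δ := fun x => x.2.2.1.1 + δ x.1) ⟨g, υ⟩ h (T.bar s υ.1 p a)) =
      (T.lowerPart (GMod.free A σ δ) Γ).proj.app s n (GMod.freeMk g h' (A.mul h₁ a υ.2.1.2)) := by
  refine (GMod.freeDesc_mk (σ := fun x : T.LayerIdx σ l => x.2.1)
    (δ := fun x => x.2.2.1.1 + δ x.1) _ ⟨g, υ⟩ h _).trans ?_
  refine (T.weightSpace_act _ _ h a _).trans ?_
  rw [← GMod.Hom.app_act, GMod.act_freeMk h g rfl h₁ h']

/-- The coordinates of an element of a weight space of a free module. -/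
def layerCoord (s : T.indices {l}) (n : ℤ) :
    (GMod.free A σ δ).piece s n →ₗ[k] (T.layerFree l σ δ).piece s n :=
  GMod.freeMkLift fun g p h => (T.yLift fun υ e he =>
    GMod.freeMk (σ := fun x : T.LayerIdx σ l => x.2.1) (δ := fun x => x.2.2.1.1 + δ x.1) ⟨g, υ⟩
      (show e + (υ.2.1.1 + δ g) = n by omega)).comp (T.coordY s (σ g) p)

include hΓ hl in
theorem layerCoord_eq_zero {s : T.indices {l}} {n : ℤ} {p : (GMod.free A σ δ).piece s n}
    (hp : p ∈ (T.lowerPart (GMod.free A σ δ) Γ).piece s n) : T.layerCoord s n p = 0 := by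
  suffices h : (T.lowerPart (GMod.free A σ δ) (Γ ∩ Set.Iio l)).piece s n ≤
      LinearMap.ker (T.layerCoord s n) from h (T.lowerPart_le_Iio hΓ hl s.2 n hp)
  refine Submodule.span_le.2 ?_
  rintro _ ⟨r, hr, m, n', h, a, v, rfl⟩
  change T.layerCoord s n _ = 0
  induction v using GMod.freeMk_induction with
  | hz => simp only [map_zero]
  | ha x y hx hy => simp only [map_add, hx, hy, add_zero]
  | hp g p hp c =>
    rw [GMod.act_freeMk h g hp rfl (by omega), layerCoord, GMod.freeMkLift_mk,
      LinearMap.comp_apply, T.coordY_eq_zero (A.mul_mem_idealOf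
        (T.indices_mono Set.inter_subset_right hr) rfl a c), map_zero]

-- The elements y v_g form an A_l-basis of the weight space: triples starting at weight l have
-- weight ≤ l, those of smaller weight land in F_Γ, and the others are (xh)·y with y ending the
-- triple. The inverse reads off the coefficients xh by `coordY`.
include hΓ hl in
theorem layerMap_bijective (s : T.indices {l}) (n : ℤ) :
    Function.Bijective ((T.layerMap (σ := σ) (δ := δ) hlt).app s n) := by
  constructor
  · let r : (T.weightSpace (T.freeQuot A σ δ Γ) (T.below_quot _ hlt)).piece s n →ₗ[k]
        (T.layerFree l σ δ).piece s n := Submodule.liftQ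
      ((T.lowerPart (GMod.free A σ δ) Γ).piece s n) (T.layerCoord s n)
      fun p hp => T.layerCoord_eq_zero hΓ hl hp
    refine Function.LeftInverse.injective (g := r) fun z => ?_
    induction z using GMod.freeMk_induction with
    | hz => rw [map_zero, map_zero]
    | ha x y hx hy => rw [map_add, map_add, hx, hy]
    | hp x p h a =>
      obtain ⟨g, υ⟩ := x
      obtain ⟨a, rfl⟩ := T.bar_surjective _ _ _ a
      have h' : p + υ.2.1.1 + δ g = n := (add_assoc _ _ _).trans h
      refine (congrArg r (T.layerMap_mk hlt g υ h rfl h' a)).trans ?_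
      change T.layerCoord s n (GMod.freeMk g h' (A.mul rfl a υ.2.1.2)) = _
      rw [layerCoord, GMod.freeMkLift_mk, LinearMap.comp_apply, T.coordY_mul υ rfl a, yLift_mk]
  · intro z
    obtain ⟨z, rfl⟩ := Submodule.mkQ_surjective _ z
    change (T.lowerPart (GMod.free A σ δ) Γ).proj.app s n z ∈
      LinearMap.range ((T.layerMap (σ := σ) (δ := δ) hlt).app s n)
    induction z using GMod.freeMk_induction with
    | hz => rw [map_zero]; exact zero_mem _
    | ha x y hx hy => rw [map_add]; exact add_mem hx hy
    | hp g p h c =>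
      induction T.mem_span_product c using Submodule.span_induction with
      | zero => rw [map_zero, map_zero]; exact zero_mem _
      | add x y _ _ hx hy => rw [map_add, map_add]; exact add_mem hx hy
      | smul t x _ hx => rw [map_smul, map_smul]; exact Submodule.smul_mem _ t hx
      | mem c hc =>
        obtain ⟨q, rfl⟩ := hc
        have hle : T.dot q.s ≤ l := (T.X_dot_le s.2.1 q.x).trans_eq (T.dot_sp s)
        rcases eq_or_lt_of_le hle with hq | hq
        · have hq' : T.dot q.t = l := (dot_eq q).symm.trans hq
          have hd : q.x.1.1 + q.h.1.1 + q.y.1.1 = p := q.deg_eq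
          exact ⟨_, T.layerMap_mk hlt g (⟨T.ofSp q.t hq', q.y⟩ : T.YIdx l (σ g))
            (p := q.x.1.1 + q.h.1.1) (by rw [← add_assoc, hd, h]) hd h
            (A.mul rfl q.x.1.2 q.h.1.2)⟩
        · have h1 := T.freeMk_mem_lowerPart (δ := δ) hlt g h (T.product_mem_Iio q hq)
          have h2 : (T.lowerPart (GMod.free A σ δ) Γ).proj.app s n (GMod.freeMk g h q.product) = 0 :=
            (Submodule.Quotient.mk_eq_zero _).2 h1
          exact h2 ▸ zero_mem _

include hΓ hl in
theorem projective_weightSpace_freeQuot :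
    Projective (T.weightSpace (T.freeQuot A σ δ Γ) (T.below_quot _ hlt)) :=
  have : Projective (T.layerFree l σ δ) := inferInstanceAs (Projective (GMod.free _ _ _))
  Projective.of_iso (GMod.isoOfBijective _ (T.layerMap_bijective (σ := σ) (δ := δ) hΓ hl hlt)) this

end free

end TriangularBasis

/-! ### Exactness of standardization -/

namespace TriangularBasis

variable {A : LUGAlg k I} {Λ : Type v} [PartialOrder Λ] (T : TriangularBasis A Λ) {l : Λ}

/-- The map on coordinates induced by a family of linear maps. -/
def xSumMap {E E' : T.indices {l} → ℤ → Type u} [∀ s n, AddCommGroup (E s n)]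
    [∀ s n, Module k (E s n)] [∀ s n, AddCommGroup (E' s n)] [∀ s n, Module k (E' s n)]
    (f : ∀ s n, E s n →ₗ[k] E' s n) (i : I) (n : ℤ) : T.XSum E i n →ₗ[k] T.XSum E' i n :=
  DirectSum.lmap fun p => f p.1.1.1 p.1.2

theorem xSumMap_injective {E E' : T.indices {l} → ℤ → Type u} [∀ s n, AddCommGroup (E s n)]
    [∀ s n, Module k (E s n)] [∀ s n, AddCommGroup (E' s n)] [∀ s n, Module k (E' s n)]
    {f : ∀ s n, E s n →ₗ[k] E' s n} (hf : ∀ s n, Function.Injective (f s n)) (i : I) (n : ℤ) :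
    Function.Injective (T.xSumMap f i n) :=
  (DirectSum.lmap_injective _).2 fun _ => hf _ _

theorem xSumMap_mk {E E' : T.indices {l} → ℤ → Type u} [∀ s n, AddCommGroup (E s n)]
    [∀ s n, Module k (E s n)] [∀ s n, AddCommGroup (E' s n)] [∀ s n, Module k (E' s n)]
    (f : ∀ s n, E s n →ₗ[k] E' s n) {i : I} {e n : ℤ} (ξ : T.XIdx l i) (h : ξ.2.1.1 + e = n)
    (v : E ξ.1 e) : T.xSumMap f i n (T.xMk E ξ h v) = T.xMk E' ξ h (f ξ.1 e v) := by
  classical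
  simp [xSumMap, xMk]

theorem xMap_naturality {Q Q' : GMod A} (f : Q ⟶ Q') (i : I) (n : ℤ)
    (z : T.XSum (fun s : T.indices {l} => Q.piece s) i n) :
    f.app i n (T.xMap l Q i n z) =
      T.xMap l Q' i n (T.xSumMap (fun (s : T.indices {l}) n => f.app s n) i n z) := by
  induction z using xSum_induction with
  | hz => simp only [map_zero]
  | ha x y hx hy => simp only [map_add, hx, hy]
  | hp ξ e h v => rw [xMap_mk, xSumMap_mk, xMap_mk, f.app_act]

theorem xMap_injective_of_injective {Q Q' : GMod A} (f : Q ⟶ Q')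
    (hf : ∀ (s : T.indices {l}) n, Function.Injective (f.app s n)) {i : I} {n : ℤ}
    (h : Function.Injective (T.xMap l Q' i n)) : Function.Injective (T.xMap l Q i n) := by
  refine Function.Injective.of_comp (f := f.app i n) ?_
  have e : f.app i n ∘ T.xMap l Q i n =
      T.xMap l Q' i n ∘ T.xSumMap (fun (s : T.indices {l}) n => f.app s n) i n :=
    funext fun z => T.xMap_naturality f i n z
  rw [e]
  exact h.comp (T.xSumMap_injective (fun s n => hf s n) i n)

section map

variable {M M' M'' : GMod (T.algAt A l)}

theorem standardizeMap_stdX (f : M ⟶ M') (i : I) (n : ℤ) (z : T.XSum M.piece i n) :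
    (T.standardizeMap f).app i n (T.stdX M i n z) = T.stdX M' i n (T.xSumMap f.app i n z) := by
  induction z using xSum_induction with
  | hz => simp only [map_zero]
  | ha x y hx hy => simp only [map_add, hx, hy]
  | hp ξ e h v => rw [stdX_mk, xSumMap_mk, stdX_mk, standardizeMap_mk]

theorem standardizeMap_injective {f : M ⟶ M'} (hf : ∀ s n, Function.Injective (f.app s n))
    (i : I) (n : ℤ) : Function.Injective ((T.standardizeMap f).app i n) := by
  rw [← Function.Injective.of_comp_iff' _ (T.stdX_bijective M i n)]
  have e : (T.standardizeMap f).app i n ∘ T.stdX M i n =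
      T.stdX M' i n ∘ T.xSumMap f.app i n := funext (T.standardizeMap_stdX f i n)
  rw [e]
  exact (T.stdX_bijective M' i n).1.comp (T.xSumMap_injective hf i n)

/-- Only injectivity uses the triangular basis, through the freeness of A_{≥l} e_l. The rest is
right exactness of a left adjoint. -/
theorem _root_.GMod.SES.standardize {f : M ⟶ M'} {g : M' ⟶ M''} (h : GMod.SES f g) :
    GMod.SES (T.standardizeMap f) (T.standardizeMap g) where
  inj := T.standardizeMap_injective h.inj
  surj := T.standardizeMap_surjective g h.surj
  zero i n x := by
    rw [← GMod.comp_app, ← standardizeMap_comp, h.comp_eq_zero]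
    have : T.standardizeMap (0 : M ⟶ M'') = 0 := T.std_hom_ext fun s n v => by
      rw [standardizeMap_unit, GMod.zero_app, GMod.zero_app, map_zero]
    rw [this, GMod.zero_app]
  exact := by
    -- Middle exactness by adjunction: the cokernel of j_!f is again zero below l, so M' →
    -- e_l(coker) factors through M'', and the projection onto the cokernel factors through j_!g.
    let R := GMod.range (T.standardizeMap f)
    have hR : T.Below l R.quot := fun r hr n => by
      have := T.below_standardize M' r hr n
      exact (Submodule.mkQ_surjective (R.piece r n)).subsingleton
    obtain ⟨ψ, hψ⟩ := h.exists_desc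
      (T.unitHom M' ≫ T.weightSpaceMap (T.below_standardize M') hR R.proj) (by
        refine GMod.eq_zero_of_app fun s n v => ?_
        refine (Submodule.Quotient.mk_eq_zero (R.piece s n)).2 ?_
        exact ⟨T.stdUnit M s n v, T.standardizeMap_unit f s n v⟩)
    have e : T.standardizeMap g ≫ T.stdDesc hR ψ = R.proj := T.std_hom_ext fun s n v => by
      rw [GMod.comp_app, standardizeMap_unit, stdDesc_unit]
      exact congrArg (fun φ : M' ⟶ T.weightSpace R.quot hR => φ.app s n v) hψ
    intro i n y hy
    have h1 : R.proj.app i n y = 0 := by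
      rw [← e, GMod.comp_app, hy, map_zero]
    exact (Submodule.Quotient.mk_eq_zero (R.piece i n)).1 h1

end map

/-! ### The layers of the filtration by weights -/

/-- The subquotient `V_Γ / V_Γ'`. -/
abbrev layer (V : GMod A) (Γ' Γ : Set Λ) : GMod A := (T.lowerPart V Γ').subquot (T.lowerPart V Γ)

section layer

variable (V : GMod A) {Γ : Set Λ}

theorem Iio_subset_of_insert (h : IsLowerSet (insert l Γ)) : Set.Iio l ⊆ Γ :=
  fun _ hx => (h (le_of_lt hx) (Set.mem_insert l Γ)).resolve_left (ne_of_lt hx)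

theorem mem_indices_insert {r : I} (hr : r ∈ T.indices (insert l Γ)) :
    r ∈ T.indices {l} ∨ r ∈ T.indices Γ := by
  obtain ⟨h, h' | h'⟩ := hr
  · exact Or.inl ⟨h, h'⟩
  · exact Or.inr ⟨h, h'⟩

theorem ses_layer : GMod.SES (GMod.Sub.inclLE (T.lowerPart_mono V (Set.subset_insert l Γ)))
    ((T.lowerPart V Γ).within (T.lowerPart V (insert l Γ))).proj :=
  GMod.Sub.ses_subquot _

theorem below_layer (h : Set.Iio l ⊆ Γ) : T.Below l (T.layer V Γ (insert l Γ)) := by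
  intro r hr n
  refine subsingleton_of_forall_eq 0 fun x => ?_
  obtain ⟨v, rfl⟩ := Submodule.mkQ_surjective _ x
  exact (Submodule.Quotient.mk_eq_zero _).2 (V.mem_generatedBy (T.indices_mono h hr) v.1)

/-- The inclusion of `V_Γ / V_Γ'` into `V / V_Γ'`. -/
def layerToQuot : T.layer V Γ (insert l Γ) ⟶ (T.lowerPart V Γ).quot :=
  ((T.lowerPart V Γ).within (T.lowerPart V (insert l Γ))).desc
    ((T.lowerPart V (insert l Γ)).incl ≫ (T.lowerPart V Γ).proj) fun _ _ _ hv =>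
      (Submodule.Quotient.mk_eq_zero _).2 hv

theorem layerToQuot_injective (i : I) (n : ℤ) :
    Function.Injective ((T.layerToQuot V (l := l) (Γ := Γ)).app i n) := by
  rw [injective_iff_map_eq_zero]
  intro x hx
  obtain ⟨v, rfl⟩ := Submodule.mkQ_surjective _ x
  exact (Submodule.Quotient.mk_eq_zero _).2 ((Submodule.Quotient.mk_eq_zero
    ((T.lowerPart V Γ).piece i n)).1 hx)

theorem layerToQuot_surjective (s : T.indices {l}) (n : ℤ) :
    Function.Surjective ((T.layerToQuot V (l := l) (Γ := Γ)).app s n) := by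
  intro x
  obtain ⟨v, rfl⟩ := Submodule.mkQ_surjective _ x
  exact ⟨Submodule.mkQ _ ((T.lowerPart V (insert l Γ)).elem v
    (V.mem_generatedBy (T.indices_mono (by simp) s.2) v)), rfl⟩

/-- V_{Γ∪l} is generated by its vectors with weights in Γ and of weight l, and the former vanish in
the layer. -/
theorem counit_layer_surjective (h : Set.Iio l ⊆ Γ) (i : I) (n : ℤ) :
    Function.Surjective ((T.counit (T.below_layer V h)).app i n) := by
  intro x
  obtain ⟨⟨v, hv⟩, rfl⟩ := Submodule.mkQ_surjective _ x
  let π : (T.lowerPart V (insert l Γ)).toGMod ⟶ T.layer V Γ (insert l Γ) :=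
    ((T.lowerPart V Γ).within (T.lowerPart V (insert l Γ))).proj
  suffices key : (T.lowerPart V (insert l Γ)).piece i n ≤
      ((LinearMap.range ((T.counit (T.below_layer V h)).app i n)).comap (π.app i n)).map
        ((T.lowerPart V (insert l Γ)).piece i n).subtype by
    obtain ⟨⟨v', hv'⟩, h2, h3⟩ := key hv
    obtain rfl : v' = v := h3
    exact h2
  refine Submodule.span_le.2 ?_
  rintro _ ⟨r, hr, p, q, hpq, a, x, rfl⟩
  refine ⟨(T.lowerPart V (insert l Γ)).elem (V.act hpq a x) (V.act_mem_generatedBy hr _ _ _),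
    ?_, rfl⟩
  change π.app i n _ ∈ LinearMap.range _
  rw [← (T.lowerPart V (insert l Γ)).act_elem hpq a x (V.mem_generatedBy hr x), π.app_act]
  rcases T.mem_indices_insert hr with hr' | hr'
  · exact ⟨_, T.counit_mk (T.below_layer V h) ⟨r, hr'⟩ hpq a _⟩
  · have : π.app r q ((T.lowerPart V (insert l Γ)).elem x (V.mem_generatedBy hr x)) = 0 :=
      (Submodule.Quotient.mk_eq_zero _).2 (V.mem_generatedBy hr' x)
    rw [this, map_zero]
    exact zero_mem _

theorem counit_layer_bijective (h : Set.Iio l ⊆ Γ) {i : I} {n : ℤ}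
    (hx : Function.Injective (T.xMap l (T.lowerPart V Γ).quot i n)) :
    Function.Bijective ((T.counit (T.below_layer V h)).app i n) :=
  ⟨(T.counit_injective_iff _ i n).2 (T.xMap_injective_of_injective (T.layerToQuot V)
    (fun s n => T.layerToQuot_injective V s n) hx), T.counit_layer_surjective V h i n⟩

/-- The weight spaces of `V_Γ / V_Γ'` and `V / V_Γ'` agree. -/
def weightSpaceLayerIso (h : Set.Iio l ⊆ Γ) :
    T.weightSpace _ (T.below_layer V h) ≅ T.weightSpace _ (T.below_quot V h) :=
  GMod.isoOfBijective (T.weightSpaceMap _ _ (T.layerToQuot V)) fun s n =>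
    ⟨T.layerToQuot_injective V s n, T.layerToQuot_surjective V s n⟩

end layer

/-- A maximal element of a finite lower set can be removed without destroying the lower set
property. -/
theorem lowerSet_induction {P : Set Λ → Prop} (h₀ : P ∅)
    (h₁ : ∀ (Γ : Set Λ) (l : Λ), IsLowerSet Γ → Γ.Finite → l ∉ Γ → IsLowerSet (insert l Γ) →
      P Γ → P (insert l Γ)) {Γ : Set Λ} (hΓ : IsLowerSet Γ) (hf : Γ.Finite) : P Γ := by
  induction hn : Γ.ncard generalizing Γ with
  | zero => exact (Set.ncard_eq_zero hf).1 hn ▸ h₀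
  | succ n ih =>
    have hne : Γ.Nonempty := by
      rw [Set.nonempty_iff_ne_empty]
      rintro rfl
      simp at hn
    obtain ⟨l, hl⟩ := hf.exists_maximal hne
    have hlow : IsLowerSet (Γ \ {l}) := fun a b hba ha => by
      refine ⟨hΓ hba ha.1, ?_⟩
      rintro rfl
      exact ha.2 (le_antisymm (hl.2 ha.1 hba) hba)
    have hins : insert l (Γ \ {l}) = Γ := by simp [hl.1]
    rw [← hins]
    refine h₁ _ l hlow hf.sdiff (by simp) (hins.symm ▸ hΓ) (ih hlow hf.sdiff ?_)
    rw [Set.ncard_sdiff_singleton_of_mem hl.1, hn, Nat.add_sub_cancel]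

/-! ### Acyclic modules -/

/-- All higher extension groups with values in costandard modules vanish. -/
def Acyclic (W : GMod A) : Prop :=
  ∀ (l : Λ) (N : GMod (T.algAt A l)) (n : ℕ),
    Subsingleton (Abelian.Ext W (T.costandardize N) (n + 1))

theorem acyclic_of_projective (W : GMod A) [Projective W] : T.Acyclic W :=
  fun _ _ n => GMod.ext_of_projective n

theorem acyclic_of_subsingleton {W : GMod A} (h : ∀ i n, Subsingleton (W.piece i n)) :
    T.Acyclic W := by
  have : Projective W := ⟨fun f e _ => ⟨0, GMod.hom_ext fun i n x => by
    have := h i n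
    rw [Subsingleton.elim x 0, map_zero, map_zero]⟩⟩
  exact T.acyclic_of_projective W

theorem lowerPart_empty_subsingleton (V : GMod A) (i : I) (n : ℤ) :
    Subsingleton ((T.lowerPart V ∅).toGMod.piece i n) := by
  refine subsingleton_of_forall_eq 0 fun x => Subtype.ext ?_
  have h : (T.lowerPart V ∅).piece i n ≤ ⊥ := Submodule.span_le.2 (by
    rintro _ ⟨r, ⟨_, hr⟩, _⟩
    exact absurd hr (Set.notMem_empty _))
  exact (Submodule.mem_bot k).1 (h x.2)

section

variable {ι : Type u} (σ : ι → I) (δ : ι → ℤ) {Γ : Set Λ}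

theorem counit_layer_free_bijective (hΓ : IsLowerSet Γ) (hl : l ∉ Γ) (h : Set.Iio l ⊆ Γ) (i : I)
    (n : ℤ) : Function.Bijective ((T.counit (T.below_layer (GMod.free A σ δ) h)).app i n) :=
  T.counit_layer_bijective _ h (T.xMap_freeQuot_injective hΓ hl h i n)

theorem projective_weightSpace_layer_free (hΓ : IsLowerSet Γ) (hl : l ∉ Γ) (h : Set.Iio l ⊆ Γ) :
    Projective (T.weightSpace _ (T.below_layer (GMod.free A σ δ) h)) :=
  Projective.of_iso (T.weightSpaceLayerIso _ h).symm
    (T.projective_weightSpace_freeQuot hΓ hl h)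

/-- Induction along Γ: each layer of the free module is the standardization of a projective module,
hence acyclic by `hstd`. Only weights in Γ occur, which is what makes the induction in
`acyclic_standardize` legitimate. -/
theorem acyclic_lowerPart_free (hΓ : IsLowerSet Γ) (hf : Γ.Finite)
    (hstd : ∀ l ∈ Γ, ∀ M : GMod (T.algAt A l), Projective M → T.Acyclic (T.standardize M)) :
    T.Acyclic (T.lowerPart (GMod.free A σ δ) Γ).toGMod := by
  refine lowerSet_induction (P := fun Γ' => Γ' ⊆ Γ →
    T.Acyclic (T.lowerPart (GMod.free A σ δ) Γ').toGMod) ?_ ?_ hΓ hf subset_rfl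
  · exact fun _ => T.acyclic_of_subsingleton (T.lowerPart_empty_subsingleton _)
  · intro Γ' l hΓ' _ hl hins ih hsub l' N n
    have h := Iio_subset_of_insert hins
    refine (T.ses_layer _).ext_mid (ih ((Set.subset_insert l Γ').trans hsub) l' N n) ?_
    refine GMod.ext_of_iso (GMod.isoOfBijective _
      (T.counit_layer_free_bijective σ δ hΓ' hl h)).symm ?_
    exact hstd l (hsub (Set.mem_insert l Γ')) _
      (T.projective_weightSpace_layer_free σ δ hΓ' hl h) l' N n

/-- From 0 → F_Γ → F → F/F_Γ → 0 with F projective: Ext¹ vanishes because maps from F_Γ to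
costandard modules extend to F, and the higher groups by shifting to the acyclic F_Γ. -/
theorem acyclic_freeQuot (hΓ : IsLowerSet Γ) (hf : Γ.Finite)
    (hstd : ∀ l ∈ Γ, ∀ M : GMod (T.algAt A l), Projective M → T.Acyclic (T.standardize M)) :
    T.Acyclic (T.freeQuot A σ δ Γ) := by
  have h := T.acyclic_lowerPart_free σ δ hΓ hf hstd
  intro l N n
  have hP : ∀ n, Subsingleton (Abelian.Ext (GMod.free A σ δ) (T.costandardize N) (n + 1)) :=
    fun n => GMod.ext_of_projective n
  cases n with
  | zero =>
    exact (GMod.Sub.ses_proj _).ext_right_one (fun φ => T.exists_extension_lowerPart' hΓ φ) (hP 0)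
  | succ n => exact (GMod.Sub.ses_proj _).ext_right (h l N n) (hP (n + 1))

end

/-- Induction on l. Take F free on the generators of a cover of M and R = F/F_{<l}. The induction
hypothesis makes R acyclic, and j_!M is a retract of R. -/
theorem acyclic_standardize (l : Λ) (M : GMod (T.algAt A l)) (hM : Projective M) :
    T.Acyclic (T.standardize M) := by
  have := T.wellFoundedLT
  have hwf : WellFounded ((· < ·) : Λ → Λ → Prop) := wellFounded_lt
  induction l using hwf.induction with
  | _ l ih =>
    let σ : M.CoverIdx → I := fun g => g.1
    let δ : M.CoverIdx → ℤ := fun g => g.2.1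
    let R : GMod A := T.freeQuot A σ δ (Set.Iio l)
    have hR : T.Below l R := T.below_quot _ subset_rfl
    have hac : T.Acyclic R := T.acyclic_freeQuot σ δ (isLowerSet_Iio l)
      ((T.lowerFinite l).subset Set.Iio_subset_Iic_self) fun m hm M' hM' => ih m hm M' hM'
    let π : GMod.free A σ δ ⟶ T.standardize M :=
      GMod.freeDesc fun g => T.stdUnit M g.1 g.2.1 g.2.2
    have hπ : ∀ i n, ∀ v ∈ (T.lowerPart (GMod.free A σ δ) (Set.Iio l)).piece i n,
        π.app i n v = 0 := fun i n => by
      suffices h : (T.lowerPart (GMod.free A σ δ) (Set.Iio l)).piece i n ≤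
        LinearMap.ker (π.app i n) from h
      refine Submodule.span_le.2 ?_
      rintro _ ⟨r, hr, p, q, hpq, a, x, rfl⟩
      have := T.below_standardize M r hr q
      change π.app i n _ = 0
      rw [π.app_act, Subsingleton.elim (π.app r q x) 0, map_zero]
    let ρ : R ⟶ T.standardize M := GMod.Sub.desc _ π hπ
    let ρ' := T.weightSpaceMap hR (T.below_standardize M) ρ
    have hρ' : ∀ s n, Function.Surjective (ρ'.app s n) := by
      intro s n x
      obtain ⟨v, rfl⟩ := (T.stdUnit_bijective M s n).2 x
      suffices h : ⊤ ≤ (LinearMap.range (ρ'.app s n)).comap (T.stdUnit M s n) from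
        h (Submodule.mem_top (x := v))
      rw [← (Module.Basis.ofVectorSpace k (M.piece s n)).span_eq, Submodule.span_le]
      rintro _ ⟨b, rfl⟩
      rw [Module.Basis.ofVectorSpace_apply_self]
      let g : M.CoverIdx := ⟨s, n, b⟩
      exact ⟨Submodule.mkQ _ (GMod.freeGen (A := A) (σ := σ) (δ := δ) g),
        GMod.freeDesc_gen (V := T.standardize M) (σ := σ) (δ := δ)
          (fun g : M.CoverIdx => T.stdUnit M g.1 g.2.1 g.2.2) g⟩
    have : Epi ρ' := GMod.epi_of_surjective _ hρ'
    -- R → j_!M is surjective on weight l, so projectivity of M lifts the unit M → e_l j_!M to e_l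
    -- R. The adjoint of this lift is the section.
    let j := Projective.factorThru (T.unitHom M) ρ'
    have hj : j ≫ ρ' = T.unitHom M := Projective.factorThru_comp _ _
    have key : T.stdDesc hR j ≫ ρ = 𝟙 _ := T.std_hom_ext fun s n v => by
      rw [GMod.comp_app, stdDesc_unit]
      exact congrArg (fun φ : M ⟶ T.weightSpace _ (T.below_standardize M) => φ.app s n v) hj
    exact fun l' N n => GMod.ext_of_retract _ _ key (hac l' N n)

/-- Extension groups from modules without small weights to costandard modules of small weight. -/
theorem ext_costd_eq_zero {Γ : Set Λ} (hΓ : IsLowerSet Γ) (hf : Γ.Finite) (hl : l ∈ Γ)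
    (N : GMod (T.algAt A l)) (n : ℕ) {W : GMod A}
    (hW : ∀ r ∈ T.indices Γ, ∀ n, Subsingleton (W.piece r n)) :
    Subsingleton (Abelian.Ext W (T.costandardize N) n) := by
  induction n generalizing W with
  | zero =>
    refine GMod.ext_zero_of_hom fun f => T.hom_costd_eq_zero N f fun s n v => ?_
    have := hW s (T.indices_mono (by simpa using hl) s.2) n
    rw [Subsingleton.elim v 0, map_zero, map_zero]
  | succ n ih =>
    -- Dimension shift along P/P_Γ → W with P the free cover. The map exists because e_Γ W = 0, its
    -- source is acyclic, and its kernel again has no weights in Γ.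
    have hπ : ∀ i n, ∀ v ∈ (T.lowerPart W.cover Γ).piece i n, W.coverMap.app i n v = 0 :=
      fun i n => by
        suffices h : (T.lowerPart W.cover Γ).piece i n ≤
          LinearMap.ker (W.coverMap.app i n) from h
        refine Submodule.span_le.2 ?_
        rintro _ ⟨r, hr, p, q, hpq, a, x, rfl⟩
        have := hW r hr q
        change W.coverMap.app i n _ = 0
        rw [W.coverMap.app_act, Subsingleton.elim (W.coverMap.app r q x) 0, map_zero]
    let ρ : (T.lowerPart W.cover Γ).quot ⟶ W := GMod.Sub.desc _ W.coverMap hπ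
    have hρ : ∀ i n, Function.Surjective (ρ.app i n) := fun i n x => by
      obtain ⟨y, rfl⟩ := W.coverMap_surjective i n x
      exact ⟨Submodule.mkQ _ y, rfl⟩
    refine (GMod.ses_ker hρ).ext_right (ih fun r hr n => ?_)
      (T.acyclic_freeQuot (fun g : W.CoverIdx => g.1) (fun g => g.2.1) hΓ hf
        (fun m _ M hM => T.acyclic_standardize m M hM) l N n)
    have := T.quot_subsingleton W.cover hr n
    exact Subtype.val_injective.subsingleton

/-! ### Costandard modules of injective modules -/

section injective

variable {N : GMod (T.algAt A l)}

theorem exists_hom_costd_of_below {W : GMod A} (hW : T.Below l W) (φ : T.weightSpace W hW ⟶ N) :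
    ∃ f : W ⟶ T.costandardize N, ∀ (s : T.indices {l}) n v,
      T.ev N s n (f.app s n v) = φ.app s n v :=
  T.exists_hom_costd (fun s n => φ.app s n) (fun s t d n m h a v =>
    φ.app_act h (T.bar s t d a) v) fun s r hr d n m h a v => by
    have := hW r hr n
    rw [Subsingleton.elim v 0, map_zero]
    exact map_zero _

/-- The homomorphism of `A_l`-modules adjoint to a homomorphism to a costandard module. -/
def costdTranspose {W : GMod A} (hW : T.Below l W) (f : W ⟶ T.costandardize N) :
    T.weightSpace W hW ⟶ N :=
  GMod.Hom.mk (fun s n => (T.ev N s n).comp (f.app s n)) fun {s t d n m} h a v => by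
    obtain ⟨a, rfl⟩ := T.bar_surjective _ _ _ a
    exact (congrArg (T.ev N s m) (f.app_act h a v)).trans (T.ev_act_bar N h a (f.app t n v))

/-- On modules that vanish below l, maps to j_*N correspond to maps from the weight space to N, and
passing to the weight space preserves injections. -/
theorem exists_extension_of_injective (hN : Injective N) {X Y : GMod A} (hX : T.Below l X)
    (hY : T.Below l Y) (f : X ⟶ Y) (hf : ∀ i n, Function.Injective (f.app i n))
    (g : X ⟶ T.costandardize N) : ∃ g' : Y ⟶ T.costandardize N, f ≫ g' = g := by
  have : Mono (T.weightSpaceMap hX hY f) := GMod.mono_of_injective _ fun s n => hf s n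
  obtain ⟨g', hg'⟩ := T.exists_hom_costd_of_below hY
    (Injective.factorThru (T.costdTranspose hX g) (T.weightSpaceMap hX hY f))
  refine ⟨g', T.hom_costd_ext fun s n v => ?_⟩
  refine (hg' s n (f.app s n v)).trans ?_
  exact congrArg (fun φ : T.weightSpace X hX ⟶ N => φ.app s n v)
    (Injective.comp_factorThru (T.costdTranspose hX g) (T.weightSpaceMap hX hY f))

/-- Dimension shift in M along the standardized free cover, which is acyclic. For Ext¹ the maps from
the kernel must extend: for equal weights by injectivity of N, for distinct weights because the only
map is zero. -/
theorem ext_std_costd_injective (hN : Injective N) {m : Λ} (M : GMod (T.algAt A m)) (n : ℕ) :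
    Subsingleton (Abelian.Ext (T.standardize M) (T.costandardize N) (n + 1)) := by
  have hP : ∀ M : GMod (T.algAt A m), T.Acyclic (T.standardize M.cover) := fun M =>
    T.acyclic_standardize m M.cover inferInstance
  induction n generalizing M with
  | zero =>
    refine ((GMod.ses_ker M.coverMap_surjective).standardize T).ext_right_one (fun φ => ?_)
      (hP M l N 0)
    by_cases hm : m = l
    · subst hm
      exact T.exists_extension_of_injective hN (T.below_standardize _) (T.below_standardize _) _
        (T.standardizeMap_injective fun s n => Subtype.val_injective) φ
    · exact ⟨0, by rw [T.hom_std_costd_eq_zero hm φ, comp_zero]⟩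
  | succ n ih =>
    exact ((GMod.ses_ker M.coverMap_surjective).standardize T).ext_right (ih _) (hP M l N (n + 1))

end injective

end TriangularBasis

/-! ### Simple quotients and projective modules -/

namespace GMod

variable {A : LUGAlg k I} {V W : GMod A}

/-- The inverse image of a graded submodule. -/
def Sub.comap (f : V ⟶ W) (N : W.Sub) : V.Sub where
  piece i n := (N.piece i n).comap (f.app i n)
  act_mem h a v hv := by
    change f.app _ _ _ ∈ N.piece _ _
    rw [f.app_act]
    exact N.act_mem h a _ hv

/-- The image of a graded submodule. -/
def Sub.map (f : V ⟶ W) (N : V.Sub) : W.Sub where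
  piece i n := (N.piece i n).map (f.app i n)
  act_mem := by
    rintro i j d n m h a _ ⟨v, hv, rfl⟩
    exact ⟨V.act h a v, N.act_mem h a v hv, f.app_act h a v⟩

instance : Top V.Sub := ⟨⟨fun _ _ => ⊤, fun _ _ _ _ => Submodule.mem_top⟩⟩

theorem Sub.mem_top {i : I} {n : ℤ} (v : V.piece i n) : v ∈ (⊤ : V.Sub).piece i n :=
  Submodule.mem_top

theorem Sub.le_top (N : V.Sub) : N ≤ ⊤ := fun _ _ _ _ => Submodule.mem_top

theorem Sub.eq_top_of_forall {N : V.Sub} (h : ∀ i n, N.piece i n = ⊤) : N = ⊤ :=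
  le_antisymm N.le_top fun i n => (h i n).ge

theorem simple_quot {U : V.Sub} (hU : U ≠ ⊤) (hmax : ∀ U' : V.Sub, U ≤ U' → U' ≠ U → U' = ⊤) :
    Simple U.quot where
  mono_isIso_iff_nonzero {Y} f hf := by
    constructor
    · intro hiso hzero
      refine hU (Sub.eq_top_of_forall fun i n => eq_top_iff.2 fun v _ => ?_)
      obtain ⟨y, hy⟩ := surjective_of_epi f i n (U.proj.app i n v)
      rw [hzero, zero_app] at hy
      exact (Submodule.Quotient.mk_eq_zero _).1 hy.symm
    · intro hne
      let U' : V.Sub := Sub.comap U.proj (range f)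
      have hle : U ≤ U' := fun i n v hv => by
        have : U.proj.app i n v = 0 := (Submodule.Quotient.mk_eq_zero _).2 hv
        change U.proj.app i n v ∈ (range f).piece i n
        rw [this]
        exact zero_mem _
      have hne' : U' ≠ U := by
        intro he
        refine hne (eq_zero_of_app fun i n y => ?_)
        obtain ⟨v, hv⟩ := Submodule.mkQ_surjective _ (f.app i n y)
        rw [← hv]
        have : v ∈ U'.piece i n := ⟨y, hv.symm⟩
        rw [he] at this
        exact (Submodule.Quotient.mk_eq_zero _).2 this
      have htop := hmax U' hle hne'
      refine isIso_of_bijective f fun i n => ⟨injective_of_mono f i n, fun x => ?_⟩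
      obtain ⟨v, rfl⟩ := Submodule.mkQ_surjective _ x
      have : v ∈ U'.piece i n := by
        rw [htop]
        exact Sub.mem_top v
      exact this

/-- V need not be finitely generated, so maximal submodules are sought among those containing all
degrees ≥ m. Such submodules differ only in finitely many degrees, of finite total dimension, and a
proper one of largest dimension is maximal. -/
theorem exists_simple_quotient [Finite I] (hA : A.FiniteBelow) (hV : V.LocallyFinite)
    (hb : V.BoundedBelow) {i₀ : I} {n₀ : ℤ} {x₀ : V.piece i₀ n₀} (hx₀ : x₀ ≠ 0) :
    ∃ (S : GMod A) (φ : V ⟶ S), Simple S ∧ φ ≠ 0 := by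
  have := Fintype.ofFinite I
  obtain ⟨N, hN⟩ := exists_lower_bound hb
  obtain ⟨N', hN'⟩ := exists_lower_bound fun i => hA.2 i₀ i
  -- An element of A taking degree ≥ m to degree n₀ has degree < N', so its component in 1_{i₀}A
  -- vanishes. Hence the submodule generated by degrees ≥ m misses x₀ and is proper.
  let m : ℤ := n₀ - N' + 1
  let G (U : V.Sub) : Prop := U ≠ ⊤ ∧ ∀ i n, m ≤ n → U.piece i n = ⊤
  -- The dimension of U in the degrees that are not forced: below N all of V is zero, and from m on
  -- U is everything.
  let μ (U : V.Sub) : ℕ := ∑ i : I, ∑ n ∈ Finset.Ico N m, Module.finrank k (U.piece i n)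
  have hfin := hV
  have hne : ∃ U, G U := by
    let U : V.Sub :=
      { piece := fun i p => Submodule.span k {x | ∃ (s : I) (e n : ℤ) (h : e + n = p) (_ : m ≤ n)
          (a : A.piece i s e) (v : V.piece s n), x = V.act h a v}
        act_mem := by
          intro i j d n q h c x hx
          induction hx using Submodule.span_induction with
          | mem x hx =>
            obtain ⟨s, e, n', h', hn, a, v, rfl⟩ := hx
            exact Submodule.subset_span ⟨s, d + e, n', by omega, hn, A.mul rfl c a, v,
              (V.mul_act rfl (by omega) h' h c a v).symm⟩
          | zero => simp
          | add x y _ _ hx hy => simpa using add_mem hx hy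
          | smul t x _ hx => simpa using Submodule.smul_mem _ t hx }
    refine ⟨U, fun hU => ?_, fun i n hn => eq_top_iff.2 fun v _ =>
      Submodule.subset_span ⟨i, 0, n, zero_add n, hn, A.one i, v, (V.one_act _ v).symm⟩⟩
    have h0 : U.piece i₀ n₀ ≤ ⊥ := by
      refine Submodule.span_le.2 ?_
      rintro _ ⟨s, e, n, h, hn, a, v, rfl⟩
      have := hN' s e (by omega)
      rw [Subsingleton.elim a 0, map_zero, LinearMap.zero_apply]
      exact zero_mem _
    exact hx₀ ((Submodule.mem_bot k).1 (h0 (by rw [hU]; exact Sub.mem_top x₀)))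
  have hle (U U' : V.Sub) (h : U ≤ U') : μ U ≤ μ U' :=
    Finset.sum_le_sum fun i _ => Finset.sum_le_sum fun n _ => by
      have := hfin i n
      exact Submodule.finrank_mono (h i n)
  have hbound : ∀ U, μ U ≤ μ ⊤ := fun U => hle U ⊤ U.le_top
  obtain ⟨U, hU, hmax⟩ : ∃ U, G U ∧ ∀ U', G U' → μ U' ≤ μ U := by
    obtain ⟨U, hU⟩ := hne
    have hex : ∃ c, ∃ U, G U ∧ μ ⊤ - μ U = c := ⟨_, U, hU, rfl⟩
    classical
    obtain ⟨U₁, hU₁, h₁⟩ := Nat.find_spec hex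
    refine ⟨U₁, hU₁, fun U' hU' => ?_⟩
    have := Nat.find_min' hex ⟨U', hU', rfl⟩
    have := hbound U'
    have := hbound U₁
    omega
  refine ⟨U.quot, U.proj, simple_quot hU.1 fun U' hUU' hne' => ?_, fun h0 => hU.1
    (Sub.eq_top_of_forall fun i n => eq_top_iff.2 fun v _ => ?_)⟩
  · by_contra htop
    have hG : G U' := ⟨htop, fun i n hn => top_le_iff.1 ((hU.2 i n hn).ge.trans (hUU' i n))⟩
    have hμ := le_antisymm (hmax U' hG) (hle U U' hUU')
    refine hne' (le_antisymm (fun i n => ?_) hUU')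
    by_cases h1 : m ≤ n
    · exact (hU.2 i n h1).symm ▸ le_top
    by_cases h2 : n < N
    · have := hN i n h2
      intro v _
      rw [Subsingleton.elim v 0]
      exact zero_mem _
    have h3 : ∀ i n, Module.finrank k (U.piece i n) ≤ Module.finrank k (U'.piece i n) :=
      fun i n => by
        have := hfin i n
        exact Submodule.finrank_mono (hUU' i n)
    have h4 := (Finset.sum_eq_sum_iff_of_le fun i _ => Finset.sum_le_sum fun n _ => h3 i n).1 hμ.symm
      i (Finset.mem_univ i)
    have h5 := (Finset.sum_eq_sum_iff_of_le fun n _ => h3 i n).1 h4 n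
      (Finset.mem_Ico.2 ⟨not_lt.1 h2, not_le.1 h1⟩)
    have := hfin i n
    exact (Submodule.eq_of_le_of_finrank_eq (hUU' i n) h5).ge
  · have := proj_app U i n v
    rw [h0] at this
    exact (Submodule.Quotient.mk_eq_zero _).1 this.symm

/-- Zorn's lemma for descending chains. In each finite-dimensional piece a chain reaches its
minimum, so the intersection is still a supplement of K. For K the kernel of a cover, R plays the
role of a projective cover. -/
theorem exists_minimal_supplement (hV : V.LocallyFinite) (K : V.Sub) :
    ∃ R : V.Sub, (∀ i n, R.piece i n ⊔ K.piece i n = ⊤) ∧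
      ∀ R' : V.Sub, R' ≤ R → (∀ i n, R'.piece i n ⊔ K.piece i n = ⊤) → R' = R := by
  obtain ⟨R, hR⟩ := zorn_le₀ (α := V.Subᵒᵈ)
    {R | ∀ i n, (OrderDual.ofDual R).piece i n ⊔ K.piece i n = ⊤} (by
    intro c hc hchain
    let R₀ : V.Sub :=
      { piece := fun i n => ⨅ R ∈ c, (OrderDual.ofDual R).piece i n
        act_mem := by
          intro i j d n m h a v hv
          simp only [Submodule.mem_iInf] at hv ⊢
          exact fun R hR => (OrderDual.ofDual R).act_mem h a v (hv R hR) }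
    refine ⟨OrderDual.toDual R₀, fun i n => ?_, fun R hR i n => iInf₂_le R hR⟩
    change (⨅ R ∈ c, (OrderDual.ofDual R).piece i n) ⊔ K.piece i n = ⊤
    rcases c.eq_empty_or_nonempty with rfl | hne
    · simp
    · have := hV i n
      obtain ⟨_, ⟨R₁, hR₁, rfl⟩, hmin⟩ := (wellFounded_lt (α := Submodule k (V.piece i n))).has_min
        ((fun R : V.Subᵒᵈ => (OrderDual.ofDual R).piece i n) '' c) (hne.image _)
      have h : (⨅ R ∈ c, (OrderDual.ofDual R).piece i n) = (OrderDual.ofDual R₁).piece i n := by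
        refine le_antisymm (iInf₂_le R₁ hR₁) (le_iInf₂ fun R hR => ?_)
        rcases hchain.total hR hR₁ with h | h
        · exact h i n
        · exact (eq_of_le_of_not_lt (h i n) (hmin _ ⟨R, hR, rfl⟩)).ge
      rw [h]
      exact hc hR₁ i n)
  exact ⟨OrderDual.ofDual R, hR.1, fun R' hle hR' => le_antisymm hle (hR.2 hR' hle)⟩

theorem cover_boundedBelow [Finite I] (hA : A.FiniteBelow) (hb : V.BoundedBelow) :
    V.cover.BoundedBelow := by
  intro i
  obtain ⟨N, hN⟩ := exists_lower_bound hb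
  obtain ⟨M, hM⟩ := exists_lower_bound (hA.2 i)
  refine ⟨N + M, fun n hn => subsingleton_of_forall_eq 0 fun x => ?_⟩
  induction x using freeMk_induction (σ := fun g : V.CoverIdx => g.1) (δ := fun g => g.2.1) with
  | hz => rfl
  | ha x y hx hy => exact (congrArg₂ _ hx hy).trans (add_zero _)
  | hp g p h a =>
    obtain ⟨j, m, b⟩ := g
    have h' : p + m = n := h
    by_cases hp : p < M
    · have := hM j p hp
      rw [Subsingleton.elim a 0, map_zero]
      rfl
    · have := hN j m (by omega)
      exact ((Module.Basis.ofVectorSpace k (V.piece j m)).ne_zero b (Subsingleton.elim _ _)).elim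

/-- A minimal supplement R of the kernel of the free cover maps onto V. A nonzero kernel of R → V
would have a simple quotient, whose projection would extend to R by vanishing of Ext¹ and cut out a
smaller supplement. So R ≅ V, which splits the cover. -/
theorem projective_of_ext_simple [Finite I] (hA : A.FiniteBelow) (hV : V.LocallyFinite)
    (hb : V.BoundedBelow)
    (h : ∀ S : GMod A, Simple S → Subsingleton (Abelian.Ext V S 1)) : Projective V := by
  have hP : V.cover.LocallyFinite := V.cover_locallyFinite hA hV hb
  have hPb : V.cover.BoundedBelow := V.cover_boundedBelow hA hb
  let K : V.cover.Sub := ker V.coverMap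
  obtain ⟨R, hR, hmin⟩ := exists_minimal_supplement hP K
  let f : R.toGMod ⟶ V := R.incl ≫ V.coverMap
  have hf : ∀ i n, Function.Surjective (f.app i n) := by
    intro i n x
    obtain ⟨y, rfl⟩ := V.coverMap_surjective i n x
    obtain ⟨r, hr, z, hz, rfl⟩ := Submodule.mem_sup.1 ((hR i n).ge (Submodule.mem_top (x := y)))
    refine ⟨R.elem r hr, ?_⟩
    rw [map_add, show V.coverMap.app i n z = 0 from hz, add_zero]
    rfl
  have hinj : ∀ i n, Function.Injective (f.app i n) := by
    intro i n
    rw [injective_iff_map_eq_zero]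
    intro x hx
    by_contra hx0
    have hRP : R.toGMod.LocallyFinite := hP.of_injective R.incl fun _ _ => Subtype.val_injective
    have hRb : R.toGMod.BoundedBelow := hPb.of_injective R.incl fun _ _ => Subtype.val_injective
    obtain ⟨S, φ, hS, hφ⟩ := exists_simple_quotient hA
      (hRP.of_injective (ker f).incl fun _ _ => Subtype.val_injective)
      (hRb.of_injective (ker f).incl fun _ _ => Subtype.val_injective)
      (x₀ := (ker f).elem x hx) (fun h0 => hx0 (congrArg Subtype.val h0))
    obtain ⟨ψ, hψ⟩ := (ses_ker hf).exists_extension (h S hS) φ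
    have : Epi φ := epi_of_nonzero_to_simple hφ
    -- Still a supplement: φ is onto, so any r ∈ R can be corrected by some t in the kernel of R → V
    -- to lie in ker ψ, and t lies in K. Minimality then forces ψ = 0 and hence φ = 0.
    let R' : V.cover.Sub := Sub.map R.incl (ker ψ)
    have hR' : R' = R := by
      refine hmin R' ?_ fun i n => eq_top_iff.2 fun y _ => ?_
      · rintro i n _ ⟨r, -, rfl⟩
        exact r.2
      · obtain ⟨r, hr, z, hz, rfl⟩ :=
          Submodule.mem_sup.1 ((hR i n).ge (Submodule.mem_top (x := y)))
        obtain ⟨⟨t, ht⟩, htr⟩ := surjective_of_epi φ i n (ψ.app i n (R.elem r hr))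
        refine Submodule.mem_sup.2 ⟨(r - R.incl.app i n t : V.cover.piece i n), ?_,
          (R.incl.app i n t + z : V.cover.piece i n), ?_, by abel⟩
        · refine ⟨R.elem r hr - t, ?_, rfl⟩
          change ψ.app i n (R.elem r hr - t) = 0
          rw [map_sub, ← htr, ← hψ]
          exact sub_self _
        · exact add_mem (show R.incl.app i n t ∈ K.piece i n from ht) hz
    apply hφ
    rw [← hψ]
    refine eq_zero_of_app fun i n t => ?_
    have h1 : R.incl.app i n ((ker f).incl.app i n t) ∈ R'.piece i n := by
      rw [hR']
      exact ((ker f).incl.app i n t).2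
    obtain ⟨r, hr, hrt⟩ := h1
    obtain rfl : r = (ker f).incl.app i n t := Subtype.ext hrt
    exact hr
  let e := isoOfBijective f fun i n => ⟨hinj i n, hf i n⟩
  refine ⟨fun {E X} g π hπ => ⟨e.inv ≫ R.incl ≫ Projective.factorThru (V.coverMap ≫ g) π, ?_⟩⟩
  rw [Category.assoc, Category.assoc, Projective.factorThru_comp]
  change e.inv ≫ e.hom ≫ g = g
  rw [e.inv_hom_id_assoc]

end GMod

/-! ### Layers detected by extension groups -/

namespace TriangularBasis

variable {A : LUGAlg k I} {Λ : Type v} [PartialOrder Λ]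

/-- A class of graded modules over the algebras `A_l` that is used to test for layers, and the
class of modules whose standardizations are the layers. -/
structure LayerTest (T : TriangularBasis A Λ) where
  test : ∀ {l : Λ}, GMod (T.algAt A l) → Prop
  good : ∀ {l : Λ}, GMod (T.algAt A l) → Prop
  ext_of_good : ∀ {l m : Λ} {M : GMod (T.algAt A l)} {N : GMod (T.algAt A m)}, good M → test N →
    ∀ n : ℕ, Subsingleton (Abelian.Ext (T.standardize M) (T.costandardize N) (n + 1))
  good_of_extends : ∀ {l : Λ} {M : GMod (T.algAt A l)}, M.LocallyFinite → M.BoundedBelow →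
    (∀ N : GMod (T.algAt A l), test N → ∀ φ : (GMod.ker M.coverMap).toGMod ⟶ N,
      ∃ ψ : M.cover ⟶ N, (GMod.ker M.coverMap).incl ≫ ψ = φ) → good M
  exists_hom : ∀ {l : Λ} {M : GMod (T.algAt A l)}, M.LocallyFinite → M.BoundedBelow →
    ∀ {s : T.indices {l}} {n : ℤ} {x : M.piece s n}, x ≠ 0 →
      ∃ (N : GMod (T.algAt A l)) (φ : M ⟶ N), test N ∧ φ ≠ 0

/-- The first extension groups with values in the costandard modules of the test class, with
weights in `Γ`, vanish. -/
def LayerTest.ExtOne {T : TriangularBasis A Λ} (C : T.LayerTest) (Γ : Set Λ) (V : GMod A) : Prop :=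
  ∀ l ∈ Γ, ∀ N : GMod (T.algAt A l), C.test N → Subsingleton (Abelian.Ext V (T.costandardize N) 1)

/-- The layers of a given weight. -/
def LayerTest.layer {T : TriangularBasis A Λ} (C : T.LayerTest) (l : Λ) (V : GMod A) : Prop :=
  ∃ M : GMod (T.algAt A l), C.good M ∧ M.LocallyFinite ∧ M.BoundedBelow ∧
    Nonempty (V ≅ T.standardize M)

variable (T : TriangularBasis A Λ) {l : Λ}

theorem weightSpace_locallyFinite {Q : GMod A} (hQ : T.Below l Q) (h : Q.LocallyFinite) :
    (T.weightSpace Q hQ).LocallyFinite := fun s n => h s n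

theorem weightSpace_boundedBelow {Q : GMod A} (hQ : T.Below l Q) (h : Q.BoundedBelow) :
    (T.weightSpace Q hQ).BoundedBelow := fun s => h s

theorem layer_locallyFinite {V : GMod A} (h : V.LocallyFinite) (Γ' Γ : Set Λ) :
    (T.layer V Γ' Γ).LocallyFinite :=
  (h.of_injective (T.lowerPart V Γ).incl fun _ _ => Subtype.val_injective).of_surjective
    ((T.lowerPart V Γ').within (T.lowerPart V Γ)).proj fun _ _ => Submodule.mkQ_surjective _

theorem layer_boundedBelow {V : GMod A} (h : V.BoundedBelow) (Γ' Γ : Set Λ) :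
    (T.layer V Γ' Γ).BoundedBelow :=
  (h.of_injective (T.lowerPart V Γ).incl fun _ _ => Subtype.val_injective).of_surjective
    ((T.lowerPart V Γ').within (T.lowerPart V Γ)).proj fun _ _ => Submodule.mkQ_surjective _

theorem subsingleton_of_idealOf_eq_top {W : GMod A} {J : Set I}
    (hW : ∀ r ∈ J, ∀ n, Subsingleton (W.piece r n)) {i : I}
    (h : ∀ j d, (A.idealOf J).piece i j d = ⊤) (n : ℤ) : Subsingleton (W.piece i n) := by
  refine subsingleton_of_forall_eq 0 fun x => ?_
  rw [← W.one_act (zero_add n) x]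
  exact W.act_eq_zero_of_mem hW _ (by rw [h]; exact Submodule.mem_top) x

/-- Extending homomorphisms to a module over `A_l` from its cover. -/
theorem exists_extension_cover {Q : GMod A} (hQ : T.Below l Q)
    (hc : ∀ i n, Function.Surjective ((T.counit hQ).app i n)) {N : GMod (T.algAt A l)}
    (hN : Subsingleton (Abelian.Ext Q (T.costandardize N) 1))
    (φ : (GMod.ker (T.weightSpace Q hQ).coverMap).toGMod ⟶ N) :
    ∃ ψ : (T.weightSpace Q hQ).cover ⟶ N,
      (GMod.ker (T.weightSpace Q hQ).coverMap).incl ≫ ψ = φ := by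
  let M := T.weightSpace Q hQ
  let p : T.standardize M.cover ⟶ Q := T.stdDesc hQ M.coverMap
  have hpu : ∀ (s : T.indices {l}) n (v : M.cover.piece s n),
      p.app s n (T.stdUnit M.cover s n v) = M.coverMap.app s n v := T.stdDesc_unit hQ M.coverMap
  have hp : ∀ i n, Function.Surjective (p.app i n) := by
    have e : p = T.standardizeMap M.coverMap ≫ T.counit hQ := T.std_hom_ext fun s n v => by
      rw [hpu, GMod.comp_app, standardizeMap_unit]
      exact (T.counit_unit hQ s n _).symm
    intro i n
    rw [e]
    exact (hc i n).comp (T.standardizeMap_surjective _ M.coverMap_surjective i n)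
  have hb := T.below_standardize M.cover
  have hK : T.Below l (GMod.ker p).toGMod := hb.of_injective (GMod.ker p).incl
    fun _ _ => Subtype.val_injective
  -- The unit is bijective, so the weight space of ker p is the kernel of the cover of e_l Q.
  let u : (GMod.ker M.coverMap).toGMod ⟶ T.weightSpace (GMod.ker p).toGMod hK :=
    GMod.Hom.mk (fun s n => LinearMap.codRestrict ((GMod.ker p).piece s n)
      ((T.stdUnit M.cover s n).comp ((GMod.ker M.coverMap).piece s n).subtype)
      fun v => (hpu s n v.1).trans v.2) fun {s t d n m} h a v => by
        obtain ⟨a, rfl⟩ := T.bar_surjective _ _ _ a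
        exact Subtype.ext (T.stdUnit_act M.cover h a v.1)
  let e := GMod.isoOfBijective u fun s n => by
    refine ⟨fun x y hxy => Subtype.ext ((T.stdUnit_bijective M.cover s n).1
      (congrArg (fun z : (GMod.ker p).piece s n => z.1) hxy)), fun z => ?_⟩
    obtain ⟨v, hv⟩ := (T.stdUnit_bijective M.cover s n).2 z.1
    refine ⟨(GMod.ker M.coverMap).elem v ?_, Subtype.ext hv⟩
    have hz : p.app s n z.1 = 0 := z.2
    rw [← hv, hpu] at hz
    exact hz
  obtain ⟨f, hf⟩ := T.exists_hom_costd_of_below hK (e.inv ≫ φ)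
  obtain ⟨g, hg⟩ := (GMod.ses_ker hp).exists_extension hN f
  refine ⟨T.unitHom M.cover ≫ T.costdTranspose hb g, GMod.hom_ext fun s n v => ?_⟩
  have h1 : φ.app s n v = T.ev N s n (f.app s n (u.app s n v)) := by
    rw [hf s n (u.app s n v)]
    exact congrArg (φ.app s n) (congrArg (fun z : _ ⟶ _ => GMod.Hom.app z s n v)
      e.hom_inv_id).symm
  rw [h1, ← hg]
  rfl

-- Induction on the weight: once all smaller weight spaces of K vanish, K is zero below m, and a
-- nonzero map from e_m K to a test module would give a nonzero map from K to its costandard module.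
variable {T} in
theorem LayerTest.subsingleton_of_hom (C : T.LayerTest) {Γ : Set Λ} (hΓ : IsLowerSet Γ)
    {K : GMod A} (hK : K.LocallyFinite) (hb : K.BoundedBelow)
    (h : ∀ l ∈ Γ, ∀ N : GMod (T.algAt A l), C.test N → ∀ f : K ⟶ T.costandardize N, f = 0) :
    ∀ r ∈ T.indices Γ, ∀ n, Subsingleton (K.piece r n) := by
  have := T.wellFoundedLT
  have hwf : WellFounded ((· < ·) : Λ → Λ → Prop) := wellFounded_lt
  suffices key : ∀ m ∈ Γ, ∀ r ∈ T.indices {m}, ∀ n, Subsingleton (K.piece r n) by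
    rintro r ⟨hr, hr'⟩
    exact key _ hr' r ⟨hr, rfl⟩
  intro m
  induction m using hwf.induction with
  | _ m ih =>
    intro hm s hs n
    have hbelow : T.Below m K := by
      rintro r ⟨hr, hr'⟩
      exact ih _ hr' (hΓ (le_of_lt hr') hm) r ⟨hr, rfl⟩
    refine subsingleton_of_forall_eq 0 fun x => ?_
    by_contra hx
    obtain ⟨N, φ, hN, hφ⟩ := C.exists_hom (T.weightSpace_locallyFinite hbelow hK)
      (T.weightSpace_boundedBelow hbelow hb) (s := ⟨s, hs⟩) (n := n) (x := x) hx
    obtain ⟨f, hf⟩ := T.exists_hom_costd_of_below hbelow φ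
    refine hφ (GMod.eq_zero_of_app fun s n v => ?_)
    refine (hf s n v).symm.trans ?_
    rw [h m hm N hN f]
    exact map_zero _

section main

variable {T} (C : T.LayerTest) (hA : A.FiniteBelow) {V : GMod A}

/-- The kernel of the counit of a layer. -/
abbrev counitKer (T : TriangularBasis A Λ) (V : GMod A) {Γ : Set Λ} (h : Set.Iio l ⊆ Γ) : GMod A :=
  (GMod.ker (T.counit (T.below_layer V h))).toGMod

theorem LayerTest.extOne_layer {Γ Γ₂ : Set Λ} (hΓ : IsLowerSet Γ)
    (hV : C.ExtOne Γ₂ (T.lowerPart V (insert l Γ)).toGMod) :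
    C.ExtOne Γ₂ (T.layer V Γ (insert l Γ)) := fun m hm N hN =>
  (T.ses_layer V).ext_right_one
    (fun φ => T.exists_extension_inclLE hΓ (Set.subset_insert l Γ) φ) (hV m hm N hN)

-- The inductive step. With Q the layer and K the kernel of j_!e_l Q → Q, vanishing of Ext¹(Q, –)
-- makes e_l Q good and e_{Γ₂}K zero. This in turn gives Ext²(Q, –) = 0, so that the vanishing of
-- Ext¹ descends to V_Γ.
include hA in
theorem LayerTest.step (hfin : V.LocallyFinite) (hbdd : V.BoundedBelow) {Γ Γ₂ : Set Λ}
    (hΓ : IsLowerSet Γ) (h : Set.Iio l ⊆ Γ) (hlΓ₂ : l ∈ Γ₂) (hΓ₂ : IsLowerSet Γ₂)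
    (hf : Γ₂.Finite) (hV : C.ExtOne Γ₂ (T.lowerPart V (insert l Γ)).toGMod) :
    C.good (T.weightSpace _ (T.below_layer V h)) ∧
    (∀ r ∈ T.indices Γ₂, ∀ n, Subsingleton ((counitKer T V h).piece r n)) ∧
    C.ExtOne Γ₂ (T.lowerPart V Γ).toGMod := by
  have hQ := C.extOne_layer hΓ hV
  have hb := T.below_layer V h
  have hs := T.counit_layer_surjective V h
  have hQf := T.weightSpace_locallyFinite hb (T.layer_locallyFinite hfin Γ (insert l Γ))
  have hQb := T.weightSpace_boundedBelow hb (T.layer_boundedBelow hbdd Γ (insert l Γ))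
  have hgood : C.good (T.weightSpace _ hb) := C.good_of_extends hQf hQb fun N hN φ =>
    T.exists_extension_cover hb hs (hQ l hlΓ₂ N hN) φ
  have hses := GMod.ses_ker hs
  have hK : ∀ r ∈ T.indices Γ₂, ∀ n, Subsingleton ((counitKer T V h).piece r n) := by
    refine C.subsingleton_of_hom hΓ₂
      ((T.standardize_locallyFinite hA hQf hQb).of_injective _ hses.inj)
      ((T.standardize_boundedBelow hA hQb).of_injective _ hses.inj) fun m hm N hN f => ?_
    -- At weight l the counit is bijective, so K has no weight l part. At any other weight f extends
    -- to the standard module, since Ext¹(Q, –) = 0, and no nonzero map exists there.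
    by_cases hml : l = m
    · subst hml
      refine T.hom_costd_eq_zero N f fun s n x => ?_
      have hx : x = 0 := by
        refine Subtype.ext ?_
        obtain ⟨v, hv⟩ := (T.stdUnit_bijective _ s n).2 x.1
        have hx : (T.counit hb).app s n x.1 = 0 := x.2
        rw [← hv] at hx
        have hv0 : v = 0 := (T.counit_unit hb s n v).symm.trans hx
        rw [← hv, hv0]
        exact map_zero _
      rw [hx, map_zero, map_zero]
    · obtain ⟨g, rfl⟩ := hses.exists_extension (hQ m hm N hN) f
      rw [T.hom_std_costd_eq_zero hml g, comp_zero]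
  refine ⟨hgood, hK, fun m hm N hN => ?_⟩
  -- Ext²(Q, –) lies between Ext¹(K, –), zero because e_{Γ₂}K = 0, and Ext² of a standard module
  -- with good weight space.
  refine (T.ses_layer V).ext_left (hV m hm N hN) (hses.ext_right ?_ (C.ext_of_good hgood hN 1))
  exact T.ext_costd_eq_zero hΓ₂ hf hm N 1 hK

-- Descends from Γ₂ to Γ one weight at a time. The start uses that V/V_{Γ₂} has no Ext² to
-- costandard modules with weights in Γ₂.
include hA in
theorem LayerTest.extOne_lowerPart_of_subset (hfin : V.LocallyFinite) (hbdd : V.BoundedBelow)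
    {Γ Γ₂ : Set Λ} (hV : C.ExtOne Γ₂ V) (hΓ : IsLowerSet Γ) (hΓ₂ : IsLowerSet Γ₂) (hf : Γ₂.Finite)
    (hsub : Γ ⊆ Γ₂) : C.ExtOne Γ₂ (T.lowerPart V Γ).toGMod := by
  induction hn : (Γ₂ \ Γ).ncard generalizing Γ with
  | zero =>
    have h0 := Set.sdiff_eq_empty.1 ((Set.ncard_eq_zero hf.sdiff).1 hn)
    obtain rfl := subset_antisymm hsub h0
    intro m hm N hN
    exact (GMod.Sub.ses_proj _).ext_left (hV m hm N hN) (T.ext_costd_eq_zero hΓ₂ hf hm N 2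
      fun r hr n => T.quot_subsingleton V hr n)
  | succ n ih =>
    have hne : (Γ₂ \ Γ).Nonempty := by
      rw [Set.nonempty_iff_ne_empty]
      intro h
      simp [h] at hn
    -- Minimality in Γ₂ \ Γ puts all weights below m into Γ, so adding m keeps a lower set and
    -- `step` applies.
    obtain ⟨m, hm⟩ := (hf.sdiff (t := Γ)).exists_minimal hne
    have hlt : Set.Iio m ⊆ Γ := fun x hx => by
      by_contra hxΓ
      exact absurd (hm.2 ⟨hΓ₂ (le_of_lt hx) hm.1.1, hxΓ⟩ (le_of_lt hx)) (not_le_of_gt hx)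
    have hins : IsLowerSet (insert m Γ) := by
      rintro a b hba (rfl | ha)
      · rcases eq_or_lt_of_le hba with rfl | hlt'
        · exact Set.mem_insert _ _
        · exact Set.mem_insert_of_mem _ (hlt hlt')
      · exact Set.mem_insert_of_mem _ (hΓ hba ha)
    refine (C.step hA hfin hbdd hΓ hlt hm.1.1 hΓ₂ hf
      (ih hins (Set.insert_subset hm.1.1 hsub) ?_)).2.2
    have : Γ₂ \ insert m Γ = (Γ₂ \ Γ) \ {m} := by
      ext x
      simp only [Set.mem_sdiff, Set.mem_insert_iff, Set.mem_singleton_iff]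
      tauto
    rw [this, Set.ncard_sdiff_singleton_of_mem hm.1, hn, Nat.add_sub_cancel]

variable (hfin : V.LocallyFinite) (hbdd : V.BoundedBelow) (hV : C.ExtOne Set.univ V)

-- For a fixed weight m the finite lower set Γ ∪ {≤ m} contains both Γ and m.
include hA hfin hbdd hV in
theorem LayerTest.extOne_lowerPart {Γ : Set Λ} (hΓ : IsLowerSet Γ) (hf : Γ.Finite) :
    C.ExtOne Set.univ (T.lowerPart V Γ).toGMod := fun m _ =>
  C.extOne_lowerPart_of_subset hA hfin hbdd (fun l _ => hV l trivial) hΓ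
    (hΓ.union (isLowerSet_Iic m)) (hf.union (T.lowerFinite m)) Set.subset_union_left m (by simp)

include hV in
theorem LayerTest.extOne_quot {Γ : Set Λ} (hΓ : IsLowerSet Γ) :
    C.ExtOne Set.univ (T.lowerPart V Γ).quot := fun m _ N hN =>
  (GMod.Sub.ses_proj _).ext_right_one (fun φ => T.exists_extension_lowerPart' hΓ φ)
    (hV m trivial N hN)

-- The kernel of the counit does not depend on Γ₂, so it vanishes on every finite lower set of
-- weights containing l. For each i some such set generates all of 1ᵢA, and then the component of
-- the kernel at i is zero.
include hA hfin hbdd hV in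
theorem LayerTest.layer_of_extOne {Γ : Set Λ} (hΓ : IsLowerSet Γ) (hf : Γ.Finite) (h : Set.Iio l ⊆ Γ)
    (hins : IsLowerSet (insert l Γ)) : C.good (T.weightSpace _ (T.below_layer V h)) ∧
      ∀ i n, Function.Bijective ((T.counit (T.below_layer V h)).app i n) := by
  have hext := C.extOne_lowerPart hA hfin hbdd hV hins (hf.insert l)
  have key := fun (Γ₂ : Set Λ) (hlΓ₂ : l ∈ Γ₂) (hΓ₂ : IsLowerSet Γ₂) (hf₂ : Γ₂.Finite) =>
    C.step hA hfin hbdd hΓ h hlΓ₂ hΓ₂ hf₂ fun m _ => hext m trivial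
  refine ⟨(key _ (Set.mem_insert l Γ) hins (hf.insert l)).1, fun i n =>
    ⟨?_, T.counit_layer_surjective V h i n⟩⟩
  obtain ⟨Γ₂, hsub, hf₂, hΓ₂, htop⟩ := T.exists_idealOf_eq_top i (hf.insert l) hins
  have h1 := (key Γ₂ (hsub (Set.mem_insert l Γ)) hΓ₂ hf₂).2.1
  rw [injective_iff_map_eq_zero]
  intro x hx
  have := subsingleton_of_idealOf_eq_top h1 htop n
  exact congrArg Subtype.val (Subsingleton.elim ((GMod.ker (T.counit (T.below_layer V h))).elem x hx) 0)

end main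

end TriangularBasis

/-! ### Flags and extension groups -/

theorem IsLowerSet.exists_chain {Λ : Type v} [PartialOrder Λ] {Γ : Set Λ} (hΓ : IsLowerSet Γ)
    (hf : Γ.Finite) : ∃ (n : ℕ) (S : ℕ → Set Λ), S 0 = ∅ ∧ S n = Γ ∧ ∀ r < n, ∃ l,
      IsLowerSet (S r) ∧ l ∉ S r ∧ IsLowerSet (insert l (S r)) ∧ S (r + 1) = insert l (S r) := by
  refine TriangularBasis.lowerSet_induction (P := fun Γ => ∃ (n : ℕ) (S : ℕ → Set Λ), S 0 = ∅ ∧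
    S n = Γ ∧ ∀ r < n, ∃ l, IsLowerSet (S r) ∧ l ∉ S r ∧ IsLowerSet (insert l (S r)) ∧
      S (r + 1) = insert l (S r)) ⟨0, fun _ => ∅, rfl, rfl, by simp⟩ ?_ hΓ hf
  rintro Γ l hΓ - hl hins ⟨n, S, h0, rfl, hS⟩
  refine ⟨n + 1, fun r => if r ≤ n then S r else insert l (S n), by simp [h0], by simp,
    fun r hr => ?_⟩
  rcases Nat.lt_succ_iff_lt_or_eq.1 hr with h | rfl
  · obtain ⟨m, hm⟩ := hS r h
    exact ⟨m, by simpa [h.le, Nat.succ_le_of_lt h] using hm⟩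
  · exact ⟨l, by simpa using ⟨hΓ, hl, hins⟩⟩

namespace Weights

variable {A : LUGAlg k I} {Λ : Type v}

/-- Evaluates the family along a chain that adds one weight at a time. Distinctness of the weights
is automatic, since each one is new when it is added. -/
theorem hasFlag_of_family [PartialOrder Λ] {layer : Λ → GMod A → Prop} {W : GMod A}
    (N : Set Λ → W.Sub) (hmono : ∀ {Γ Γ'}, Γ ⊆ Γ' → N Γ ≤ N Γ') (h0 : ∀ i n, (N ∅).piece i n = ⊥)
    {Γ : Set Λ} (hΓ : IsLowerSet Γ) (hf : Γ.Finite) (htop : ∀ i n, (N Γ).piece i n = ⊤)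
    (hl : ∀ Γ' l, IsLowerSet Γ' → l ∉ Γ' → IsLowerSet (insert l Γ') → insert l Γ' ⊆ Γ →
      layer l ((N Γ').subquot (N (insert l Γ')))) : HasFlag layer W := by
  obtain ⟨n, S, hS0, hSn, hS⟩ := hΓ.exists_chain hf
  choose wt hwt using fun r : Fin n => hS r r.2
  have hstep : ∀ r < n, S r ⊆ S (r + 1) := fun r hr => by
    obtain ⟨l, -, -, -, h⟩ := hS r hr
    rw [h]
    exact Set.subset_insert _ _
  have hSmono : ∀ r r', r ≤ r' → r' ≤ n → S r ⊆ S r' := by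
    intro r r' h
    induction h with
    | refl => exact fun _ => subset_rfl
    | step _ ih => exact fun h => (ih (Nat.le_of_succ_le h)).trans (hstep _ h)
  refine ⟨n, fun r => N (S r), wt, ?_, ?_, ?_, ?_, ?_⟩
  · intro i d
    change (N (S 0)).piece i d = ⊥
    rw [hS0, h0]
  · intro i d
    change (N (S n)).piece i d = ⊤
    rw [hSn, htop]
  · exact fun r => hmono (hstep r r.2)
  · have key : ∀ r r' : Fin n, r < r' → wt r ≠ wt r' := fun r r' h he => by
      refine (hwt r').2.1 (hSmono (r + 1) r' h r'.2.le ?_)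
      rw [(hwt r).2.2.2, ← he]
      exact Set.mem_insert _ _
    intro r r' he
    rcases lt_trichotomy r r' with h | h | h
    · exact absurd he (key r r' h)
    · exact h
    · exact absurd he.symm (key r' r h)
  · intro r
    obtain ⟨h1, h2, h3, h4⟩ := hwt r
    change layer (wt r) ((N (S r)).subquot (N (S (r + 1))))
    rw [h4]
    refine hl _ _ h1 h2 h3 ?_
    rw [← h4, ← hSn]
    exact hSmono _ _ r.2 le_rfl

theorem HasFlag.mono {layer layer' : Λ → GMod A → Prop} {W : GMod A}
    (h : ∀ l U, layer l U → layer' l U) (hW : HasFlag layer W) : HasFlag layer' W := by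
  obtain ⟨n, F, wt, h0, h1, h2, h3, h4⟩ := hW
  exact ⟨n, F, wt, h0, h1, h2, h3, fun r => h _ _ (h4 r)⟩

theorem HasFlag.ext {layer : Λ → GMod A → Prop} {V W : GMod A} {n : ℕ} (hV : HasFlag layer V)
    (h : ∀ l U, layer l U → Subsingleton (Abelian.Ext U W n)) :
    Subsingleton (Abelian.Ext V W n) := by
  obtain ⟨N, F, wt, h0, h1, h2, -, h4⟩ := hV
  have key : ∀ r : Fin (N + 1), Subsingleton (Abelian.Ext (F r).toGMod W n) := by
    intro r
    induction r using Fin.induction with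
    | zero =>
      have hz : 𝟙 (F 0).toGMod = 0 := GMod.eq_zero_of_app fun i d x =>
        Subtype.ext ((Submodule.mem_bot k).1 ((h0 i d).le x.2))
      refine subsingleton_of_forall_eq 0 fun x => ?_
      rw [← x.mk₀_id_comp, hz, Abelian.Ext.mk₀_zero, Abelian.Ext.zero_comp]
    | succ r ih =>
      exact (GMod.Sub.ses_subquot (h2 r)).ext_mid ih (h _ _ (h4 r))
  refine GMod.ext_of_iso (GMod.isoOfBijective (F (Fin.last N)).incl fun i d =>
    ⟨Subtype.val_injective, fun v => ⟨(F (Fin.last N)).elem v ?_, rfl⟩⟩).symm (key _)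
  rw [h1]
  exact Submodule.mem_top

end Weights

namespace TriangularBasis

variable {A : LUGAlg k I} {Λ : Type v} [PartialOrder Λ] {T : TriangularBasis A Λ} {l : Λ}
  (C : T.LayerTest)

theorem lowerPart_piece_empty (T : TriangularBasis A Λ) (V : GMod A) (i : I) (n : ℤ) :
    (T.lowerPart V ∅).piece i n = ⊥ := by
  refine Submodule.span_eq_bot.2 ?_
  rintro _ ⟨r, ⟨_, hr⟩, _⟩
  exact absurd hr (Set.notMem_empty _)

theorem lowerPart_lowerPart (T : TriangularBasis A Λ) (V : GMod A) (Γ : Set Λ) (i : I) (n : ℤ) :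
    (T.lowerPart (T.lowerPart V Γ).toGMod Γ).piece i n = ⊤ := by
  rw [eq_top_iff]
  rintro ⟨v, hv⟩ -
  suffices key : (T.lowerPart V Γ).piece i n ≤
      ((T.lowerPart (T.lowerPart V Γ).toGMod Γ).piece i n).map
        ((T.lowerPart V Γ).piece i n).subtype by
    obtain ⟨⟨v', hv'⟩, h2, h3⟩ := key hv
    obtain rfl : v' = v := h3
    exact h2
  refine Submodule.span_le.2 ?_
  rintro _ ⟨r, hr, p, q, hpq, a, x, rfl⟩
  exact ⟨(T.lowerPart V Γ).elem (V.act hpq a x) (V.act_mem_generatedBy hr _ _ _),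
    GMod.act_mem_generatedBy _ hr hpq a ((T.lowerPart V Γ).elem x (V.mem_generatedBy hr x)), rfl⟩

/-- All modules `V_Γ`, for finite lower sets `Γ`, have flags. -/
def LayerTest.HasAscendingFlag (V : GMod A) : Prop :=
  ∀ Γ : Set Λ, IsLowerSet Γ → Γ.Finite → Weights.HasFlag C.layer (T.lowerPart V Γ).toGMod

theorem LayerTest.ext_of_layer {U : GMod A} (hU : C.layer l U) {m : Λ} {N : GMod (T.algAt A m)}
    (hN : C.test N) (n : ℕ) : Subsingleton (Abelian.Ext U (T.costandardize N) (n + 1)) := by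
  obtain ⟨M, hM, -, -, ⟨e⟩⟩ := hU
  exact GMod.ext_of_iso e (C.ext_of_good hM hN n)

/-- For a fixed weight m the set Γ = {≤ m} suffices: V_Γ has a finite flag with acyclic layers, and
V/V_Γ has no weights ≤ m, hence no Ext into weight m. -/
theorem LayerTest.ext_of_hasAscendingFlag {V : GMod A} (hV : C.HasAscendingFlag V) {m : Λ}
    {N : GMod (T.algAt A m)} (hN : C.test N) (n : ℕ) :
    Subsingleton (Abelian.Ext V (T.costandardize N) (n + 1)) :=
  (GMod.Sub.ses_proj (T.lowerPart V (Set.Iic m))).ext_mid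
    ((hV _ (isLowerSet_Iic m) (T.lowerFinite m)).ext fun _ _ hU => C.ext_of_layer hU hN n)
    (T.ext_costd_eq_zero (isLowerSet_Iic m) (T.lowerFinite m) (Set.mem_Iic.2 le_rfl) N _
      fun _ hr n => T.quot_subsingleton V hr n)

theorem LayerTest.isLayer_of_extOne (hA : A.FiniteBelow) {V : GMod A} (hfin : V.LocallyFinite)
    (hbdd : V.BoundedBelow) (hV : C.ExtOne Set.univ V) {Γ : Set Λ} (hΓ : IsLowerSet Γ)
    (hf : Γ.Finite) (hins : IsLowerSet (insert l Γ)) : C.layer l (T.layer V Γ (insert l Γ)) := by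
  obtain ⟨h1, h2⟩ := C.layer_of_extOne hA hfin hbdd hV hΓ hf (Iio_subset_of_insert hins) hins
  exact ⟨_, h1, T.weightSpace_locallyFinite _ (T.layer_locallyFinite hfin _ _),
    T.weightSpace_boundedBelow _ (T.layer_boundedBelow hbdd _ _),
    ⟨(GMod.isoOfBijective _ h2).symm⟩⟩

/-- The recognition of layers is applied to V_Γ, which inherits vanishing of Ext¹, rather than to V.
The flag then consists of submodules of V_Γ. -/
theorem LayerTest.hasAscendingFlag_of_extOne (hA : A.FiniteBelow) {V : GMod A}
    (hfin : V.LocallyFinite) (hbdd : V.BoundedBelow) (hV : C.ExtOne Set.univ V) :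
    C.HasAscendingFlag V := fun Γ hΓ hf =>
  Weights.hasFlag_of_family (T.lowerPart (T.lowerPart V Γ).toGMod) (T.lowerPart_mono _)
    (T.lowerPart_piece_empty _) hΓ hf (T.lowerPart_lowerPart V Γ) fun Γ' l hΓ' _ hins hsub =>
      C.isLayer_of_extOne hA (hfin.of_injective (T.lowerPart V Γ).incl fun _ _ =>
        Subtype.val_injective) (hbdd.of_injective (T.lowerPart V Γ).incl fun _ _ =>
        Subtype.val_injective) (C.extOne_lowerPart hA hfin hbdd hV hΓ hf) hΓ'
        (hf.subset ((Set.subset_insert l Γ').trans hsub)) hins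

end TriangularBasis

/-! ### Idempotent truncation to a finite lower set -/

namespace GMod

variable {A : LUGAlg k I} {V W : GMod A} (J : Set I)

/-- Truncation of a homomorphism. -/
def truncateMap (f : V ⟶ W) : V.truncate J ⟶ W.truncate J :=
  Hom.mk (fun i n => f.app i n) fun h a v => f.app_act h a v

theorem SES.truncate {X Y Z : GMod A} {f : X ⟶ Y} {g : Y ⟶ Z} (h : SES f g) :
    SES (truncateMap J f) (truncateMap J g) where
  inj i n := h.inj i n
  surj i n := h.surj i n
  zero i n x := h.zero i n x
  exact i n y hy := h.exact i n y hy

/-- Truncation of a graded submodule. -/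
def Sub.truncate (N : V.Sub) : (V.truncate J).Sub where
  piece i n := N.piece i n
  act_mem h a v hv := N.act_mem h a v hv

/-- Truncation of a subquotient. -/
def Sub.truncateSubquot (N M : V.Sub) :
    (N.truncate J).subquot (M.truncate J) ≅ (N.subquot M).truncate J :=
  isoOfBijective (Hom.mk (fun i n => LinearMap.id (M := (N.subquot M).piece i n))
    fun {i j d n m} h a v => by
      obtain ⟨v, rfl⟩ := Submodule.mkQ_surjective _ v
      rfl) fun _ _ => Function.bijective_id

end GMod

namespace TriangularBasis

variable {A : LUGAlg k I} {Λ : Type v} [PartialOrder Λ] (T : TriangularBasis A Λ) {Γ : Set Λ}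

/-- The triples of the truncation to a lower set. -/
def cornerTriple (hΓ : IsLowerSet Γ) (i j : T.indices Γ) (d : ℤ) :
    BasisTriple (A.corner (T.indices Γ)) (S := Set.univ)
      (fun i s => T.X i ⟨s.1.1, s.1.2.1⟩) (fun s t => T.H ⟨s.1.1, s.1.2.1⟩ ⟨t.1.1, t.1.2.1⟩)
      (fun t j => T.Y ⟨t.1.1, t.1.2.1⟩ j) i j d ≃ T.Triple i j d where
  toFun q := ⟨⟨q.s.1.1, q.s.1.2.1⟩, ⟨q.t.1.1, q.t.1.2.1⟩, q.x, q.h, q.y, q.deg_eq⟩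
  invFun q := ⟨⟨⟨q.s.1, q.s.2, hΓ (T.X_dot_le i.2.1 q.x) i.2.2⟩, trivial⟩,
    ⟨⟨q.t.1, q.t.2, hΓ (T.Y_dot_le j.2.1 q.y) j.2.2⟩, trivial⟩, q.x, q.h, q.y, q.deg_eq⟩
  left_inv _ := rfl
  right_inv _ := rfl

/-- The triangular basis of the truncation to a lower set. -/
def corner (hΓ : IsLowerSet Γ) : TriangularBasis (A.corner (T.indices Γ)) Γ where
  toWeights := T.restrict Γ
  lowerFinite m := (T.lowerFinite m.1).preimage Subtype.val_injective.injOn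
  finite_fibers m := by
    have := T.finite_fibers m.1
    refine Set.Finite.of_finite_image (f := fun s : (T.restrict Γ).S =>
      (⟨s.1.1, s.1.2.1⟩ : T.S)) (this.subset ?_) ?_
    · rintro _ ⟨s, hs, rfl⟩
      exact congrArg Subtype.val hs
    · intro s _ t _ h
      exact Subtype.ext (Subtype.ext (congrArg (fun z : T.S => z.1) h))
  X i s := T.X i ⟨s.1.1, s.1.2.1⟩
  H s t := T.H ⟨s.1.1, s.1.2.1⟩ ⟨t.1.1, t.1.2.1⟩
  Y t j := T.Y ⟨t.1.1, t.1.2.1⟩ j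
  basis i j d := by
    refine ⟨(T.basis i j d).1.comp (T.cornerTriple hΓ i j d) (T.cornerTriple hΓ i j d).injective,
      ?_⟩
    rw [← (T.basis i j d).2]
    exact congrArg _ ((T.cornerTriple hΓ i j d).surjective.range_comp
      fun q : T.Triple i j d => q.product)
  X_self s := T.X_self ⟨s.1.1, s.1.2.1⟩
  Y_self s := T.Y_self ⟨s.1.1, s.1.2.1⟩
  X_lt s t hst h := T.X_lt ⟨s.1.1, s.1.2.1⟩ ⟨t.1.1, t.1.2.1⟩
    (fun he => hst (Subtype.ext (Subtype.ext (congrArg (fun z : T.S => z.1) he)))) h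
  H_eq s t hst h := Subtype.ext (T.H_eq ⟨s.1.1, s.1.2.1⟩ ⟨t.1.1, t.1.2.1⟩
    (fun he => hst (Subtype.ext (Subtype.ext (congrArg (fun z : T.S => z.1) he)))) h)
  Y_lt s t hst h := T.Y_lt ⟨s.1.1, s.1.2.1⟩ ⟨t.1.1, t.1.2.1⟩
    (fun he => hst (Subtype.ext (Subtype.ext (congrArg (fun z : T.S => z.1) he)))) h
  finite_special i hi := absurd trivial hi

section transport

theorem mem_restrict_indices {Γ' : Set Γ} {r : T.indices Γ} :
    r ∈ (T.restrict Γ).indices Γ' ↔ r.1 ∈ T.indices (Subtype.val '' Γ') := by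
  constructor
  · rintro ⟨_, h⟩
    exact ⟨r.2.1, _, h, rfl⟩
  · rintro ⟨h, m, hm, he⟩
    refine ⟨trivial, ?_⟩
    have : (T.restrict Γ).dot ⟨r, trivial⟩ = m := Subtype.ext he.symm
    rwa [this]

theorem corner_idealOf (Γ' : Set Γ) (i j : T.indices Γ) (d : ℤ) :
    ((A.corner (T.indices Γ)).idealOf ((T.restrict Γ).indices Γ')).piece i j d =
      (A.idealOf (T.indices (Subtype.val '' Γ'))).piece i j d := by
  refine le_antisymm (Submodule.span_mono ?_) (Submodule.span_mono ?_)
  · rintro _ ⟨s, hs, m, n, h, a, b, rfl⟩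
    exact ⟨s, T.mem_restrict_indices.1 hs, m, n, h, a, b, rfl⟩
  · rintro _ ⟨s, hs, m, n, h, a, b, rfl⟩
    have hs' : s ∈ T.indices Γ := T.indices_mono (by rintro _ ⟨x, -, rfl⟩; exact x.2) hs
    exact ⟨⟨s, hs'⟩, T.mem_restrict_indices.2 hs, m, n, h, a, b, rfl⟩

variable (m : Γ)

theorem corner_geIdeal_le (i j : T.indices Γ) (d : ℤ) :
    ((T.restrict Γ).geIdeal (A.corner (T.indices Γ)) m).piece i j d ≤
      (T.geIdeal A m.1).piece i j d := by
  rw [Weights.geIdeal, corner_idealOf]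
  refine A.idealOf_mono (T.indices_mono ?_) i j d
  rintro _ ⟨x, hx, rfl⟩
  exact hx

/-- With `corner_geIdeal_le` this squeezes the defining ideal of the truncation between the ideal of
weights < m and the one for A. Next to weight m the outer two agree, so the truncation has the same
algebra A_m. -/
theorem idealOf_Iio_le_corner (hΓ : IsLowerSet Γ) (i j : T.indices Γ) (d : ℤ) :
    (A.idealOf (T.indices (Set.Iio m.1))).piece i j d ≤
      ((T.restrict Γ).geIdeal (A.corner (T.indices Γ)) m).piece i j d := by
  rw [Weights.geIdeal, corner_idealOf]
  exact A.idealOf_mono (T.indices_mono (Γ := Set.Iio m.1)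
    (Γ' := Subtype.val '' {μ : Γ | ¬ m ≤ μ}) fun x hx => ⟨⟨x, hΓ (le_of_lt hx) m.2⟩,
    not_le_of_gt hx, rfl⟩) i j d

variable {m}

/-- An idempotent of the truncation, as an idempotent of the original algebra. -/
abbrev up (s : (T.restrict Γ).indices {m}) : T.indices {m.1} :=
  ⟨s.1.1, s.1.2.1, congrArg Subtype.val s.2.2⟩

/-- An idempotent of weight in `Γ`, as an idempotent of the truncation. -/
abbrev down (s : T.indices {m.1}) : (T.restrict Γ).indices {m} :=
  ⟨⟨s.1, s.2.1, (show T.dot ⟨s.1, s.2.1⟩ = m.1 from s.2.2).symm ▸ m.2⟩, trivial,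
    Subtype.ext s.2.2⟩

/-- A module over `A_l`, as a module over the corresponding algebra for the truncation. -/
def toCorner (M : GMod (T.algAt A m.1)) :
    GMod ((T.restrict Γ).algAt (A.corner (T.indices Γ)) m) where
  piece s n := M.piece (T.up s) n
  act {s t d n p} h := Submodule.liftQ (((T.restrict Γ).geIdeal _ m).piece s.1 t.1 d)
    ((M.act h).comp (T.bar (T.up s) (T.up t) d)) fun a ha => by
      have : T.bar (T.up s) (T.up t) d a = 0 :=
        T.toGE_eq_zero.2 (T.corner_geIdeal_le m s.1 t.1 d ha)
      change M.act h (T.bar (T.up s) (T.up t) d a) = 0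
      rw [this, map_zero]
  one_act {s n} h v := M.one_act (i := T.up s) h v
  mul_act {r s t _ _ _ _ _ _} h₁ h₂ h₃ h₄ a b v := by
    obtain ⟨a, rfl⟩ := Weights.bar_surjective _ _ _ _ a
    obtain ⟨b, rfl⟩ := Weights.bar_surjective _ _ _ _ b
    exact M.mul_act h₁ h₂ h₃ h₄ (T.bar (T.up r) (T.up s) _ a) (T.bar (T.up s) (T.up t) _ b) v

/-- A module over the algebra of weight `m` of the truncation, as a module over `A_m`. -/
def ofCorner (hΓ : IsLowerSet Γ)
    (M : GMod ((T.restrict Γ).algAt (A.corner (T.indices Γ)) m)) : GMod (T.algAt A m.1) where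
  piece s n := M.piece (T.down s) n
  act {s t d n p} h := Submodule.liftQ ((T.geIdeal A m.1).piece s.1 t.1 d)
    ((M.act h).comp ((T.restrict Γ).bar (A := A.corner (T.indices Γ)) (T.down s) (T.down t) d))
    fun a ha => by
      have : (T.restrict Γ).bar (A := A.corner (T.indices Γ)) (T.down s) (T.down t) d a = 0 :=
        Weights.toGE_eq_zero _ |>.2 (T.idealOf_Iio_le_corner m hΓ (T.down s).1 (T.down t).1 d
          (T.geIdeal_le_left s.2 _ d ha))
      change M.act h ((T.restrict Γ).bar (A := A.corner (T.indices Γ)) (T.down s) (T.down t) d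
        a) = 0
      rw [this, map_zero]
  one_act {s n} h v := M.one_act (i := T.down s) h v
  mul_act {r s t _ _ _ _ _ _} h₁ h₂ h₃ h₄ a b v := by
    obtain ⟨a, rfl⟩ := Weights.bar_surjective _ _ _ _ a
    obtain ⟨b, rfl⟩ := Weights.bar_surjective _ _ _ _ b
    exact M.mul_act h₁ h₂ h₃ h₄
      ((T.restrict Γ).bar (A := A.corner (T.indices Γ)) (T.down r) (T.down s) _ a)
      ((T.restrict Γ).bar (A := A.corner (T.indices Γ)) (T.down s) (T.down t) _ b) v

variable {M : GMod (T.algAt A m.1)} {X Y : GMod ((T.restrict Γ).algAt (A.corner (T.indices Γ)) m)}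
  (hΓ : IsLowerSet Γ)

/-- Transport of homomorphisms. -/
def ofCornerMap (f : X ⟶ Y) : T.ofCorner hΓ X ⟶ T.ofCorner hΓ Y :=
  GMod.Hom.mk (fun s n => f.app (T.down s) n) fun h a v => by
    obtain ⟨a, rfl⟩ := T.bar_surjective _ _ _ a
    exact f.app_act h _ v

/-- Transport of homomorphisms. -/
def fromToCorner (f : T.toCorner M ⟶ X) : M ⟶ T.ofCorner hΓ X :=
  GMod.Hom.mk (fun s n => f.app (T.down s) n) fun {s t d n p} h a v => by
    obtain ⟨a, rfl⟩ := T.bar_surjective _ _ _ a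
    exact f.app_act h ((T.restrict Γ).bar (A := A.corner (T.indices Γ)) (T.down s) (T.down t) d a) v

/-- Transport of homomorphisms. -/
def toOfCorner (f : M ⟶ T.ofCorner hΓ X) : T.toCorner M ⟶ X :=
  GMod.Hom.mk (fun s n => f.app (T.up s) n) fun {s t d n p} h a v => by
    obtain ⟨a, rfl⟩ := Weights.bar_surjective _ _ _ _ a
    exact f.app_act h (T.bar (T.up s) (T.up t) d a) v

/-- Transport of homomorphisms. -/
def intoToCorner (f : X ⟶ T.toCorner M) : T.ofCorner hΓ X ⟶ M :=
  GMod.Hom.mk (fun s n => f.app (T.down s) n) fun {s t d n p} h a v => by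
    obtain ⟨a, rfl⟩ := T.bar_surjective _ _ _ a
    exact f.app_act h ((T.restrict Γ).bar (A := A.corner (T.indices Γ)) (T.down s) (T.down t) d a) v

/-- Transport of homomorphisms. -/
def fromOfCorner (f : T.ofCorner hΓ X ⟶ M) : X ⟶ T.toCorner M :=
  GMod.Hom.mk (fun s n => f.app (T.up s) n) fun {s t d n p} h a v => by
    obtain ⟨a, rfl⟩ := Weights.bar_surjective _ _ _ _ a
    exact f.app_act h (T.bar (T.up s) (T.up t) d a) v

-- Modules over A_m and over its counterpart for the truncation have the same pieces and actions,
-- but over differently indexed algebras. Lifting problems are moved across by `toCorner` and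
-- `ofCorner`.
include hΓ in
theorem projective_toCorner (hM : Projective M) : Projective (T.toCorner M) where
  factors {E X} f e he := by
    have : Epi (T.ofCornerMap hΓ e) := GMod.epi_of_surjective _ fun s n =>
      GMod.surjective_of_epi e (T.down s) n
    let g := Projective.factorThru (T.fromToCorner hΓ f) (T.ofCornerMap hΓ e)
    have hg : g ≫ T.ofCornerMap hΓ e = T.fromToCorner hΓ f := Projective.factorThru_comp _ _
    exact ⟨T.toOfCorner hΓ g, GMod.hom_ext fun s n v =>
      congrArg (fun φ : M ⟶ T.ofCorner hΓ X => φ.app (T.up s) n v) hg⟩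

include hΓ in
theorem injective_toCorner (hM : Injective M) : Injective (T.toCorner M) where
  factors {X Y} f i hi := by
    have : Mono (T.ofCornerMap hΓ i) := GMod.mono_of_injective _ fun s n =>
      GMod.injective_of_mono i (T.down s) n
    let g := Injective.factorThru (T.intoToCorner hΓ f) (T.ofCornerMap hΓ i)
    have hg : T.ofCornerMap hΓ i ≫ g = T.intoToCorner hΓ f := Injective.comp_factorThru _ _
    exact ⟨T.fromOfCorner hΓ g, GMod.hom_ext fun s n v =>
      congrArg (fun φ : T.ofCorner hΓ X ⟶ M => φ.app (T.up s) n v) hg⟩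

end transport

/-! ### Truncation of standard modules -/

section standardize

variable {m : Γ} (hΓ : IsLowerSet Γ) (M : GMod (T.algAt A m.1))

theorem below_truncate {Q : GMod A} (hQ : T.Below m.1 Q) :
    (T.restrict Γ).Below m (Q.truncate (T.indices Γ)) := fun r hr n =>
  hQ r.1 (T.indices_mono (by rintro _ ⟨x, hx, rfl⟩; exact hx) (T.mem_restrict_indices.1 hr)) n

/-- The comparison map between standard modules of the truncation and truncated standard
modules. -/
def cornerStd : (T.corner hΓ).standardize (T.toCorner M) ⟶
    (T.standardize M).truncate (T.indices Γ) :=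
  (T.corner hΓ).stdDesc (M := T.toCorner M) (T.below_truncate (T.below_standardize M))
    (GMod.Hom.mk (fun s n => T.stdUnit M (T.up s) n) fun {s t d n p} h a v => by
      obtain ⟨a, rfl⟩ := Weights.bar_surjective _ _ _ _ a
      exact T.stdUnit_act M (s := T.up s) (t := T.up t) h a v)

theorem cornerStd_mk {i : T.indices Γ} {p q n : ℤ} (t : (T.restrict Γ).indices {m})
    (h : p + q = n) (a : A.piece i t.1 p) (v : M.piece (T.up t) q) :
    (T.cornerStd hΓ M).app i n ((T.restrict Γ).stdMk (A := A.corner (T.indices Γ))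
      (T.toCorner M) t h a v) = T.stdMk M (T.up t) h a v :=
  ((T.corner hΓ).stdDesc_mk (M := T.toCorner M) (T.below_truncate (T.below_standardize M))
    _ t h a v).trans (T.act_stdUnit M (t := T.up t) h a v)

/-- Both sides are generated by the same symbols a ⊗ v with the same relations, because the defining
ideals agree in the columns of weight m. -/
theorem cornerStd_bijective (i : T.indices Γ) (n : ℤ) :
    Function.Bijective ((T.cornerStd hΓ M).app i n) := by
  let r : (T.standardize M).piece i n →ₗ[k]
      ((T.corner hΓ).standardize (T.toCorner M)).piece i n := T.stdLift
    (fun t p q h => (T.restrict Γ).stdMk (A := A.corner (T.indices Γ)) (T.toCorner M)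
      (T.down t) h)
    (fun t p q h a ha => LinearMap.ext fun v => (T.restrict Γ).stdMk_eq_zero (T.toCorner M) h
      (T.idealOf_Iio_le_corner m hΓ i (T.down t).1 p (T.geIdeal_le_right t.2 _ p ha)) v)
    (fun s t p e q p' q' h₁ h₂ h₃ h₄ a b v => (T.restrict Γ).stdMk_mul
      (A := A.corner (T.indices Γ)) (T.toCorner M) (s := T.down s) (t := T.down t) h₁ h₂ h₃ h₄ a b v)
  refine ⟨Function.LeftInverse.injective (g := r) fun x => ?_, fun x => ?_⟩
  · induction x using Weights.std_induction with
    | hz => rw [map_zero]; exact map_zero r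
    | ha x y hx hy => rw [map_add]; exact (map_add r _ _).trans (congrArg₂ _ hx hy)
    | hp t p q h a v =>
      refine (congrArg r (T.cornerStd_mk hΓ M t h a v)).trans ?_
      exact T.stdLift_mk _ _ _ (T.up t) p q h a v
  · change ∃ y, _ = (x : (T.standardize M).piece i n)
    induction x using Weights.std_induction with
    | hz => exact ⟨0, map_zero _⟩
    | ha x y hx hy =>
      obtain ⟨x, rfl⟩ := hx
      obtain ⟨y, rfl⟩ := hy
      exact ⟨x + y, map_add _ _ _⟩
    | hp t p q h a v => exact ⟨_, T.cornerStd_mk hΓ M (T.down t) h a v⟩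

/-- Truncation of a module isomorphic to a standard module. -/
def truncateIso {V : GMod A} (e : V ≅ T.standardize M) :
    V.truncate (T.indices Γ) ≅ (T.restrict Γ).standardize (T.toCorner M) :=
  GMod.isoOfBijective (GMod.truncateMap _ e.hom) (fun i n => GMod.bijective_of_iso e i n) ≪≫
    (GMod.isoOfBijective _ (T.cornerStd_bijective hΓ M)).symm

end standardize

/-! ### Comparison of extension groups -/

/-- Ext¹(V, j_*N) is the obstruction to extending maps into j_*N from the kernel of the free cover
to the cover. Such maps see only weights ≤ m, all in Γ, so the extension can be carried out after
truncation. The truncated cover need not be projective for this. -/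
theorem ext_one_of_truncate (hΓ : IsLowerSet Γ) {m : Γ} (N : GMod (T.algAt A m.1)) (V : GMod A)
    (hV : Subsingleton (Abelian.Ext (V.truncate (T.indices Γ))
      ((T.corner hΓ).costandardize (T.toCorner N)) 1)) :
    Subsingleton (Abelian.Ext V (T.costandardize N) 1) := by
  have hses := GMod.ses_ker V.coverMap_surjective
  refine hses.ext_right_one (fun g => ?_) (GMod.ext_of_projective 0)
  have hIio : ∀ r ∈ (T.restrict Γ).indices (Set.Iio m), r.1 ∈ T.indices (Set.Iio m.1) :=
    fun r hr => T.indices_mono (by rintro _ ⟨x, hx, rfl⟩; exact hx) (T.mem_restrict_indices.1 hr)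
  obtain ⟨θ, hθ⟩ := (T.corner hΓ).exists_hom_costd (N := T.toCorner N)
    (W := (GMod.ker V.coverMap).toGMod.truncate (T.indices Γ))
    (fun s n => (T.ev N (T.up s) n).comp (g.app s.1 n))
    (fun s t d n p h a v => (congrArg (T.ev N (T.up s) p) (g.app_act h a v)).trans
      (T.ev_act_bar N (s := T.up s) (t := T.up t) h a _))
    (fun s r hr d n p h a v => by
      have := T.costd_subsingleton_of_lt N (hIio r hr) n
      refine (congrArg (T.ev N (T.up s) p) (g.app_act h a v)).trans ?_
      rw [Subsingleton.elim (g.app r.1 n v) 0, map_zero, map_zero]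
      rfl)
  obtain ⟨η, hη⟩ := (hses.truncate (T.indices Γ)).exists_extension hV θ
  -- The extension η exists only on the truncated cover. Its values at weight m define a map on the
  -- whole cover by the mapping property of j_*N.
  obtain ⟨f, hf⟩ := T.exists_hom_costd (N := N) (W := V.cover)
    (fun s n => ((T.corner hΓ).ev (T.toCorner N) (T.down s) n).comp (η.app (T.down s).1 n))
    (fun s t d n p h a v => (congrArg ((T.corner hΓ).ev (T.toCorner N) (T.down s) p)
      (η.app_act (i := (T.down s).1) (j := (T.down t).1) h a v)).trans
        ((T.corner hΓ).ev_act_bar (T.toCorner N) (s := T.down s) (t := T.down t) h a _))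
    (fun s r hr d n p h a v => by
      have hr' : r ∈ T.indices Γ := T.indices_mono (fun x hx => hΓ (le_of_lt hx) m.2) hr
      have hr'' : (⟨r, hr'⟩ : T.indices Γ) ∈ (T.restrict Γ).indices (Set.Iio m) :=
        T.mem_restrict_indices.2 (T.indices_mono (Γ := Set.Iio m.1)
          (Γ' := Subtype.val '' Set.Iio m) (fun x hx => ⟨⟨x, hΓ (le_of_lt hx) m.2⟩, hx, rfl⟩) hr)
      have := (T.corner hΓ).costd_subsingleton_of_lt (T.toCorner N) hr'' n
      refine (congrArg ((T.corner hΓ).ev (T.toCorner N) (T.down s) p)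
        (η.app_act (i := (T.down s).1) (j := ⟨r, hr'⟩) h a v)).trans ?_
      rw [Subsingleton.elim (η.app ⟨r, hr'⟩ n v) 0, map_zero, map_zero]
      rfl)
  refine ⟨f, T.hom_costd_ext fun s n v => ?_⟩
  refine (hf s n v.1).trans ?_
  refine (congrArg (fun φ : (GMod.ker V.coverMap).toGMod.truncate (T.indices Γ) ⟶
    (T.corner hΓ).costandardize (T.toCorner N) => (T.corner hΓ).ev (T.toCorner N) (T.down s) n
      (φ.app (T.down s).1 n v)) hη).trans ?_
  exact hθ (T.down s) n v

/-- The truncation of a module with layers as subquotients has a flag. -/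
theorem LayerTest.hasFlag_truncate {T : TriangularBasis A Λ} (C : T.LayerTest)
    (hA : A.FiniteBelow) {V : GMod A} (hfin : V.LocallyFinite) (hbdd : V.BoundedBelow)
    (hV : C.ExtOne Set.univ V) (hΓ : IsLowerSet Γ) (hf : Γ.Finite)
    {layer : Γ → GMod (A.corner (T.indices Γ)) → Prop}
    (hlayer : ∀ (m : Γ) (M : GMod (T.algAt A m.1)), C.good M → M.LocallyFinite → M.BoundedBelow →
      ∀ U, Nonempty (U ≅ (T.restrict Γ).standardize (T.toCorner M)) → layer m U) :
    Weights.HasFlag layer (V.truncate (T.indices Γ)) := by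
  have := hf.to_subtype
  -- The flag of the truncation is the truncated filtration V_{Γ'} for Γ' ⊆ Γ. It exhausts it
  -- because every idempotent of the truncation has weight in Γ.
  refine Weights.hasFlag_of_family (fun Γ' : Set Γ =>
    (T.lowerPart V (Subtype.val '' Γ')).truncate (T.indices Γ))
    (fun h i n => T.lowerPart_mono V (Set.image_mono h) i n) (fun i n => ?_) isLowerSet_univ
    Set.finite_univ (fun i n => ?_) fun Γ' m hΓ' _ hins _ => ?_
  · change (T.lowerPart V (Subtype.val '' ∅)).piece i n = ⊥
    rw [Set.image_empty, lowerPart_piece_empty]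
  · refine eq_top_iff.2 fun v _ => ?_
    exact V.mem_generatedBy (T.indices_mono (Γ := Γ) (Γ' := Subtype.val '' Set.univ) (fun x hx => ⟨⟨x, hx⟩, trivial, rfl⟩) i.2) v
  · have himage : ∀ Γ' : Set Γ, IsLowerSet Γ' → IsLowerSet (Subtype.val '' Γ') := by
      rintro Γ' hΓ' _ b hba ⟨a, ha, rfl⟩
      exact ⟨⟨b, hΓ hba a.2⟩, hΓ' hba ha, rfl⟩
    have hins' : IsLowerSet (insert m.1 (Subtype.val '' Γ')) := by
      rw [← Set.image_insert_eq]
      exact himage _ hins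
    obtain ⟨M, hM, hM₁, hM₂, ⟨e⟩⟩ := C.isLayer_of_extOne hA hfin hbdd hV (himage Γ' hΓ')
      (hf.subset (by rintro _ ⟨x, -, rfl⟩; exact x.2)) hins'
    refine hlayer m M hM hM₁ hM₂ _ ⟨?_⟩
    rw [Set.image_insert_eq]
    exact GMod.Sub.truncateSubquot _ _ _ ≪≫ T.truncateIso hΓ M e

end TriangularBasis

/-! ### Degree shifts -/

namespace GMod

variable {A : LUGAlg k I} {V W X Y E : GMod A}

/-- Pieces in degrees n and n + d + -d are different types. The action of 1ᵢ, viewed as a map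
between them, serves as the transport, and this lemma and the next two make it cancel. -/
theorem act_one_act {i j : I} {d n n' m : ℤ} (h : d + n' = m) (h' : 0 + n = n') (h'' : d + n = m)
    (a : A.piece i j d) (v : V.piece j n) :
    V.act h a (V.act h' (A.one j) v) = V.act h'' a v := by
  rw [← V.mul_act (add_zero d) h'' h' h, A.mul_one]

theorem one_act_act {i j : I} {d n m m' : ℤ} (h : 0 + m = m') (h' : d + n = m) (h'' : d + n = m')
    (a : A.piece i j d) (v : V.piece j n) :
    V.act h (A.one i) (V.act h' a v) = V.act h'' a v := by
  rw [← V.mul_act (zero_add d) h'' h' h, A.one_mul]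

theorem one_act_one_act {i : I} {n m : ℤ} (h : 0 + m = n) (h' : 0 + n = m) (v : V.piece i n) :
    V.act h (A.one i) (V.act h' (A.one i) v) = v := by
  rw [one_act_act h h' (zero_add n), V.one_act]

/-- Homomorphisms to a shifted module, as homomorphisms from a shifted module. -/
def unshiftHom (d : ℤ) (g : X ⟶ E.shift d) : X.shift (-d) ⟶ E :=
  Hom.mk (fun i n => (E.act (show 0 + (n + -d + d) = n by omega) (A.one i)).comp
    (g.app i (n + -d))) fun {i j e n m} h a v => by
      have h1 : g.app i (m + -d) ((X.shift (-d)).act h a v) =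
          E.act (show e + (n + -d + d) = m + -d + d by omega) a (g.app j (n + -d) v) :=
        g.app_act (show e + (n + -d) = m + -d by omega) a v
      refine (congrArg (E.act _ (A.one i)) h1).trans ?_
      refine (one_act_act _ _ (by omega) a _).trans ?_
      exact (act_one_act h _ _ a _).symm

/-- Homomorphisms from a shifted module, as homomorphisms to a shifted module. -/
def shiftHom (d : ℤ) (f : Y.shift (-d) ⟶ E) : Y ⟶ E.shift d :=
  Hom.mk (fun i n => (f.app i (n + d)).comp
    (Y.act (show 0 + n = n + d + -d by omega) (A.one i))) fun {i j e n m} h a v => by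
      have h1 : Y.act (show 0 + m = m + d + -d by omega) (A.one i) (Y.act h a v) =
          Y.act (show e + (n + d + -d) = m + d + -d by omega) a
            (Y.act (show 0 + n = n + d + -d by omega) (A.one j) v) :=
        (one_act_act _ _ (by omega) a _).trans (act_one_act _ _ (by omega) a _).symm
      refine (congrArg (f.app i (m + d)) h1).trans ?_
      exact f.app_act (show e + (n + d) = m + d by omega) a _

theorem shiftHom_app (d : ℤ) (f : Y.shift (-d) ⟶ E) (i : I) (n : ℤ) (v : Y.piece i n) :
    (shiftHom d f).app i n v =
      f.app i (n + d) (Y.act (show 0 + n = n + d + -d by omega) (A.one i) v) := rfl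

/-- The shift of a homomorphism. -/
def shiftMap (d : ℤ) (f : V ⟶ W) : V.shift d ⟶ W.shift d :=
  Hom.mk (fun i n => f.app i (n + d)) fun _ a v => f.app_act _ a v

theorem injective_shift (d : ℤ) (hE : Injective E) : Injective (E.shift d) where
  factors {X Y} g f hf := by
    have : Mono (shiftMap (-d) f) := mono_of_injective _ fun i n => injective_of_mono f i _
    let u := Injective.factorThru (unshiftHom d g) (shiftMap (-d) f)
    have hu : shiftMap (-d) f ≫ u = unshiftHom d g := Injective.comp_factorThru _ _
    refine ⟨shiftHom d u, hom_ext fun i n v => ?_⟩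
    have h1 := f.app_act (show 0 + n = n + d + -d by omega) (A.one i) v
    rw [comp_app, shiftHom_app, ← h1]
    refine (congrArg (fun φ : X.shift (-d) ⟶ E => φ.app i (n + d)
      (X.act (show 0 + n = n + d + -d by omega) (A.one i) v)) hu).trans ?_
    have h2 : g.app i (n + d + -d) (X.act (show 0 + n = n + d + -d by omega) (A.one i) v) =
        E.act (show 0 + (n + d) = n + d + -d + d by omega) (A.one i) (g.app i n v) :=
      g.app_act _ _ _
    refine (congrArg (E.act (show 0 + (n + d + -d + d) = n + d by omega) (A.one i)) h2).trans ?_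
    exact one_act_one_act _ _ _

/-! ### Homomorphisms of arbitrary degree -/

/-- A homomorphism of degree `d`, as a homomorphism to the shifted module. -/
def homDegToHom {d : ℤ} (f : homDeg V W d) : V ⟶ W.shift d :=
  Hom.mk f.1 fun h a v => f.2 _ _ _ _ _ h a v

/-- A homomorphism to the shifted module, as a homomorphism of degree `d`. -/
def homDegOfHom {d : ℤ} (g : V ⟶ W.shift d) : homDeg V W d :=
  ⟨g.app, fun _ _ _ _ _ h a v => g.app_act h a v⟩

theorem homDegToHom_injective {d : ℤ} : Function.Injective (homDegToHom (V := V) (W := W) (d := d)) :=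
  fun _ _ h => Subtype.ext (congrArg Hom.app h)

/-- Composition of homomorphisms of arbitrary degree with a homomorphism of degree zero. -/
def homDegPrecomp (φ : X ⟶ V) (W : GMod A) (d : ℤ) : homDeg V W d →ₗ[k] homDeg X W d where
  toFun f := ⟨fun i n => (f.1 i n).comp (φ.app i n), fun i j e n m h a v => by
    rw [LinearMap.comp_apply, φ.app_act, f.2 i j e n m h a]
    rfl⟩
  map_add' _ _ := rfl
  map_smul' _ _ := rfl

theorem subsingleton_homDeg {d : ℤ} (h : ∀ f : V ⟶ W.shift d, f = 0) :
    Subsingleton (homDeg V W d) :=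
  subsingleton_of_forall_eq (homDegOfHom 0) fun _ => homDegToHom_injective (h _)

theorem homSeries_eq_of_precomp (φ : X ⟶ V)
    (hinj : ∀ d, ∀ f g : V ⟶ W.shift d, φ ≫ f = φ ≫ g → f = g)
    (hsurj : ∀ d, ∀ f : X ⟶ W.shift d, ∃ g, φ ≫ g = f) :
    X.homSeries W = V.homSeries W := by
  funext d
  refine (LinearEquiv.finrank_eq (LinearEquiv.ofBijective (homDegPrecomp φ W d) ⟨?_, ?_⟩)).symm
  · intro f g hfg
    exact homDegToHom_injective (hinj d _ _ (congrArg homDegToHom hfg))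
  · intro f
    obtain ⟨g, hg⟩ := hsurj d (homDegToHom f)
    exact ⟨homDegOfHom g, homDegToHom_injective hg⟩

theorem homSeries_eq_zero (h : ∀ d, ∀ f : V ⟶ W.shift d, f = 0) : V.homSeries W = 0 := by
  funext d
  have := subsingleton_homDeg (h d)
  exact Module.finrank_zero_of_subsingleton

/-- `V` is bounded above: the pieces vanish in all large degrees. -/
def BoundedAbove (V : GMod A) : Prop := ∀ i, ∃ N : ℤ, ∀ n > N, Subsingleton (V.piece i n)

theorem BoundedAbove.of_injective (hW : W.BoundedAbove) (f : V ⟶ W)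
    (hf : ∀ i n, Function.Injective (f.app i n)) : V.BoundedAbove := fun i =>
  let ⟨N, hN⟩ := hW i
  ⟨N, fun n hn => have := hN n hn; (hf i n).subsingleton⟩

/-! ### Finiteness of injective hulls of simple modules -/

theorem Sub.eq_bot_or_top_of_simple (hV : Simple V) (N : V.Sub) :
    (∀ i n, N.piece i n = ⊥) ∨ ∀ i n, N.piece i n = ⊤ := by
  by_cases h : N.incl = 0
  · refine Or.inl fun i n => eq_bot_iff.2 fun v hv => ?_
    have := N.incl_elem v hv
    rw [h] at this
    exact (Submodule.mem_bot k).2 this.symm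
  · have := isIso_of_mono_of_nonzero h
    refine Or.inr fun i n => eq_top_iff.2 fun v _ => ?_
    obtain ⟨w, rfl⟩ := surjective_of_epi N.incl i n v
    exact w.2

theorem exists_ne_zero_of_simple (hV : Simple V) : ∃ (i : I) (n : ℤ) (x : V.piece i n), x ≠ 0 := by
  by_contra! h
  exact id_nonzero V (eq_zero_of_app h)

/-- Choose a functional φ that is nonzero at a vector of L. The vectors v with φ(Av) = 0 form a
submodule meeting L trivially, since L is simple, hence zero, since L is essential. So v ↦ φ(–v)
embeds E in the dual of a row of A. -/
theorem exists_pairing_of_isInjectiveHull {L E : GMod A} (hL : Simple L) {ι : L ⟶ E}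
    (hι : IsInjectiveHull ι) : ∃ (s : I) (p : ℤ), ∀ (t : I) (n e : ℤ), e + n = p →
      ∃ f : E.piece t n →ₗ[k] Module.Dual k (A.piece s t e), Function.Injective f := by
  obtain ⟨-, hmono, hess⟩ := hι
  obtain ⟨s, p, x, hx⟩ := exists_ne_zero_of_simple hL
  have hιx : ι.app s p x ≠ 0 := fun h => hx (injective_of_mono ι s p (h.trans (map_zero _).symm))
  obtain ⟨φ, hφ⟩ := Module.Projective.exists_dual_ne_zero k hιx
  -- The functional φ lives on a single piece, at s and degree p, so only those a that send v into
  -- this piece are tested.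
  let K : E.Sub :=
    { piece := fun t n =>
        { carrier := {v | ∀ (e : ℤ) (h : e + n = p) (a : A.piece s t e), φ (E.act h a v) = 0}
          add_mem' := fun hv hw e h a => by rw [map_add, map_add, hv e h a, hw e h a, add_zero]
          zero_mem' := fun e h a => by rw [map_zero, map_zero]
          smul_mem' := fun c v hv e h a => by rw [map_smul, map_smul, hv e h a, smul_zero] }
      act_mem := fun {i j d n m} h c v hv e h' a => by
        rw [← E.mul_act rfl (show e + d + n = p by omega) h h']
        exact hv _ _ _ }
  have hKL : ∀ t n, (Sub.comap ι K).piece t n = ⊥ := by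
    refine (Sub.eq_bot_or_top_of_simple hL _).resolve_right fun htop => hφ ?_
    have hx' : x ∈ (Sub.comap ι K).piece s p := (htop s p).ge Submodule.mem_top
    have := hx' 0 (zero_add p) (A.one s)
    rwa [E.one_act] at this
  have hK : ∀ t n, K.piece t n = ⊥ := hess K fun t n => by
    rw [eq_bot_iff]
    rintro _ ⟨hv, y, rfl⟩
    have hy : y ∈ (Sub.comap ι K).piece t n := hv
    rw [hKL] at hy
    rw [(Submodule.mem_bot k).1 hy, map_zero]
    exact zero_mem _
  refine ⟨s, p, fun t n e h => ⟨(E.act h).flip.compr₂ φ, ?_⟩⟩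
  rw [injective_iff_map_eq_zero]
  intro v hv
  have hvK : v ∈ K.piece t n := fun e' h' a => by
    obtain rfl : e = e' := by omega
    exact LinearMap.congr_fun hv a
  rw [hK] at hvK
  exact (Submodule.mem_bot k).1 hvK

theorem locallyFinite_of_isInjectiveHull (hA : A.FiniteBelow) {L E : GMod A} (hL : Simple L)
    {ι : L ⟶ E} (hι : IsInjectiveHull ι) : E.LocallyFinite ∧ E.BoundedAbove := by
  obtain ⟨s, p, h⟩ := exists_pairing_of_isInjectiveHull hL hι
  refine ⟨fun t n => ?_, fun t => ?_⟩
  · obtain ⟨f, hf⟩ := h t n (p - n) (by omega)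
    have := hA.1 s t (p - n)
    exact FiniteDimensional.of_injective f hf
  · obtain ⟨N, hN⟩ := hA.2 s t
    refine ⟨p - N, fun n hn => ?_⟩
    obtain ⟨f, hf⟩ := h t n (p - n) (by omega)
    have := hN (p - n) (by omega)
    exact hf.subsingleton

end GMod

-- Degree shifts of costandard modules and multiplicity series

namespace TriangularBasis

variable {A : LUGAlg k I} {Λ : Type v} [PartialOrder Λ] (T : TriangularBasis A Λ) {l : Λ}
  (N : GMod (T.algAt A l))

theorem exists_costd_shift_hom (d : ℤ) :
    ∃ f : (T.costandardize N).shift d ⟶ T.costandardize (N.shift d),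
      ∀ (s : T.indices {l}) n (v : (T.costandardize N).piece s (n + d)),
        T.ev (N.shift d) s n (f.app s n v) = T.ev N s (n + d) v :=
  T.exists_hom_costd (N := N.shift d) (W := (T.costandardize N).shift d)
    (fun s n => T.ev N s (n + d))
    (fun s t e n m h a v => T.ev_act_bar N (show e + (n + d) = m + d by omega) a v)
    (fun s r hr e n m h a v => by
      have := T.costd_subsingleton_of_lt N hr (n + d)
      have hv : v = 0 := Subsingleton.elim (α := (T.costandardize N).piece r (n + d)) _ _
      rw [hv, map_zero]
      exact map_zero _)

theorem nonempty_costd_shift_iso (d : ℤ) :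
    ∃ e : (T.costandardize N).shift d ≅ T.costandardize (N.shift d),
      ∀ (s : T.indices {l}) n (v : (T.costandardize N).piece s (n + d)),
        T.ev (N.shift d) s n (e.hom.app s n v) = T.ev N s (n + d) v := by
  obtain ⟨f, hf⟩ := T.exists_costd_shift_hom N d
  obtain ⟨g, hg⟩ := T.exists_hom_costd (N := N)
    (W := (T.costandardize (N.shift d)).shift (-d))
    (fun s n => (N.act (show 0 + (n + -d + d) = n by omega) ((T.algAt A l).one s)).comp
      (T.ev (N.shift d) s (n + -d)))
    (fun s t e n m h a v => by
      have h1 : T.ev (N.shift d) s (m + -d)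
          (((T.costandardize (N.shift d)).shift (-d)).act h a v) =
          N.act (show e + (n + -d + d) = m + -d + d by omega) (T.bar s t e a)
            (T.ev (N.shift d) t (n + -d) v) :=
        T.ev_act_bar (N.shift d) (show e + (n + -d) = m + -d by omega) a v
      refine (congrArg (N.act _ ((T.algAt A l).one s)) h1).trans ?_
      refine (GMod.one_act_act _ _ (by omega) _ _).trans ?_
      exact (GMod.act_one_act h _ _ _ _).symm)
    (fun s r hr e n m h a v => by
      have := T.costd_subsingleton_of_lt (N.shift d) hr (n + -d)
      have hv : v = 0 :=
        Subsingleton.elim (α := (T.costandardize (N.shift d)).piece r (n + -d)) _ _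
      rw [hv, map_zero]
      exact map_zero _)
  -- A right inverse gives surjectivity of f. Injectivity comes separately from `costd_eq_zero`,
  -- since f commutes with evaluation.
  have h1 : GMod.shiftHom d g ≫ f = 𝟙 _ := T.hom_costd_ext fun s n v => by
    refine (hf s n ((GMod.shiftHom d g).app s n v)).trans ((hg s (n + d) _).trans ?_)
    have h2 : T.ev (N.shift d) s (n + d + -d) ((T.costandardize (N.shift d)).act
        (show 0 + n = n + d + -d by omega) (A.one s) v) =
        N.act (show 0 + (n + d) = n + d + -d + d by omega) ((T.algAt A l).one s)
          (T.ev (N.shift d) s n v) := T.ev_act_bar (N.shift d) _ (A.one s) v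
    refine (congrArg (N.act _ ((T.algAt A l).one s)) h2).trans ?_
    exact GMod.one_act_one_act _ _ _
  refine ⟨GMod.isoOfBijective f fun i n => ⟨?_, fun y => ?_⟩, hf⟩
  · rw [injective_iff_map_eq_zero]
    intro y hy
    refine T.costd_eq_zero N fun s p m hp a => ?_
    obtain ⟨m, rfl⟩ : ∃ m', m = m' + d := ⟨m - d, by omega⟩
    have h2 := hf s m (((T.costandardize N).shift d).act (show p + n = m by omega) a y)
    rw [f.app_act, hy, map_zero, map_zero] at h2
    exact h2.symm
  · exact ⟨(GMod.shiftHom d g).app i n y,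
      congrArg (fun φ : T.costandardize (N.shift d) ⟶ T.costandardize (N.shift d) =>
        φ.app i n y) h1⟩

/-- Degree shifts commute with costandardization. -/
def costdShiftIso (d : ℤ) : (T.costandardize N).shift d ≅ T.costandardize (N.shift d) :=
  (T.nonempty_costd_shift_iso N d).choose

theorem ev_costdShiftIso (d : ℤ) (s : T.indices {l}) (n : ℤ)
    (v : (T.costandardize N).piece s (n + d)) :
    T.ev (N.shift d) s n ((T.costdShiftIso N d).hom.app s n v) = T.ev N s (n + d) v :=
  (T.nonempty_costd_shift_iso N d).choose_spec s n v

section series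

variable {N} {U V : GMod A} {Γ : Set Λ}

theorem hom_costd_shift_eq_zero {d : ℤ} (f : U ⟶ (T.costandardize N).shift d)
    (h : ∀ g : U ⟶ T.costandardize (N.shift d), g = 0) : f = 0 := by
  rw [← cancel_mono (T.costdShiftIso N d).hom, zero_comp]
  exact h _

/-- A map into j_*N is determined by its evaluations on the finitely many pieces of weight l. As U
is bounded below and N above, a map of degree d involves only finitely many degrees, and none if d
is large. -/
theorem homSeriesDefined (hU : U.LocallyFinite) (hb : U.BoundedBelow) (hN : N.LocallyFinite)
    (hNb : N.BoundedAbove) : U.HomSeriesDefined (T.costandardize N) := by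
  have := T.finite_indices l
  obtain ⟨a, ha⟩ := GMod.exists_lower_bound fun s : T.indices {l} => hb s
  -- Degrees are negated to reuse the lemma on lower bounds, so N vanishes in degrees above -b.
  obtain ⟨b, hb⟩ := GMod.exists_lower_bound fun s : T.indices {l} =>
    (hNb s).imp' (fun n => -n) fun M hM n hn => hM (-n) (by omega)
  have hb' : ∀ (s : T.indices {l}) n, -b < n → Subsingleton (N.piece s n) := fun s n hn => by
    simpa using hb s (-n) (by omega)
  have key : ∀ d (f : GMod.homDeg U (T.costandardize N) d),
      (∀ (s : T.indices {l}) n, a ≤ n → n ≤ -b - d → (T.ev N s (n + d)).comp (f.1 s n) = 0) →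
      f = 0 := by
    intro d f hf
    refine GMod.homDegToHom_injective ?_
    change GMod.homDegToHom f = 0
    rw [← cancel_mono (T.costdShiftIso N d).hom, zero_comp]
    refine T.hom_costd_eq_zero _ _ fun s n v => ?_
    refine (T.ev_costdShiftIso N d s n (f.1 s n v)).trans ?_
    by_cases h1 : n < a
    · have := ha s n h1
      rw [Subsingleton.elim v 0, map_zero]
      exact map_zero _
    by_cases h2 : -b - d < n
    · have := hb' s (n + d) (by omega)
      exact Subsingleton.elim (α := N.piece s (n + d)) _ _
    exact LinearMap.congr_fun (hf s n (not_lt.1 h1) (not_lt.1 h2)) v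
  refine ⟨fun d => ?_, -b - a, fun d hd => subsingleton_of_forall_eq 0 fun f =>
    key d f fun s n h1 h2 => absurd h1 (by omega)⟩
  have : ∀ (s : T.indices {l}) (n : Set.Icc a (-b - d)),
      FiniteDimensional k (U.piece s n →ₗ[k] N.piece s (n + d)) := fun s n => by
    have := hU s n
    have := hN s (n + d)
    infer_instance
  let F : GMod.homDeg U (T.costandardize N) d →ₗ[k]
      ∀ (s : T.indices {l}) (n : Set.Icc a (-b - d)), U.piece s n →ₗ[k] N.piece s (n + d) :=
    { toFun := fun f s n => (T.ev N s (n + d)).comp (f.1 s n)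
      map_add' := fun f g => by
        funext s n
        exact LinearMap.comp_add _ _ _
      map_smul' := fun c f => by
        funext s n
        exact LinearMap.comp_smul _ _ _ }
  refine FiniteDimensional.of_injective F ?_
  rw [injective_iff_map_eq_zero]
  intro f hf
  exact key d f fun s n h1 h2 => congrFun (congrFun hf s) ⟨n, h1, h2⟩

/-- For l ∈ Γ restriction to V_Γ is bijective on maps into j_*N, and V/V_Γ has no weight l part. -/
theorem homSeries_of_mem (hΓ : IsLowerSet Γ) (hl : l ∈ Γ) :
    (T.lowerPart V Γ).toGMod.homSeries (T.costandardize N) = V.homSeries (T.costandardize N) ∧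
      (T.lowerPart V Γ).quot.homSeries (T.costandardize N) = 0 := by
  refine ⟨GMod.homSeries_eq_of_precomp (T.lowerPart V Γ).incl (fun d f g h => ?_) fun d f => ?_,
    GMod.homSeries_eq_zero fun d f => T.hom_costd_shift_eq_zero f fun g => ?_⟩
  · rw [← cancel_mono (T.costdShiftIso N d).hom]
    exact T.hom_ext_lowerPart hl (by rw [← Category.assoc, h, Category.assoc])
  · obtain ⟨g, hg⟩ := T.exists_extension_lowerPart hΓ hl (f ≫ (T.costdShiftIso N d).hom)
    refine ⟨g ≫ (T.costdShiftIso N d).inv, ?_⟩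
    rw [← Category.assoc, hg, Category.assoc, Iso.hom_inv_id, Category.comp_id]
  · refine T.hom_costd_eq_zero _ g fun s n v => ?_
    have := T.quot_subsingleton V (T.indices_mono (by simpa using hl) s.2 : s.1 ∈ T.indices Γ) n
    rw [Subsingleton.elim v 0, map_zero, map_zero]

/-- For l ∉ Γ there are no maps from V_Γ to j_*N, so all maps from V factor through V/V_Γ. -/
theorem homSeries_of_notMem (hΓ : IsLowerSet Γ) (hl : l ∉ Γ) :
    (T.lowerPart V Γ).toGMod.homSeries (T.costandardize N) = 0 ∧
      (T.lowerPart V Γ).quot.homSeries (T.costandardize N) = V.homSeries (T.costandardize N) := by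
  have h0 : ∀ d (f : (T.lowerPart V Γ).toGMod ⟶ (T.costandardize N).shift d), f = 0 := fun d f =>
    T.hom_costd_shift_eq_zero f fun g => T.hom_lowerPart_eq_zero hΓ hl g
  refine ⟨GMod.homSeries_eq_zero h0, (GMod.homSeries_eq_of_precomp (T.lowerPart V Γ).proj
    (fun d f g h => (cancel_epi _).1 h) fun d f => ?_).symm⟩
  exact (T.lowerPart V Γ).ses_proj.exists_desc f (h0 d _)

end series

end TriangularBasis

variable {A : LUGAlg k I} {Λ : Type v} [PartialOrder Λ]

namespace TriangularBasis

variable {T : TriangularBasis A Λ}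

/-! ### Criteria for ascending flags with respect to a family of test modules -/

section criterion

variable {C : T.LayerTest} {B : Λ → Type w} {F : ∀ {l : Λ}, B l → GMod (T.algAt A l)}

theorem LayerTest.extOne_univ_iff
    (htest : ∀ {l : Λ} (N : GMod (T.algAt A l)), C.test N ↔ ∃ (b : B l) (d : ℤ), N = (F b).shift d)
    {V : GMod A} : C.ExtOne Set.univ V ↔
      ∀ (l : Λ) (b : B l), V.ExtVanishes (T.costandardize (F b)) 1 := by
  constructor
  · intro h l b d
    exact GMod.ext_of_iso_right (T.costdShiftIso (F b) d)
      (h l trivial _ ((htest _).2 ⟨b, d, rfl⟩))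
  · intro h l _ N hN
    obtain ⟨b, d, rfl⟩ := (htest N).1 hN
    exact GMod.ext_of_iso_right (T.costdShiftIso (F b) d).symm (h l b d)

/-- `hlayer` and `hext` are the two facts needed about the truncations: standardizations of
transported good modules are layers, and layers have no Ext¹ to the transported tests. -/
theorem LayerTest.ascendingFlag_tfae (hA : A.FiniteBelow)
    (htest : ∀ {l : Λ} (N : GMod (T.algAt A l)), C.test N ↔ ∃ (b : B l) (d : ℤ), N = (F b).shift d)
    {layer : ∀ Γ : Set Λ, Γ → GMod (A.corner (T.indices Γ)) → Prop}
    (hlayer : ∀ (Γ : Set Λ) (m : Γ) (M : GMod (T.algAt A m.1)), IsLowerSet Γ → C.good M →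
      M.LocallyFinite → M.BoundedBelow → ∀ U : GMod (A.corner (T.indices Γ)),
        Nonempty (U ≅ (T.restrict Γ).standardize (T.toCorner M)) → layer Γ m U)
    (hext : ∀ (Γ : Set Λ) (hΓ : IsLowerSet Γ) (m m' : Γ) (U : GMod (A.corner (T.indices Γ)))
      (N : GMod (T.algAt A m'.1)), layer Γ m U → C.test N →
        Subsingleton (Abelian.Ext U ((T.corner hΓ).costandardize (T.toCorner N)) 1))
    {V : GMod A} (hfin : V.LocallyFinite) (hbdd : V.BoundedBelow) :
    List.TFAE
      [C.HasAscendingFlag V,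
       ∀ Γ : Set Λ, IsLowerSet Γ → Γ.Finite →
         Weights.HasFlag (layer Γ) (V.truncate (T.indices Γ)),
       ∀ (l : Λ) (b : B l), V.ExtVanishes (T.costandardize (F b)) 1,
       ∀ (l : Λ) (b : B l) (n : ℕ), 1 ≤ n → V.ExtVanishes (T.costandardize (F b)) n] := by
  tfae_have 1 → 4 := by
    intro h l b n hn d
    obtain ⟨n, rfl⟩ := Nat.exists_eq_add_of_le' hn
    exact GMod.ext_of_iso_right (T.costdShiftIso (F b) d)
      (C.ext_of_hasAscendingFlag h ((htest _).2 ⟨b, d, rfl⟩) n)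
  tfae_have 4 → 3 := fun h l b => h l b 1 le_rfl
  tfae_have 3 → 1 := fun h =>
    C.hasAscendingFlag_of_extOne hA hfin hbdd ((extOne_univ_iff htest).2 h)
  tfae_have 3 → 2 := fun h Γ hΓ hf =>
    C.hasFlag_truncate hA hfin hbdd ((extOne_univ_iff htest).2 h) hΓ hf
      fun m M hM h₁ h₂ => hlayer Γ m M hΓ hM h₁ h₂
  tfae_have 2 → 3 := by
    -- For a test of weight l only the truncation to Γ = {≤ l} is used.
    refine fun h => (extOne_univ_iff htest).1 fun l _ N hN => ?_
    let m : Set.Iic l := ⟨l, le_rfl⟩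
    have h' := h _ (isLowerSet_Iic l) (T.lowerFinite l)
    have : Subsingleton (Abelian.Ext (V.truncate (T.indices (Set.Iic l)))
        ((T.corner (isLowerSet_Iic l)).costandardize (T.toCorner (m := m) N)) 1) :=
      h'.ext fun m' U hU => hext _ (isLowerSet_Iic l) m' m U N hU hN
    exact T.ext_one_of_truncate (isLowerSet_Iic l) (m := m) N V this
  tfae_finish

theorem LayerTest.hasAscendingFlag_lowerPart_quot (hA : A.FiniteBelow)
    {V : GMod A} (hfin : V.LocallyFinite) (hbdd : V.BoundedBelow) (hV : C.HasAscendingFlag V)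
    {Γ : Set Λ} (hΓ : IsLowerSet Γ) (hf : Γ.Finite) :
    C.HasAscendingFlag (T.lowerPart V Γ).toGMod ∧ C.HasAscendingFlag (T.lowerPart V Γ).quot := by
  have h : C.ExtOne Set.univ V := fun l _ N hN => C.ext_of_hasAscendingFlag hV hN 0
  have hi : ∀ i n, Function.Injective ((T.lowerPart V Γ).incl.app i n) :=
    fun _ _ => Subtype.val_injective
  have hs : ∀ i n, Function.Surjective ((T.lowerPart V Γ).proj.app i n) :=
    fun _ _ => Submodule.mkQ_surjective _
  exact ⟨C.hasAscendingFlag_of_extOne hA (hfin.of_injective _ hi) (hbdd.of_injective _ hi)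
      (C.extOne_lowerPart hA hfin hbdd h hΓ hf),
    C.hasAscendingFlag_of_extOne hA (hfin.of_surjective _ hs) (hbdd.of_surjective _ hs)
      (C.extOne_quot h hΓ)⟩

theorem homSeries_lowerPart_quot {V : GMod A} (hfin : V.LocallyFinite) (hbdd : V.BoundedBelow)
    {Γ : Set Λ} (hΓ : IsLowerSet Γ) {l : Λ} {N : GMod (T.algAt A l)} (hN : N.LocallyFinite)
    (hNb : N.BoundedAbove) :
    V.HomSeriesDefined (T.costandardize N) ∧
    (T.lowerPart V Γ).toGMod.HomSeriesDefined (T.costandardize N) ∧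
    (T.lowerPart V Γ).quot.HomSeriesDefined (T.costandardize N) ∧
    (l ∈ Γ →
      (T.lowerPart V Γ).toGMod.homSeries (T.costandardize N) = V.homSeries (T.costandardize N) ∧
      (T.lowerPart V Γ).quot.homSeries (T.costandardize N) = 0) ∧
    (l ∉ Γ →
      (T.lowerPart V Γ).toGMod.homSeries (T.costandardize N) = 0 ∧
      (T.lowerPart V Γ).quot.homSeries (T.costandardize N) =
        V.homSeries (T.costandardize N)) := by
  have hi : ∀ i n, Function.Injective ((T.lowerPart V Γ).incl.app i n) :=
    fun _ _ => Subtype.val_injective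
  have hs : ∀ i n, Function.Surjective ((T.lowerPart V Γ).proj.app i n) :=
    fun _ _ => Submodule.mkQ_surjective _
  exact ⟨T.homSeriesDefined hfin hbdd hN hNb,
    T.homSeriesDefined (hfin.of_injective _ hi) (hbdd.of_injective _ hi) hN hNb,
    T.homSeriesDefined (hfin.of_surjective _ hs) (hbdd.of_surjective _ hs) hN hNb,
    T.homSeries_of_mem hΓ, T.homSeries_of_notMem hΓ⟩

end criterion

/-! ### The two classes of test modules -/

section instances

variable (hA : A.FiniteBelow) (irr : Irreducibles.{u, v, w} A T.toWeights)

include hA in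
theorem exists_hom_shift_irreducible {l : Λ} {M : GMod (T.algAt A l)} (hM : M.LocallyFinite)
    (hb : M.BoundedBelow) {s : T.indices {l}} {n : ℤ} {x : M.piece s n} (hx : x ≠ 0) :
    ∃ (b : irr.B l) (d : ℤ) (φ : M ⟶ (irr.L b).shift d), φ ≠ 0 := by
  have := T.finite_indices l
  obtain ⟨S, φ, hS, hφ⟩ :=
    GMod.exists_simple_quotient (T.algAt_finiteBelow hA l) hM hb hx
  obtain ⟨b, d, ⟨e⟩⟩ := irr.exists_iso S hS
  refine ⟨b, d, φ ≫ e.hom, fun h => hφ ?_⟩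
  rwa [← cancel_mono e.hom, zero_comp]

/-- Projective modules and the shifts of the irreducible modules. -/
def irreducibleTest : T.LayerTest where
  test {l} N := ∃ (b : irr.B l) (d : ℤ), N = (irr.L b).shift d
  good M := Projective M
  ext_of_good {_ m _ N} hM _ n := T.acyclic_standardize _ _ hM m N n
  good_of_extends {l M} hM hb h := by
    have := T.finite_indices l
    refine GMod.projective_of_ext_simple (T.algAt_finiteBelow hA l) hM hb fun S hS => ?_
    obtain ⟨b, d, ⟨e⟩⟩ := irr.exists_iso S hS
    exact GMod.ext_of_iso_right e ((GMod.ses_ker M.coverMap_surjective).ext_right_one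
      (h _ ⟨b, d, rfl⟩) (GMod.ext_of_projective 0))
  exists_hom hM hb _ _ _ hx := by
    obtain ⟨b, d, φ, hφ⟩ := exists_hom_shift_irreducible hA irr hM hb hx
    exact ⟨_, φ, ⟨b, d, rfl⟩, hφ⟩

variable {E : ∀ {l : Λ}, irr.B l → GMod (T.algAt A l)}
  {ι : ∀ {l : Λ} (b : irr.B l), irr.L b ⟶ E b}
  (hι : ∀ {l : Λ} (b : irr.B l), GMod.IsInjectiveHull (ι b))

/-- Arbitrary modules and the shifts of the injective hulls of the irreducible modules. -/
def injectiveHullTest : T.LayerTest where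
  test {l} N := ∃ (b : irr.B l) (d : ℤ), N = (E b).shift d
  good _ := True
  ext_of_good {_ m M N} _ hN n := by
    obtain ⟨b, d, rfl⟩ := hN
    exact T.ext_std_costd_injective (GMod.injective_shift d (hι b).1) M n
  good_of_extends _ _ _ := trivial
  exists_hom hM hb _ _ _ hx := by
    obtain ⟨b, d, φ, hφ⟩ := exists_hom_shift_irreducible hA irr hM hb hx
    have := (hι b).2.1
    have : Mono (GMod.shiftMap d (ι b)) := GMod.mono_of_injective _ fun i n =>
      GMod.injective_of_mono (ι b) i (n + d)
    refine ⟨_, φ ≫ GMod.shiftMap d (ι b), ⟨b, d, rfl⟩, fun h => hφ ?_⟩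
    rwa [← cancel_mono (GMod.shiftMap d (ι b)), zero_comp]

theorem injectiveHullTest_layer {l : Λ} {U : GMod A} :
    (injectiveHullTest hA irr hι).layer l U ↔ T.IsDeltaBarLayer l U :=
  ⟨fun ⟨M, _, h⟩ => ⟨M, h⟩, fun ⟨M, h⟩ => ⟨M, trivial, h⟩⟩

theorem injectiveHullTest_hasAscendingFlag {V : GMod A} :
    (injectiveHullTest hA irr hι).HasAscendingFlag V ↔ T.HasAscendingDeltaBarFlag V :=
  ⟨fun h Γ hΓ hf => (h Γ hΓ hf).mono fun _ _ => (injectiveHullTest_layer hA irr hι).1,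
    fun h Γ hΓ hf => Weights.HasFlag.mono (fun _ _ => (injectiveHullTest_layer hA irr hι).2)
      (h Γ hΓ hf)⟩

include hA in
theorem ascendingDeltaFlag_tfae {V : GMod A} (hfin : V.LocallyFinite) (hbdd : V.BoundedBelow) :
    List.TFAE
      [T.HasAscendingDeltaFlag V,
       ∀ Γ : Set Λ, IsLowerSet Γ → Γ.Finite →
         (T.restrict Γ).HasDeltaFlag (V.truncate (T.indices Γ)),
       ∀ (l : Λ) (b : irr.B l), V.ExtVanishes (T.costandardize (irr.L b)) 1,
       ∀ (l : Λ) (b : irr.B l) (n : ℕ), 1 ≤ n →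
         V.ExtVanishes (T.costandardize (irr.L b)) n] :=
  (irreducibleTest hA irr).ascendingFlag_tfae hA (fun _ => Iff.rfl)
    (layer := fun Γ => (T.restrict Γ).IsDeltaLayer)
    (fun _ _ M hΓ hM h₁ h₂ _ hU => ⟨T.toCorner M, T.projective_toCorner hΓ hM,
      fun s n => h₁ (T.up s) n, fun s => h₂ (T.up s), hU⟩)
    (fun _ hΓ m m' _ N ⟨M, hM, _, _, ⟨e⟩⟩ _ => GMod.ext_of_iso e
      ((T.corner hΓ).acyclic_standardize m M hM m' (T.toCorner N) 0))
    hfin hbdd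

include hA hι in
theorem ascendingDeltaBarFlag_tfae {V : GMod A} (hfin : V.LocallyFinite)
    (hbdd : V.BoundedBelow) :
    List.TFAE
      [T.HasAscendingDeltaBarFlag V,
       ∀ Γ : Set Λ, IsLowerSet Γ → Γ.Finite →
         (T.restrict Γ).HasDeltaBarFlag (V.truncate (T.indices Γ)),
       ∀ (l : Λ) (b : irr.B l), V.ExtVanishes (T.costandardize (E b)) 1,
       ∀ (l : Λ) (b : irr.B l) (n : ℕ), 1 ≤ n →
         V.ExtVanishes (T.costandardize (E b)) n] := by
  rw [← injectiveHullTest_hasAscendingFlag hA irr hι]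
  refine (injectiveHullTest hA irr hι).ascendingFlag_tfae hA (fun _ => Iff.rfl)
    (layer := fun Γ => (T.restrict Γ).IsDeltaBarLayer)
    (fun Γ m M hΓ hM h₁ h₂ U hU => ⟨T.toCorner M, fun s n => h₁ (T.up s) n,
      fun s => h₂ (T.up s), hU⟩)
    (fun Γ hΓ m m' U N => ?_) hfin hbdd
  rintro ⟨M, _, _, ⟨e⟩⟩ ⟨b, d, rfl⟩
  exact GMod.ext_of_iso e ((T.corner hΓ).ext_std_costd_injective
    (T.injective_toCorner hΓ (GMod.injective_shift d (hι b).1)) M 0)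

end instances

end TriangularBasis

end

-- The main theorem

theorem mainTheorem7 {k : Type u} [Field k] [IsAlgClosed k] {I : Type u} (A : LUGAlg k I)
    (hA : A.FiniteBelow) {Λ : Type v} [PartialOrder Λ] (T : TriangularBasis A Λ)
    (irr : Irreducibles.{u, v, w} A T.toWeights)
    (E : ∀ {lam : Λ}, irr.B lam → GMod (T.algAt A lam))
    (ι : ∀ {lam : Λ} (b : irr.B lam), irr.L b ⟶ E b)
    (hι : ∀ {lam : Λ} (b : irr.B lam), GMod.IsInjectiveHull (ι b))
    (V : GMod A) (hfin : V.LocallyFinite) (hbdd : V.BoundedBelow) :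
    (List.TFAE
      [T.HasAscendingDeltaFlag V,
       ∀ Γ : Set Λ, IsLowerSet Γ → Γ.Finite →
         (T.restrict Γ).HasDeltaFlag (V.truncate (T.indices Γ)),
       ∀ (lam : Λ) (b : irr.B lam), V.ExtVanishes (T.costandardize (irr.L b)) 1,
       ∀ (lam : Λ) (b : irr.B lam) (n : ℕ), 1 ≤ n →
         V.ExtVanishes (T.costandardize (irr.L b)) n] ∧
      (T.HasAscendingDeltaFlag V → ∀ Γ : Set Λ, IsLowerSet Γ → Γ.Finite →
        T.HasAscendingDeltaFlag (T.lowerPart V Γ).toGMod ∧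
        T.HasAscendingDeltaFlag (T.lowerPart V Γ).quot ∧
        ∀ (lam : Λ) (b : irr.B lam),
          V.HomSeriesDefined (T.costandardize (irr.L b)) ∧
          (T.lowerPart V Γ).toGMod.HomSeriesDefined (T.costandardize (irr.L b)) ∧
          (T.lowerPart V Γ).quot.HomSeriesDefined (T.costandardize (irr.L b)) ∧
          (lam ∈ Γ →
            (T.lowerPart V Γ).toGMod.homSeries (T.costandardize (irr.L b)) =
              V.homSeries (T.costandardize (irr.L b)) ∧
            (T.lowerPart V Γ).quot.homSeries (T.costandardize (irr.L b)) = 0) ∧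
          (lam ∉ Γ →
            (T.lowerPart V Γ).toGMod.homSeries (T.costandardize (irr.L b)) = 0 ∧
            (T.lowerPart V Γ).quot.homSeries (T.costandardize (irr.L b)) =
              V.homSeries (T.costandardize (irr.L b))))) ∧
    (List.TFAE
      [T.HasAscendingDeltaBarFlag V,
       ∀ Γ : Set Λ, IsLowerSet Γ → Γ.Finite →
         (T.restrict Γ).HasDeltaBarFlag (V.truncate (T.indices Γ)),
       ∀ (lam : Λ) (b : irr.B lam), V.ExtVanishes (T.costandardize (E b)) 1,
       ∀ (lam : Λ) (b : irr.B lam) (n : ℕ), 1 ≤ n →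
         V.ExtVanishes (T.costandardize (E b)) n] ∧
      (T.HasAscendingDeltaBarFlag V → ∀ Γ : Set Λ, IsLowerSet Γ → Γ.Finite →
        T.HasAscendingDeltaBarFlag (T.lowerPart V Γ).toGMod ∧
        T.HasAscendingDeltaBarFlag (T.lowerPart V Γ).quot ∧
        ∀ (lam : Λ) (b : irr.B lam),
          V.HomSeriesDefined (T.costandardize (E b)) ∧
          (T.lowerPart V Γ).toGMod.HomSeriesDefined (T.costandardize (E b)) ∧
          (T.lowerPart V Γ).quot.HomSeriesDefined (T.costandardize (E b)) ∧
          (lam ∈ Γ →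
            (T.lowerPart V Γ).toGMod.homSeries (T.costandardize (E b)) =
              V.homSeries (T.costandardize (E b)) ∧
            (T.lowerPart V Γ).quot.homSeries (T.costandardize (E b)) = 0) ∧
          (lam ∉ Γ →
            (T.lowerPart V Γ).toGMod.homSeries (T.costandardize (E b)) = 0 ∧
            (T.lowerPart V Γ).quot.homSeries (T.costandardize (E b)) =
              V.homSeries (T.costandardize (E b))))) := by
  have hE : ∀ {lam : Λ} (b : irr.B lam), (E b).LocallyFinite ∧ (E b).BoundedAbove :=
    fun {lam} b => GMod.locallyFinite_of_isInjectiveHull (T.algAt_finiteBelow hA lam)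
      (irr.simple b) (hι b)
  -- A simple module inherits finiteness and the upper bound on degrees from its injective hull.
  have hL : ∀ {lam : Λ} (b : irr.B lam), (irr.L b).LocallyFinite ∧ (irr.L b).BoundedAbove :=
    fun b => by
      have := (hι b).2.1
      have hi := GMod.injective_of_mono (ι b)
      exact ⟨(hE b).1.of_injective _ hi, (hE b).2.of_injective _ hi⟩
  refine ⟨⟨TriangularBasis.ascendingDeltaFlag_tfae hA irr hfin hbdd, fun h Γ hΓ hf => ?_⟩,
    ⟨TriangularBasis.ascendingDeltaBarFlag_tfae hA irr hι hfin hbdd, fun h Γ hΓ hf => ?_⟩⟩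
  -- For this test class the layers are Δ-layers by definition. In the Δ̄ case the goodness
  -- condition is `True` and has to be inserted and removed.
  · obtain ⟨h₁, h₂⟩ := (TriangularBasis.irreducibleTest hA irr).hasAscendingFlag_lowerPart_quot
      hA hfin hbdd h hΓ hf
    exact ⟨h₁, h₂, fun lam b =>
      TriangularBasis.homSeries_lowerPart_quot hfin hbdd hΓ (hL b).1 (hL b).2⟩
  · rw [← TriangularBasis.injectiveHullTest_hasAscendingFlag hA irr hι] at h
    obtain ⟨h₁, h₂⟩ := TriangularBasis.LayerTest.hasAscendingFlag_lowerPart_quot hA hfin hbdd h hΓ hf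
    exact ⟨(TriangularBasis.injectiveHullTest_hasAscendingFlag hA irr hι).1 h₁,
      (TriangularBasis.injectiveHullTest_hasAscendingFlag hA irr hι).1 h₂, fun lam b =>
      TriangularBasis.homSeries_lowerPart_quot hfin hbdd hΓ (hE b).1 (hE b).2⟩
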